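/- **Setting.** Let $(\Omega,\mathcal F,(\mathcal F_t)_{t\ge 0},P)$ be a filtered probability space with two $(\mathcal F_t)$-Brownian motions $Z,W$, $d\langle Z,W\rangle_t=\rho\,dt$. Let $\kappa$ be a measurable kernel with $\int_0^T\kappa(x)^2dx<\infty$ for every $T$. An *affine forward variance (AFV) model* consists of a positive adapted price $S$ and nonnegative adapted forward variances $\xi_t(u)$, $0\le t\le u$, jointly measurable in $(u,\omega)$ for each $t$, with progressively measurable spot variance $V_t=\xi_t(t)$ and $E\int_0^T\xi_0(u)\,du<\infty$ for every $T$, such that $$\frac{dS_t}{S_t}=\sqrt{V_t}\,dZ_t,\qquad d\xi_t(u)=\kappa(u-t)\sqrt{V_t}\,dW_t\quad(0\le t\le u),$$ the stochastic integrals $\int_0^t\kappa(u-s)\sqrt{V_s}\,dW_s$ and $\int_0^t\sqrt{V_s}\,dZ_s$ being those of square-integrable integrands. Put $X=\log S$. Fix a maturity $T\ge 0$. The diamond product of two processes $A,B$ with integrable covariation process is $$(A\diamond B)_t(T)=E[\langle A,B\rangle_T\mid\mathcal F_t]-\langle A,B\rangle_t,\qquad 0\le t\le T.$$ A *diamond tree*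 $\mathbb T$ is a binary tree with at least one diamond product and all leaves equal to $X$, i.e. either $X\diamond X$, or $\mathbb T_1\diamond X$, $X\diamond\mathbb T_1$ or $\mathbb T_1\diamond\mathbb T_2$ with $\mathbb T_1,\mathbb T_2$ diamond trees; $\mathbb T_t(T)$ denotes its value, obtained by evaluating the diamond products recursively, at the same maturity $T$. For a quantity $A_s=\Phi_s(\xi_s)$ given by a functional $\Phi_s$ of the forward variance curve on $[s,T]$, the functional derivative $\delta A_s/\delta\xi_s(u)$ is the bounded density of the Fréchet differential of $\Phi_s$ on $L^1([s,T])$, and $$D^\xi_s A_s=\int_s^T\kappa(u-s)\,\frac{\delta A_s}{\delta\xi_s(u)}\,du$$ (this is $\frac1{\sqrt{V_s}}\int_s^T f_s(\xi)\,\kappa(u-s)\frac{\delta A_s}{\delta \xi_s(u)}du$ with $f_s(\xi)=\sqrt{V_s}$). **Lemma.** Let $\mathbb T$ be a diamond tree in an AFV model. Then all diamond products occurring in $\mathbb T$ and in $\mathbb T\diamond X$ are well defined (the covariation processes exist on $[0,T]$ and are integrable). There are functionals $\Phi_s$ of the forward variance curve, $0\le s\le T$, with $\mathbb T_s(T)=\Phi_s(\xi_s)$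 a.s. and with a functional derivative which does not depend on the curve. For every such family of functionals and every $t\in[0,T]$, almost surely $s\mapsto\xi_t(s)\,D^\xi_s\mathbb T_s(T)$ is integrable on $[t,T]$ and $$(\mathbb T\diamond X)_t(T)=\rho\int_t^T\xi_t(s)\,D^\xi_s\mathbb T_s(T)\,ds .$$ -/

import Mathlib

open MeasureTheory ProbabilityTheory Filter Topology
open scoped NNReal ENNReal

noncomputable section

/-- Lebesgue measure on the time axis `[0, ∞)`. -/
instance NNReal.lebesgueMeasureSpace : MeasureSpace ℝ≥0 :=
  ⟨Measure.comap ((↑) : ℝ≥0 → ℝ) volume⟩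

/-! ### Covariation of stochastic processes -/

/-- A finite partition `0 = pts 0 ≤ pts 1 ≤ … ≤ pts n = t` of the time interval `[0, t]`. -/
structure TimePartition (t : ℝ≥0) where
  n : ℕ
  pts : ℕ → ℝ≥0
  mono : Monotone pts
  zero : pts 0 = 0
  last : pts n = t

/-- The mesh of a partition. -/
def TimePartition.mesh {t : ℝ≥0} (p : TimePartition t) : ℝ≥0 :=
  (Finset.range p.n).sup fun i => p.pts (i + 1) - p.pts i

/-- The sum of the products of the increments of `A` and `B` along a partition. -/
def TimePartition.covSum {t : ℝ≥0} {Ω : Type*} (p : TimePartition t) (A B : ℝ≥0 → Ω → ℝ)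
    (ω : Ω) : ℝ :=
  ∑ i ∈ Finset.range p.n,
    (A (p.pts (i + 1)) ω - A (p.pts i) ω) * (B (p.pts (i + 1)) ω - B (p.pts i) ω)

/-- `C` is the covariation process `⟨A, B⟩` on `[0, T]`: for each `t ≤ T`, the sums of products of
increments converge to `C t` in probability along every sequence of partitions of `[0, t]` whose
mesh tends to zero. -/
def HasCovariation {Ω : Type*} [MeasurableSpace Ω] (P : Measure Ω) (T : ℝ≥0)
    (A B C : ℝ≥0 → Ω → ℝ) : Prop :=
  ∀ t ≤ T, ∀ p : ℕ → TimePartition t, Tendsto (fun k => (p k).mesh) atTop (𝓝 0) →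
    TendstoInMeasure P (fun k => (p k).covSum A B) atTop (C t)

/-- `A` and `B` have an integrable covariation process on `[0, T]`. -/
def HasIntegrableCovariation {Ω : Type*} [MeasurableSpace Ω] (P : Measure Ω) (T : ℝ≥0)
    (A B : ℝ≥0 → Ω → ℝ) : Prop :=
  ∃ C : ℝ≥0 → Ω → ℝ, HasCovariation P T A B C ∧ ∀ t ≤ T, Integrable (C t) P

open Classical in
/-- The covariation process `⟨A, B⟩` on `[0, T]`. It is unique up to modification; it is meaningful
only under `HasIntegrableCovariation P T A B`, and is set to zero otherwise. -/
def covariation {Ω : Type*} [MeasurableSpace Ω] (P : Measure Ω) (T : ℝ≥0)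
    (A B : ℝ≥0 → Ω → ℝ) : ℝ≥0 → Ω → ℝ :=
  if h : HasIntegrableCovariation P T A B then h.choose else 0

/-! ### Brownian motion and the Itô integral -/

/-- `B` is a Brownian motion with respect to the filtration `𝓕`. -/
structure IsBrownianWrt {Ω : Type*} [mΩ : MeasurableSpace Ω] (𝓕 : Filtration ℝ≥0 mΩ)
    (P : Measure Ω) (B : ℝ≥0 → Ω → ℝ) : Prop where
  brownian : IsBrownianReal B P
  adapted : StronglyAdapted 𝓕 B
  indep : ∀ s t : ℝ≥0, s ≤ t →
    Indep (MeasurableSpace.comap (fun ω => B t ω - B s ω) inferInstance) (𝓕 s) P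

/-- A simple predictable process `∑_{i < n} η i · 1_{(t i, t (i+1)]}` with bounded,
`𝓕 (t i)`-measurable coefficients. -/
structure SimpleProcess {Ω : Type*} [mΩ : MeasurableSpace Ω] (𝓕 : Filtration ℝ≥0 mΩ) where
  n : ℕ
  time : ℕ → ℝ≥0
  mono : Monotone time
  η : ℕ → Ω → ℝ
  measurable : ∀ i, StronglyMeasurable[𝓕 (time i)] (η i)
  bounded : ∀ i, ∃ c : ℝ, ∀ ω, |η i ω| ≤ c

/-- The value of a simple process at time `s`. -/
def SimpleProcess.val {Ω : Type*} [mΩ : MeasurableSpace Ω] {𝓕 : Filtration ℝ≥0 mΩ}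
    (H : SimpleProcess 𝓕) (s : ℝ≥0) (ω : Ω) : ℝ :=
  ∑ i ∈ Finset.range H.n, (Set.Ioc (H.time i) (H.time (i + 1))).indicator (fun _ => H.η i ω) s

/-- The elementary stochastic integral `∫_0^t H dB` of a simple process. -/
def SimpleProcess.integral {Ω : Type*} [mΩ : MeasurableSpace Ω] {𝓕 : Filtration ℝ≥0 mΩ}
    (H : SimpleProcess 𝓕) (B : ℝ≥0 → Ω → ℝ) (t : ℝ≥0) (ω : Ω) : ℝ :=
  ∑ i ∈ Finset.range H.n, H.η i ω * (B (min (H.time (i + 1)) t) ω - B (min (H.time i) t) ω)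

/-- `N = ∫_0^t H_s dB_s` (Itô integral of a square-integrable integrand): simple processes converge
to `H` in `L²(ds ⊗ P)` on `(0, t] × Ω` while their elementary integrals converge to `N` in
`L²(P)`. -/
def IsItoIntegral {Ω : Type*} [mΩ : MeasurableSpace Ω] (𝓕 : Filtration ℝ≥0 mΩ) (P : Measure Ω)
    (B : ℝ≥0 → Ω → ℝ) (H : ℝ≥0 → Ω → ℝ) (t : ℝ≥0) (N : Ω → ℝ) : Prop :=
  AEStronglyMeasurable (fun p : ℝ≥0 × Ω => H p.1 p.2) ((volume.restrict (Set.Ioc 0 t)).prod P) ∧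
  AEStronglyMeasurable N P ∧
  ∃ Hn : ℕ → SimpleProcess 𝓕,
    Tendsto (fun k => eLpNorm (fun p : ℝ≥0 × Ω => (Hn k).val p.1 p.2 - H p.1 p.2) 2
      ((volume.restrict (Set.Ioc 0 t)).prod P)) atTop (𝓝 0) ∧
    Tendsto (fun k => eLpNorm (fun ω => (Hn k).integral B t ω - N ω) 2 P) atTop (𝓝 0)

/-! ### Affine forward variance models -/

/-- An affine forward variance model with kernel `κ` and correlation `ρ`:
`dS_t / S_t = √V_t dZ_t`, `dξ_t(u) = κ(u - t) √V_t dW_t`, `V_t = ξ_t(t)`, `d⟨Z, W⟩_t = ρ dt`.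
Here `ξ t u` is the forward variance `ξ_t(u)`, meaningful for `t ≤ u`. -/
structure AFVModel {Ω : Type*} [mΩ : MeasurableSpace Ω] (P : Measure Ω) (κ : ℝ → ℝ) (ρ : ℝ) where
  /-- The filtration. -/
  𝓕 : Filtration ℝ≥0 mΩ
  /-- The Brownian motion driving the asset price. -/
  Z : ℝ≥0 → Ω → ℝ
  /-- The Brownian motion driving the forward variances. -/
  W : ℝ≥0 → Ω → ℝ
  /-- The asset price. -/
  S : ℝ≥0 → Ω → ℝ
  /-- The forward variance curves. -/
  ξ : ℝ≥0 → ℝ≥0 → Ω → ℝ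
  kernel_measurable : Measurable κ
  kernel_sq_integrable : ∀ T : ℝ≥0, IntegrableOn (fun x => κ x ^ 2) (Set.Ioc 0 (T : ℝ)) volume
  Z_brownian : IsBrownianWrt 𝓕 P Z
  W_brownian : IsBrownianWrt 𝓕 P W
  correlation : ∀ T : ℝ≥0, HasCovariation P T Z W (fun t _ => ρ * t)
  /-- At each time `t` the curve `u ↦ ξ_t(u)` is jointly measurable and known at time `t`. -/
  ξ_measurable : ∀ t : ℝ≥0,
    Measurable[@Prod.instMeasurableSpace ℝ≥0 Ω inferInstance (𝓕 t)] (fun p : ℝ≥0 × Ω => ξ t p.1 p.2)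
  variance_progressive : IsStronglyProgressive 𝓕 (fun t => ξ t t)
  ξ_nonneg : ∀ t u : ℝ≥0, t ≤ u → ∀ᵐ ω ∂P, 0 ≤ ξ t u ω
  initial_integrable : ∀ T : ℝ≥0,
    Integrable (fun p : ℝ≥0 × Ω => ξ 0 p.1 p.2) ((volume.restrict (Set.Icc 0 T)).prod P)
  /-- `ξ_t(u) - ξ_0(u) = ∫_0^t κ(u - s) √V_s dW_s`. -/
  ξ_dynamics : ∀ t u : ℝ≥0, t ≤ u →
    IsItoIntegral 𝓕 P W (fun s ω => κ ((u : ℝ) - s) * √(ξ s s ω)) t (fun ω => ξ t u ω - ξ 0 u ω)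
  S_adapted : StronglyAdapted 𝓕 S
  S_pos : ∀ᵐ ω ∂P, 0 < S 0 ω
  /-- `S` is the solution `S_0 exp(∫_0^t √V_s dZ_s - ½ ∫_0^t V_s ds)` of `dS = S √V dZ`. -/
  S_dynamics : ∃ R : ℝ≥0 → Ω → ℝ,
    (∀ t : ℝ≥0, IsItoIntegral 𝓕 P Z (fun s ω => √(ξ s s ω)) t (R t)) ∧
    ∀ t : ℝ≥0, ∀ᵐ ω ∂P,
      S t ω = S 0 ω * Real.exp (R t ω - (1 / 2) * ∫ s in Set.Ioc 0 t, ξ s s ω)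

/-- The log-price `X = log S`. -/
def AFVModel.X {Ω : Type*} [mΩ : MeasurableSpace Ω] {P : Measure Ω} {κ : ℝ → ℝ} {ρ : ℝ}
    (M : AFVModel P κ ρ) (t : ℝ≥0) (ω : Ω) : ℝ :=
  Real.log (M.S t ω)

/-! ### Diamond products and diamond trees -/

/-- The diamond product `(A ⋄ B)_t(T) = E[⟨A, B⟩_T | 𝓕_t] - ⟨A, B⟩_t`. -/
def diamond {Ω : Type*} [mΩ : MeasurableSpace Ω] (𝓕 : Filtration ℝ≥0 mΩ) (P : Measure Ω) (T : ℝ≥0)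
    (A B : ℝ≥0 → Ω → ℝ) (t : ℝ≥0) (ω : Ω) : ℝ :=
  (P[covariation P T A B T | 𝓕 t]) ω - covariation P T A B t ω

/-- Binary diamond trees, all of whose leaves are the log-price `X`; `node` is root joining. -/
inductive DiamondTree : Type
  | leaf : DiamondTree
  | node : DiamondTree → DiamondTree → DiamondTree

/-- The process `t ↦ 𝕋_t(T)` of a diamond tree in an affine forward variance model. -/
def AFVModel.tree {Ω : Type*} [mΩ : MeasurableSpace Ω] {P : Measure Ω} {κ : ℝ → ℝ} {ρ : ℝ}
    (M : AFVModel P κ ρ) (T : ℝ≥0) : DiamondTree → ℝ≥0 → Ω → ℝ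
  | .leaf => M.X
  | .node a b => diamond M.𝓕 P T (M.tree T a) (M.tree T b)

/-- All diamond products occurring in the tree are well defined: the factors have an integrable
covariation process on `[0, T]`. -/
def AFVModel.TreeWellDefined {Ω : Type*} [mΩ : MeasurableSpace Ω] {P : Measure Ω} {κ : ℝ → ℝ}
    {ρ : ℝ} (M : AFVModel P κ ρ) (T : ℝ≥0) : DiamondTree → Prop
  | .leaf => True
  | .node a b => M.TreeWellDefined T a ∧ M.TreeWellDefined T b ∧
      HasIntegrableCovariation P T (M.tree T a) (M.tree T b)

/-! ### Functional derivatives in the forward variance curve -/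

/-- The functional `Φ` of curves on `[s, T]` has functional derivative `δ` at the curve `x`: it is
Fréchet differentiable at `x` with respect to the `L¹([s, T])` norm, with differential
`y ↦ ∫_s^T δ(u) y(u) du` for an (essentially bounded) density `δ(u) = δΦ/δx(u)`. -/
def HasFunctionalDerivAt (s T : ℝ≥0) (Φ : (ℝ≥0 → ℝ) → ℝ) (δ : ℝ≥0 → ℝ) (x : ℝ≥0 → ℝ) : Prop :=
  AEStronglyMeasurable δ (volume.restrict (Set.Icc s T)) ∧
  (∃ c : ℝ, ∀ᵐ u ∂(volume.restrict (Set.Icc s T)), |δ u| ≤ c) ∧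
  ∀ ε > (0 : ℝ), ∃ r > (0 : ℝ), ∀ y : ℝ≥0 → ℝ, IntegrableOn y (Set.Icc s T) →
    (∫ u in Set.Icc s T, |y u|) ≤ r →
    |Φ (x + y) - Φ x - ∫ u in Set.Icc s T, δ u * y u| ≤ ε * ∫ u in Set.Icc s T, |y u|

/-- The process `A` on `[0, T]` is given by functionals of the forward variance curve,
`A_s = Φ_s(ξ_s)`, where `Φ_s` depends on the restriction of the curve to `[s, T]`, and the
functional derivative `δΦ_s / δξ_s(u)` is `δ s u` at every curve. -/
structure AFVModel.IsCurveFunctional {Ω : Type*} [mΩ : MeasurableSpace Ω] {P : Measure Ω}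
    {κ : ℝ → ℝ} {ρ : ℝ} (M : AFVModel P κ ρ) (T : ℝ≥0) (A : ℝ≥0 → Ω → ℝ)
    (Φ : ℝ≥0 → (ℝ≥0 → ℝ) → ℝ) (δ : ℝ≥0 → ℝ≥0 → ℝ) : Prop where
  eq_functional : ∀ s ≤ T, A s =ᵐ[P] fun ω => Φ s (fun u => M.ξ s u ω)
  hasDeriv : ∀ s ≤ T, ∀ x : ℝ≥0 → ℝ, IntegrableOn x (Set.Icc s T) →
    HasFunctionalDerivAt s T (Φ s) (δ s) x

/-- `D^ξ_s A_s = V_s^{-1/2} ∫_s^T f_s(ξ) κ(u - s) δA_s/δξ_s(u) du` for a quantity with functional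
derivative `δ(u) = δA_s/δξ_s(u)`; in an affine forward variance model `f_s(ξ) = √V_s`, so that the
prefactor cancels. -/
def Dxi (κ : ℝ → ℝ) (T s : ℝ≥0) (δ : ℝ≥0 → ℝ) : ℝ :=
  ∫ u in Set.Ioc s T, κ ((u : ℝ) - s) * δ u

end

/-! ### Lebesgue measure on the half-line -/

/-! Every tree other than a leaf is, up to modification, a tail ∫_t^T ξ_t(s) g(s) ds with a
deterministic bounded weight g (`AFVModel.tree_eq_tail`). By stochastic Fubini applied to dξ_t(u) =
κ(u-t)√V_t dW_t, such a tail plus ∫_0^t V_s g(s) ds is a martingale with integrand √V_t h(t), where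
h(t) = ∫_t^T κ(u-t) g(u) du (`AFVModel.isItoPair_tail`). Again h is bounded, as κ is integrable on
(0, T]. The log-price has integrand √V with respect to Z, so h = 1. Two Itô processes with
integrands √V h and √V h' have covariation c ∫ V h h' ds, with c = 1 or c = ρ according to the
drivers, and E[V_s | F_t] = ξ_t(s) turns their diamond product into the tail with weight c h h'
(`AFVModel.hasIntegrableCovariation_and_diamond`). This is the induction step; for 𝕋 and X it is the
asserted formula, for the particular derivative g.

Covariations are limits in probability of sums over partitions. Pairs (integrand, Itô integral) form
a closed subspace of a Hilbert space; the sums are bilinear in such pairs and bounded into L¹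
uniformly in the partition, so convergence need only be checked for elementary integrands, where it
reduces to stopped Brownian motions. Drift terms disappear by Cauchy–Schwarz.

For an arbitrary family Φ_s with curve-independent derivative δ_s, the functional is affine, so
∫_s^T ξ_s(u)(δ_s - g)(u) du is a.s. constant. By the isometry its martingale integrand vanishes
before s. If the operators D^ξ_s of δ_s and g differ, continuity in time keeps the deterministic
factor of that integrand nonzero shortly before s, so V_r = 0 a.s. for a.e. r in a left
neighbourhood of s. A covering argument makes the set of such s with V_s not a.s. zero a null set
(`AFVModel.ae_variance_eq_zero_or_Dxi_eq`), and V_s = 0 a.s. forces ξ_t(s) = E[V_s | F_t] = 0. -/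

theorem NNReal.measurableEmbedding_coe : MeasurableEmbedding ((↑) : ℝ≥0 → ℝ) :=
  MeasurableEmbedding.subtype_coe measurableSet_Ici

theorem NNReal.volume_apply (s : Set ℝ≥0) :
    (volume : Measure ℝ≥0) s = volume ((↑) '' s : Set ℝ) :=
  NNReal.measurableEmbedding_coe.comap_apply _ _

theorem NNReal.map_coe_volume :
    (volume : Measure ℝ≥0).map ((↑) : ℝ≥0 → ℝ) = volume.restrict (Set.Ici 0) := by
  have h := NNReal.measurableEmbedding_coe.map_comap volume
  rwa [show Set.range ((↑) : ℝ≥0 → ℝ) = Set.Ici 0 from Subtype.range_coe] at h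

instance NNReal.sigmaFinite_volume : SigmaFinite (volume : Measure ℝ≥0) := by
  have : SigmaFinite ((volume : Measure ℝ≥0).map ((↑) : ℝ≥0 → ℝ)) := by
    rw [NNReal.map_coe_volume]; infer_instance
  exact SigmaFinite.of_map _ NNReal.measurableEmbedding_coe.measurable.aemeasurable this

instance NNReal.nullSingletonClass_volume : NullSingletonClass (volume : Measure ℝ≥0) where
  measure_singleton x := by
    rw [NNReal.volume_apply, Set.image_singleton, measure_singleton]

theorem NNReal.volume_Ioc (a b : ℝ≥0) : volume (Set.Ioc a b) = ENNReal.ofReal ((b : ℝ) - a) := by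
  rw [NNReal.volume_apply]
  have : ((↑) '' Set.Ioc a b : Set ℝ) = Set.Ioc (a : ℝ) b := by
    ext x
    simp only [Set.mem_image, Set.mem_Ioc]
    constructor
    · rintro ⟨y, ⟨h1, h2⟩, rfl⟩
      exact ⟨by exact_mod_cast h1, by exact_mod_cast h2⟩
    · rintro ⟨h1, h2⟩
      have hx : 0 ≤ x := a.2.trans h1.le
      exact ⟨⟨x, hx⟩, ⟨by exact_mod_cast h1, by exact_mod_cast h2⟩, rfl⟩
  rw [this, Real.volume_Ioc]

theorem NNReal.measureReal_Ioc {a b : ℝ≥0} (h : a ≤ b) :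
    (volume : Measure ℝ≥0).real (Set.Ioc a b) = b - a := by
  rw [measureReal_def, NNReal.volume_Ioc, ENNReal.toReal_ofReal (by simpa using h)]

theorem NNReal.volume_Ioc_lt_top (a b : ℝ≥0) : volume (Set.Ioc a b) < ⊤ := by
  rw [NNReal.volume_Ioc]; exact ENNReal.ofReal_lt_top

instance NNReal.isFiniteMeasure_restrict_Ioc (a b : ℝ≥0) :
    IsFiniteMeasure ((volume : Measure ℝ≥0).restrict (Set.Ioc a b)) :=
  ⟨by rw [Measure.restrict_apply_univ]; exact NNReal.volume_Ioc_lt_top a b⟩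

/-! ### Moments of Brownian increments -/

section Brownian

variable {Ω : Type*} [mΩ : MeasurableSpace Ω] {𝓕 : Filtration ℝ≥0 mΩ} {P : Measure Ω}
  {B : ℝ≥0 → Ω → ℝ}

/-- Only the scaling in the variance matters; the value of the standard fourth moment is never
needed. -/
theorem integral_pow_four_gaussianReal (v : ℝ≥0) :
    ∫ x, x ^ 4 ∂(gaussianReal 0 v) = v ^ 2 * ∫ x, x ^ 4 ∂(gaussianReal 0 1) := by
  have h : (gaussianReal 0 1).map (fun x => √(v : ℝ) * x) = gaussianReal 0 v := by
    rw [gaussianReal_map_const_mul]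
    congr 1
    · simp
    · ext; simp
  rw [← h, integral_map (by fun_prop) (by fun_prop), ← integral_const_mul]
  congr 1 with x
  rw [mul_pow, show (√(v : ℝ)) ^ 4 = (√(v : ℝ) ^ 2) ^ 2 by ring, Real.sq_sqrt v.coe_nonneg]

theorem IsBrownianWrt.hasLaw_sub (hB : IsBrownianWrt 𝓕 P B) {s t : ℝ≥0} (h : s ≤ t) :
    HasLaw (fun ω => B t ω - B s ω) (gaussianReal 0 (t - s)) P := by
  have h1 := hB.brownian.hasLaw_sub t s
  have h2 : nndist (t : ℝ) (s : ℝ) = t - s := by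
    ext
    rw [coe_nndist, Real.dist_eq, abs_of_nonneg (by simpa using h), NNReal.coe_sub h]
  rwa [show nndist t.1 s.1 = t - s from h2] at h1

theorem IsBrownianWrt.memLp_sub (hB : IsBrownianWrt 𝓕 P B) (s t : ℝ≥0) {p : ℝ≥0∞} (hp : p ≠ ⊤) :
    MemLp (fun ω => B t ω - B s ω) p P := by
  have h1 := hB.brownian.hasLaw_sub t s
  have h2 := memLp_id_gaussianReal' (μ := 0) (v := nndist t.1 s.1) p hp
  rw [← h1.map_eq] at h2
  exact h2.comp_of_map h1.aemeasurable

theorem IsBrownianWrt.integral_sub (hB : IsBrownianWrt 𝓕 P B) {s t : ℝ≥0} (h : s ≤ t) :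
    ∫ ω, (B t ω - B s ω) ∂P = 0 := by
  have := (hB.hasLaw_sub h).integral_eq
  rw [integral_id_gaussianReal] at this
  exact this

theorem IsBrownianWrt.integral_sub_sq (hB : IsBrownianWrt 𝓕 P B) {s t : ℝ≥0} (h : s ≤ t) :
    ∫ ω, (B t ω - B s ω) ^ 2 ∂P = t - s := by
  have h1 := (hB.hasLaw_sub h).variance_eq
  rw [variance_id_gaussianReal, variance_of_integral_eq_zero (hB.hasLaw_sub h).aemeasurable
    (hB.integral_sub h)] at h1
  rw [← NNReal.coe_sub h, ← h1]

theorem IsBrownianWrt.integral_sub_pow_four (hB : IsBrownianWrt 𝓕 P B) {s t : ℝ≥0} (h : s ≤ t) :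
    ∫ ω, (B t ω - B s ω) ^ 4 ∂P = ((t : ℝ) - s) ^ 2 * ∫ x, x ^ 4 ∂(gaussianReal 0 1) := by
  have h1 := (hB.hasLaw_sub h).integral_comp (f := fun x : ℝ => x ^ 4) (by fun_prop)
  simp only [Function.comp_def] at h1
  rw [h1, integral_pow_four_gaussianReal, NNReal.coe_sub h]

theorem IsBrownianWrt.indepFun (hB : IsBrownianWrt 𝓕 P B) {s t : ℝ≥0} (h : s ≤ t) {η : Ω → ℝ}
    (hη : StronglyMeasurable[𝓕 s] η) : IndepFun η (fun ω => B t ω - B s ω) P := by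
  rw [IndepFun_iff_Indep]
  exact indep_of_indep_of_le_left (hB.indep s t h).symm hη.measurable.comap_le

theorem IsBrownianWrt.measurable (hB : IsBrownianWrt 𝓕 P B) (t : ℝ≥0) : Measurable (B t) :=
  ((hB.adapted t).mono (𝓕.le t)).measurable

/-- An `𝓕 s`-measurable factor and a function of the increment `B t - B s` can be integrated
separately. -/
theorem IsBrownianWrt.integral_mul_comp_sub (hB : IsBrownianWrt 𝓕 P B) {s t : ℝ≥0} (h : s ≤ t)
    {η : Ω → ℝ} (hη : StronglyMeasurable[𝓕 s] η) {f : ℝ → ℝ} (hf : Measurable f) :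
    ∫ ω, η ω * f (B t ω - B s ω) ∂P = (∫ ω, η ω ∂P) * ∫ ω, f (B t ω - B s ω) ∂P := by
  have h1 := (hB.indepFun h hη).comp (φ := id) measurable_id hf
  have := hB.measurable t
  have := hB.measurable s
  exact h1.integral_mul_eq_mul_integral (hη.mono (𝓕.le s)).aestronglyMeasurable
    (Measurable.aestronglyMeasurable (by fun_prop))

theorem IsBrownianWrt.integral_mul_sub (hB : IsBrownianWrt 𝓕 P B) {s t : ℝ≥0} (h : s ≤ t)
    {η : Ω → ℝ} (hη : StronglyMeasurable[𝓕 s] η) :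
    ∫ ω, η ω * (B t ω - B s ω) ∂P = 0 := by
  have := hB.integral_mul_comp_sub h hη measurable_id
  simpa only [id, hB.integral_sub h, mul_zero] using this

theorem IsBrownianWrt.integral_mul_sub_sq (hB : IsBrownianWrt 𝓕 P B) {s t : ℝ≥0} (h : s ≤ t)
    {η : Ω → ℝ} (hη : StronglyMeasurable[𝓕 s] η) :
    ∫ ω, η ω * (B t ω - B s ω) ^ 2 ∂P = (∫ ω, η ω ∂P) * (t - s) := by
  rw [hB.integral_mul_comp_sub h hη (f := fun x => x ^ 2) (by fun_prop), hB.integral_sub_sq h]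

theorem IsBrownianWrt.condExp_eq_of_le [IsProbabilityMeasure P] (hB : IsBrownianWrt 𝓕 P B)
    {s t : ℝ≥0} (h : s ≤ t) :
    P[fun ω => B t ω - B s ω | 𝓕 s] =ᵐ[P] 0 := by
  have h1 := condExp_indep_eq (m₁ := MeasurableSpace.comap (fun ω => B t ω - B s ω) inferInstance)
    (f := fun ω => B t ω - B s ω) (μ := P)
    (((hB.measurable t).sub (hB.measurable s)).comap_le) (𝓕.le s)
    (comap_measurable _).stronglyMeasurable (hB.indep s t h)
  filter_upwards [h1] with ω hω
  rw [hω, hB.integral_sub h]; rfl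

end Brownian

/-! ### The Itô isometry as a closed subspace of `L²(ds ⊗ P) × L²(P)` -/

theorem MeasureTheory.L2.inner_eq_integral_mul {α : Type*} {mα : MeasurableSpace α} {μ : Measure α}
    (f g : Lp ℝ 2 μ) : inner ℝ f g = ∫ a, f a * g a ∂μ := by
  rw [L2.inner_def]
  congr 1 with a
  simp [mul_comm]

theorem MeasureTheory.L2.norm_sq_eq_integral {α : Type*} {mα : MeasurableSpace α} {μ : Measure α}
    (f : Lp ℝ 2 μ) : ‖f‖ ^ 2 = ∫ a, f a ^ 2 ∂μ := by
  rw [← real_inner_self_eq_norm_sq, L2.inner_eq_integral_mul]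
  simp_rw [pow_two]

section ItoSpace

variable {Ω : Type*} [mΩ : MeasurableSpace Ω]

/-- The Hilbert space of pairs of an integrand and a random variable. -/
abbrev ItoSpace (P : Measure Ω) : Type _ :=
  WithLp 2 (Lp ℝ 2 ((volume : Measure ℝ≥0).prod P) × Lp ℝ 2 P)

/-- The integrand `η · 1_{(a, b]}`. -/
noncomputable def elemVal (a b : ℝ≥0) (η : Ω → ℝ) (p : ℝ≥0 × Ω) : ℝ :=
  (Set.Ioc a b).indicator (fun _ => η p.2) p.1

/-- The integral `η (B b - B a)` of `η · 1_{(a, b]}`. -/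
noncomputable def elemInt (B : ℝ≥0 → Ω → ℝ) (a b : ℝ≥0) (η : Ω → ℝ) (ω : Ω) : ℝ :=
  η ω * (B b ω - B a ω)

/-- Pairs of an elementary integrand and its integral. -/
noncomputable def itoGenerators (𝓕 : Filtration ℝ≥0 mΩ) (P : Measure Ω) (B : ℝ≥0 → Ω → ℝ) : Set (ItoSpace P) :=
  {x | ∃ (a b : ℝ≥0) (η : Ω → ℝ), a ≤ b ∧ StronglyMeasurable[𝓕 a] η ∧ (∃ c : ℝ, ∀ ω, |η ω| ≤ c) ∧
    x.fst =ᵐ[(volume : Measure ℝ≥0).prod P] elemVal a b η ∧ x.snd =ᵐ[P] elemInt B a b η}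

/-- The closed subspace of all pairs of a square-integrable integrand and its Itô integral. -/
noncomputable def itoSubmodule (𝓕 : Filtration ℝ≥0 mΩ) (P : Measure Ω) (B : ℝ≥0 → Ω → ℝ) :
    Submodule ℝ (ItoSpace P) :=
  (Submodule.span ℝ (itoGenerators 𝓕 P B)).topologicalClosure

/-- `N` is the Itô integral of `H` over `[0, ∞)`. -/
noncomputable def IsItoPair (𝓕 : Filtration ℝ≥0 mΩ) (P : Measure Ω) (B : ℝ≥0 → Ω → ℝ) (H : ℝ≥0 × Ω → ℝ)
    (N : Ω → ℝ) : Prop :=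
  ∃ x ∈ itoSubmodule 𝓕 P B, x.fst =ᵐ[(volume : Measure ℝ≥0).prod P] H ∧ x.snd =ᵐ[P] N

variable {𝓕 : Filtration ℝ≥0 mΩ} {P : Measure Ω} {B : ℝ≥0 → Ω → ℝ} {H H' : ℝ≥0 × Ω → ℝ}
  {N N' : Ω → ℝ}

theorem IsItoPair.memLp_fst (h : IsItoPair 𝓕 P B H N) :
    MemLp H 2 ((volume : Measure ℝ≥0).prod P) := by
  obtain ⟨x, -, h1, -⟩ := h
  exact (memLp_congr_ae h1).1 (Lp.memLp _)

theorem IsItoPair.memLp_snd (h : IsItoPair 𝓕 P B H N) : MemLp N 2 P := by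
  obtain ⟨x, -, -, h1⟩ := h
  exact (memLp_congr_ae h1).1 (Lp.memLp _)

theorem IsItoPair.congr (h : IsItoPair 𝓕 P B H N)
    (h1 : H =ᵐ[(volume : Measure ℝ≥0).prod P] H') (h2 : N =ᵐ[P] N') : IsItoPair 𝓕 P B H' N' := by
  obtain ⟨x, hx, h3, h4⟩ := h
  exact ⟨x, hx, h3.trans h1, h4.trans h2⟩

theorem IsItoPair.sub (h : IsItoPair 𝓕 P B H N) (h' : IsItoPair 𝓕 P B H' N') :
    IsItoPair 𝓕 P B (H - H') (N - N') := by
  obtain ⟨x, hx, h1, h2⟩ := h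
  obtain ⟨y, hy, h3, h4⟩ := h'
  refine ⟨x - y, Submodule.sub_mem _ hx hy, ?_, ?_⟩
  · rw [WithLp.sub_fst]
    exact (Lp.coeFn_sub _ _).trans (h1.sub h3)
  · rw [WithLp.sub_snd]
    exact (Lp.coeFn_sub _ _).trans (h2.sub h4)

theorem memLp_elemVal [IsProbabilityMeasure P] (a b : ℝ≥0) {η : Ω → ℝ} (hη : Measurable η)
    {c : ℝ} (hc : ∀ ω, |η ω| ≤ c) : MemLp (elemVal a b η) 2 ((volume : Measure ℝ≥0).prod P) := by
  have : elemVal a b η = (Set.Ioc a b ×ˢ Set.univ).indicator (fun p : ℝ≥0 × Ω => η p.2) := by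
    ext p
    simp [elemVal, Set.indicator_apply]
  rw [this, memLp_indicator_iff_restrict (measurableSet_Ioc.prod .univ), ← Measure.prod_restrict]
  refine MemLp.of_bound (hη.comp measurable_snd).aestronglyMeasurable c (ae_of_all _ fun p => ?_)
  exact hc p.2

theorem memLp_elemInt (hB : IsBrownianWrt 𝓕 P B) (a b : ℝ≥0) {η : Ω → ℝ} (hη : Measurable η)
    {c : ℝ} (hc : ∀ ω, |η ω| ≤ c) : MemLp (elemInt B a b η) 2 P := by
  have h : MemLp η ⊤ P := memLp_top_of_bound hη.aestronglyMeasurable c (ae_of_all _ hc)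
  exact (hB.memLp_sub a b (by simp)).mul' (p := ⊤) (q := 2) h

theorem integral_elemVal_mul [IsProbabilityMeasure P] (a b c d : ℝ≥0) (η θ : Ω → ℝ) :
    ∫ p, elemVal a b η p * elemVal c d θ p ∂((volume : Measure ℝ≥0).prod P)
      = (volume : Measure ℝ≥0).real (Set.Ioc a b ∩ Set.Ioc c d) * ∫ ω, η ω * θ ω ∂P := by
  have : (fun p : ℝ≥0 × Ω => elemVal a b η p * elemVal c d θ p) = fun p =>
      (Set.Ioc a b ∩ Set.Ioc c d).indicator (fun _ => (1 : ℝ)) p.1 * (η p.2 * θ p.2) := by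
    ext p
    by_cases h1 : p.1 ∈ Set.Ioc a b <;> by_cases h2 : p.1 ∈ Set.Ioc c d <;>
      simp only [elemVal, Set.indicator_apply, Set.mem_inter_iff, h1, h2] <;> simp
  rw [this, integral_prod_mul (f := (Set.Ioc a b ∩ Set.Ioc c d).indicator (fun _ => (1 : ℝ)))
    (g := fun ω => η ω * θ ω), integral_indicator (measurableSet_Ioc.inter measurableSet_Ioc)]
  simp

/-- The longer increment is split at the end of the shorter one: the remaining piece is independent
of the past with mean zero, so only `η` times a squared increment survives. -/
theorem IsBrownianWrt.integral_mul_sub_mul_sub [IsProbabilityMeasure P]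
    (hB : IsBrownianWrt 𝓕 P B) {r s t : ℝ≥0} (hrs : r ≤ s) (hrt : r ≤ t) {η : Ω → ℝ}
    (hη : StronglyMeasurable[𝓕 r] η) {C : ℝ} (hC : ∀ ω, |η ω| ≤ C) :
    ∫ ω, η ω * (B s ω - B r ω) * (B t ω - B r ω) ∂P = (∫ ω, η ω ∂P) * ((min s t : ℝ≥0) - r) := by
  wlog hst : s ≤ t generalizing s t
  · rw [min_comm, ← this hrt hrs (le_of_not_ge hst)]
    congr 1 with ω
    ring
  rw [min_eq_left hst, ← hB.integral_mul_sub_sq hrs hη]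
  have hη' := (hη.mono (𝓕.le r)).measurable
  have h0 : ∫ ω, η ω * (B s ω - B r ω) * (B t ω - B s ω) ∂P = 0 :=
    hB.integral_mul_sub hst ((hη.mono (𝓕.mono hrs)).mul ((hB.adapted s).sub
      ((hB.adapted r).mono (𝓕.mono hrs))))
  have i1 : Integrable (fun ω => η ω * (B s ω - B r ω) ^ 2) P := by
    have := (memLp_elemInt hB r s hη' hC).integrable_mul (hB.memLp_sub r s (p := 2) (by simp))
    refine this.congr (ae_of_all _ fun ω => ?_)
    simp only [Pi.mul_apply, elemInt]; ring
  have i2 : Integrable (fun ω => η ω * (B s ω - B r ω) * (B t ω - B s ω)) P :=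
    (memLp_elemInt hB r s hη' hC).integrable_mul (hB.memLp_sub s t (p := 2) (by simp))
  rw [← add_zero (∫ ω, η ω * (B s ω - B r ω) ^ 2 ∂P), ← h0, ← integral_add i1 i2]
  congr 1 with ω
  ring

/-- With a ≤ c, the part of the first integral before c is orthogonal to the second, because the
increment over (c, d] is centred given the past. Only the overlap of the two intervals contributes.
-/
theorem integral_elemInt_mul [IsProbabilityMeasure P] (hB : IsBrownianWrt 𝓕 P B) {a b c d : ℝ≥0}
    (hab : a ≤ b) (hcd : c ≤ d) {η θ : Ω → ℝ} (hη : StronglyMeasurable[𝓕 a] η)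
    (hθ : StronglyMeasurable[𝓕 c] θ) {C D : ℝ} (hC : ∀ ω, |η ω| ≤ C) (hD : ∀ ω, |θ ω| ≤ D) :
    ∫ ω, elemInt B a b η ω * elemInt B c d θ ω ∂P
      = (volume : Measure ℝ≥0).real (Set.Ioc a b ∩ Set.Ioc c d) * ∫ ω, η ω * θ ω ∂P := by
  wlog hac : a ≤ c generalizing a b c d η θ C D
  · have := this hcd hab hθ hη hD hC (le_of_not_ge hac)
    rw [Set.inter_comm]
    simp_rw [mul_comm (elemInt B a b η _), mul_comm (η _)]
    exact this
  have hη' := hη.mono (𝓕.mono hac)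
  have hm := (hη'.mono (𝓕.le c)).measurable
  have hm' := (hθ.mono (𝓕.le c)).measurable
  have key : ∀ e ≤ c, a ≤ e → ∫ ω, elemInt B a e η ω * elemInt B c d θ ω ∂P = 0 := by
    intro e hec hae
    rw [← hB.integral_mul_sub hcd ((hη'.mul ((hB.adapted.stronglyMeasurable_le hec).sub
      (hB.adapted.stronglyMeasurable_le hac))).mul hθ)]
    congr 1 with ω
    simp only [elemInt, Pi.mul_apply, Pi.sub_apply]; ring
  rcases le_total b c with hbc | hcb
  · rw [key b hbc hab]
    have : Set.Ioc a b ∩ Set.Ioc c d = ∅ := by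
      rw [Set.Ioc_inter_Ioc, max_eq_right hac]
      exact Set.Ioc_eq_empty_of_le ((min_le_left _ _).trans hbc)
    simp [this]
  · have e1 : ∀ ω, elemInt B a b η ω * elemInt B c d θ ω = elemInt B a c η ω * elemInt B c d θ ω
        + (η ω * θ ω) * (B b ω - B c ω) * (B d ω - B c ω) := by
      intro ω; simp only [elemInt]; ring
    have hCD : ∀ ω, |η ω * θ ω| ≤ C * D := fun ω => by
      rw [abs_mul]
      exact mul_le_mul (hC ω) (hD ω) (abs_nonneg _) ((abs_nonneg _).trans (hC ω))
    simp_rw [e1]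
    have e2 := hB.integral_mul_sub_mul_sub hcb hcd (hη'.mul hθ) hCD
    simp only [Pi.mul_apply] at e2
    rw [integral_add, key c le_rfl hac, zero_add, e2, Set.Ioc_inter_Ioc, max_eq_right hac,
      NNReal.measureReal_Ioc (le_min hcb hcd), mul_comm]
    · exact (memLp_elemInt hB a c hm hC).integrable_mul (memLp_elemInt hB c d hm' hD)
    · exact (memLp_elemInt hB c b (hm.mul hm') hCD).integrable_mul (hB.memLp_sub c d (p := 2) (by simp))

/-- **Itô isometry** -/
theorem inner_fst_eq_inner_snd [IsProbabilityMeasure P] (hB : IsBrownianWrt 𝓕 P B)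
    {x y : ItoSpace P} (hx : x ∈ itoSubmodule 𝓕 P B) (hy : y ∈ itoSubmodule 𝓕 P B) :
    inner ℝ x.fst y.fst = inner ℝ x.snd y.snd := by
  -- The identity is bilinear and continuous, so density is used in one variable at a time: for
  -- fixed y the difference of the two sides is a continuous functional of x, whose kernel is closed
  -- and contains the generators.
  have key : ∀ y ∈ itoGenerators 𝓕 P B, ∀ x ∈ itoSubmodule 𝓕 P B,
      inner ℝ x.fst y.fst = inner ℝ x.snd y.snd := by
    intro y hy x hx
    let φ : ItoSpace P →L[ℝ] ℝ :=
      ((innerSL ℝ y.fst).comp (WithLp.fstL 2 ℝ _ _)) - ((innerSL ℝ y.snd).comp (WithLp.sndL 2 ℝ _ _))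
    have hφ : ∀ x, φ x = inner ℝ y.fst x.fst - inner ℝ y.snd x.snd := fun x => rfl
    have h1 : Submodule.span ℝ (itoGenerators 𝓕 P B) ≤ φ.ker := by
      rw [Submodule.span_le]
      intro x hx
      obtain ⟨a, b, η, hab, hη, ⟨C, hC⟩, h1, h2⟩ := hx
      obtain ⟨c, d, θ, hcd, hθ, ⟨D, hD⟩, h3, h4⟩ := hy
      change φ x = 0
      have e1 := integral_congr_ae (h3.mul h1)
      have e2 := integral_congr_ae (h4.mul h2)
      simp only [Pi.mul_apply] at e1 e2
      rw [hφ, L2.inner_eq_integral_mul, L2.inner_eq_integral_mul, e1, e2,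
        integral_elemVal_mul, integral_elemInt_mul hB hcd hab hθ hη hD hC, sub_self]
    have h2 := Submodule.topologicalClosure_minimal _ h1 φ.isClosed_ker
    have h3 : φ x = 0 := h2 hx
    rw [hφ, sub_eq_zero] at h3
    rwa [real_inner_comm, real_inner_comm x.snd] at h3
  let φ : ItoSpace P →L[ℝ] ℝ :=
    ((innerSL ℝ x.fst).comp (WithLp.fstL 2 ℝ _ _)) - ((innerSL ℝ x.snd).comp (WithLp.sndL 2 ℝ _ _))
  have h1 : Submodule.span ℝ (itoGenerators 𝓕 P B) ≤ φ.ker := by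
    rw [Submodule.span_le]
    intro y hy
    change inner ℝ x.fst y.fst - inner ℝ x.snd y.snd = 0
    rw [key y hy x hx, sub_self]
  have h2 := Submodule.topologicalClosure_minimal _ h1 φ.isClosed_ker
  have h3 : inner ℝ x.fst y.fst - inner ℝ x.snd y.snd = 0 := h2 hy
  exact sub_eq_zero.1 h3

theorem IsItoPair.integral_sq [IsProbabilityMeasure P] (hB : IsBrownianWrt 𝓕 P B)
    (h : IsItoPair 𝓕 P B H N) :
    ∫ ω, N ω ^ 2 ∂P = ∫ p, H p ^ 2 ∂((volume : Measure ℝ≥0).prod P) := by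
  obtain ⟨x, hx, h1, h2⟩ := h
  have := inner_fst_eq_inner_snd hB hx hx
  rw [real_inner_self_eq_norm_sq, real_inner_self_eq_norm_sq, L2.norm_sq_eq_integral,
    L2.norm_sq_eq_integral] at this
  have e1 := integral_congr_ae (h1.pow_const 2)
  have e2 := integral_congr_ae (h2.pow_const 2)
  simp only [Pi.pow_apply] at e1 e2
  rw [← e1, ← e2, this]

theorem IsItoPair.snd_ae_eq_zero [IsProbabilityMeasure P] (hB : IsBrownianWrt 𝓕 P B)
    (h : IsItoPair 𝓕 P B H N) (hH : H =ᵐ[(volume : Measure ℝ≥0).prod P] 0) : N =ᵐ[P] 0 := by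
  have h1 := h.integral_sq hB
  have e1 := integral_congr_ae (hH.pow_const 2)
  simp only [Pi.pow_apply, Pi.zero_apply, ne_eq, OfNat.ofNat_ne_zero, not_false_eq_true, zero_pow,
    integral_zero] at e1
  rw [e1] at h1
  rw [integral_eq_zero_iff_of_nonneg (fun _ => sq_nonneg _) h.memLp_snd.integrable_sq] at h1
  filter_upwards [h1] with ω hω using by simpa using hω

/-- Injectivity of the map from integral to integrand; the comparison of different functional
derivatives rests on it. -/
theorem IsItoPair.fst_ae_eq_zero [IsProbabilityMeasure P] (hB : IsBrownianWrt 𝓕 P B)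
    (h : IsItoPair 𝓕 P B H N) (hN : N =ᵐ[P] 0) : H =ᵐ[(volume : Measure ℝ≥0).prod P] 0 := by
  have h1 := h.integral_sq hB
  have e1 := integral_congr_ae (hN.pow_const 2)
  simp only [Pi.pow_apply, Pi.zero_apply, ne_eq, OfNat.ofNat_ne_zero, not_false_eq_true, zero_pow,
    integral_zero] at e1
  rw [e1] at h1
  replace h1 := h1.symm
  rw [integral_eq_zero_iff_of_nonneg (fun _ => sq_nonneg _) h.memLp_fst.integrable_sq] at h1
  filter_upwards [h1] with ω hω using by simpa using hω

theorem IsItoPair.snd_ae_unique [IsProbabilityMeasure P] (hB : IsBrownianWrt 𝓕 P B)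
    (h : IsItoPair 𝓕 P B H N) (h' : IsItoPair 𝓕 P B H N') : N =ᵐ[P] N' := by
  have := (h.sub h').snd_ae_eq_zero hB (by simp)
  filter_upwards [this] with ω hω using by simpa [sub_eq_zero] using hω

end ItoSpace

/-! ### Truncation of integrands, conditional expectation, and Itô integrals as Itô pairs -/

section Truncation

/-- Multiplication with the indicator function of a measurable set, on `L²`. -/
noncomputable def L2.indicatorFun {α : Type*} {mα : MeasurableSpace α} {μ : Measure α} {s : Set α}
    (hs : MeasurableSet s) (f : Lp ℝ 2 μ) : Lp ℝ 2 μ :=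
  MemLp.toLp (s.indicator f) ((Lp.memLp f).indicator hs)

theorem L2.coeFn_indicatorFun {α : Type*} {mα : MeasurableSpace α} {μ : Measure α} {s : Set α}
    (hs : MeasurableSet s) (f : Lp ℝ 2 μ) : L2.indicatorFun hs f =ᵐ[μ] s.indicator f :=
  MemLp.coeFn_toLp _

/-- Multiplication with the indicator function of a measurable set, as a continuous linear map. -/
noncomputable def L2.indicatorL {α : Type*} {mα : MeasurableSpace α} (μ : Measure α) {s : Set α}
    (hs : MeasurableSet s) : Lp ℝ 2 μ →L[ℝ] Lp ℝ 2 μ :=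
  LinearMap.mkContinuous
    { toFun := L2.indicatorFun hs
      map_add' := fun f g => by
        refine Lp.ext ?_
        filter_upwards [L2.coeFn_indicatorFun hs (f + g),
          Lp.coeFn_add (L2.indicatorFun hs f) (L2.indicatorFun hs g), L2.coeFn_indicatorFun hs f,
          L2.coeFn_indicatorFun hs g, Lp.coeFn_add f g] with x h1 h2 h3 h4 h5
        rw [h1, h2, Pi.add_apply, h3, h4]
        by_cases hx : x ∈ s
        · simp only [Set.indicator_of_mem hx, h5, Pi.add_apply]
        · simp only [Set.indicator_of_notMem hx, add_zero]
      map_smul' := fun c f => by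
        refine Lp.ext ?_
        filter_upwards [L2.coeFn_indicatorFun hs (c • f), Lp.coeFn_smul c (L2.indicatorFun hs f),
          L2.coeFn_indicatorFun hs f, Lp.coeFn_smul c f] with x h1 h2 h3 h4
        simp only [RingHom.id_apply]
        rw [h1, h2, Pi.smul_apply, h3]
        by_cases hx : x ∈ s <;> simp [hx, h4] }
    1 fun f => by
      rw [one_mul]
      refine Lp.norm_le_norm_of_ae_le ?_
      filter_upwards [L2.coeFn_indicatorFun hs f] with x h1
      simp only [LinearMap.coe_mk, AddHom.coe_mk]
      rw [h1]
      exact norm_indicator_le_norm_self _ _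

theorem L2.coeFn_indicatorL {α : Type*} {mα : MeasurableSpace α} {μ : Measure α} {s : Set α}
    (hs : MeasurableSet s) (f : Lp ℝ 2 μ) : L2.indicatorL μ hs f =ᵐ[μ] s.indicator f :=
  L2.coeFn_indicatorFun hs f

/-- Conditional expectation as a continuous linear map on `L²`. -/
noncomputable def L2.condExpL {Ω : Type*} {m mΩ : MeasurableSpace Ω} (P : Measure Ω)
    (hm : m ≤ mΩ) : Lp ℝ 2 P →L[ℝ] Lp ℝ 2 P :=
  (lpMeas ℝ ℝ m 2 P).subtypeL.comp (condExpL2 ℝ ℝ hm)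

theorem L2.coeFn_condExpL {Ω : Type*} {m mΩ : MeasurableSpace Ω} {P : Measure Ω}
    [IsFiniteMeasure P] (hm : m ≤ mΩ) (f : Lp ℝ 2 P) : L2.condExpL P hm f =ᵐ[P] P[f|m] := by
  have h := (Lp.memLp f).condExpL2_ae_eq_condExp (𝕜 := ℝ) hm
  rwa [Lp.toLp_coeFn] at h

variable {Ω : Type*} [mΩ : MeasurableSpace Ω] {𝓕 : Filtration ℝ≥0 mΩ} {P : Measure Ω}
  {B : ℝ≥0 → Ω → ℝ} {H : ℝ≥0 × Ω → ℝ} {N : Ω → ℝ}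

theorem condExp_elemInt_of_le [IsProbabilityMeasure P] (hB : IsBrownianWrt 𝓕 P B) {t a b : ℝ≥0}
    (hta : t ≤ a) (hab : a ≤ b) {η : Ω → ℝ} (hη : StronglyMeasurable[𝓕 a] η) {C : ℝ}
    (hC : ∀ ω, |η ω| ≤ C) : P[elemInt B a b η | 𝓕 t] =ᵐ[P] 0 := by
  have h1 : P[elemInt B a b η | 𝓕 a] =ᵐ[P] 0 := by
    have h2 := condExp_mul_of_stronglyMeasurable_left (μ := P) hη
      (g := fun ω => B b ω - B a ω)
      ((memLp_elemInt hB a b (hη.mono (𝓕.le a)).measurable hC).integrable (by norm_num))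
      ((hB.memLp_sub a b (p := 1) (by simp)).integrable le_rfl)
    filter_upwards [h2, hB.condExp_eq_of_le hab] with ω h3 h4
    change (P[η * fun ω => B b ω - B a ω | 𝓕 a]) ω = 0
    rw [h3, Pi.mul_apply, h4]; simp
  have h2 := condExp_condExp_of_le (μ := P) (f := elemInt B a b η) (𝓕.mono hta) (𝓕.le a)
  refine h2.symm.trans ((condExp_congr_ae h1).trans ?_)
  rw [condExp_zero]

/-- If t lies inside (a, b], the increment is split at t: the earlier piece is known and the later
one has conditional mean zero. -/
theorem condExp_elemInt [IsProbabilityMeasure P] (hB : IsBrownianWrt 𝓕 P B) (t : ℝ≥0) {a b : ℝ≥0}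
    (hab : a ≤ b) {η : Ω → ℝ} (hη : StronglyMeasurable[𝓕 a] η) {C : ℝ}
    (hC : ∀ ω, |η ω| ≤ C) :
    P[elemInt B a b η | 𝓕 t] =ᵐ[P] elemInt B (min a t) (min b t) η := by
  rcases le_total t a with hta | hat
  · rw [min_eq_right hta, min_eq_right (hta.trans hab)]
    filter_upwards [condExp_elemInt_of_le hB hta hab hη hC] with ω hω
    rw [hω]; simp [elemInt]
  rw [min_eq_left hat]
  rcases le_total b t with hbt | htb
  · rw [min_eq_left hbt, condExp_of_stronglyMeasurable (𝓕.le t)]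
    · exact (hη.mono (𝓕.mono hat)).mul ((hB.adapted.stronglyMeasurable_le hbt).sub
        (hB.adapted.stronglyMeasurable_le hat))
    · exact (memLp_elemInt hB a b (hη.mono (𝓕.le a)).measurable hC).integrable (by norm_num)
  · rw [min_eq_right htb]
    have hm := (hη.mono (𝓕.le a)).measurable
    have e1 : elemInt B a b η = elemInt B a t η + elemInt B t b η := by
      ext ω; simp only [elemInt, Pi.add_apply]; ring
    have i1 := (memLp_elemInt hB a t hm hC).integrable (by norm_num)
    have i2 := (memLp_elemInt hB t b hm hC).integrable (by norm_num)
    rw [e1]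
    have h2 : P[elemInt B a t η | 𝓕 t] = elemInt B a t η :=
      condExp_of_stronglyMeasurable (𝓕.le t) ((hη.mono (𝓕.mono hat)).mul ((hB.adapted t).sub
        (hB.adapted.stronglyMeasurable_le hat))) i1
    filter_upwards [condExp_add i1 i2 (𝓕 t),
      condExp_elemInt_of_le hB le_rfl htb (hη.mono (𝓕.mono hat)) hC] with ω h3 h4
    rw [h3, Pi.add_apply, h4, h2]; simp

/-- Generators are stable under truncation at t: the interval (a, b] becomes (a, min b t] or
disappears. -/
theorem exists_itoGenerator [IsProbabilityMeasure P] (hB : IsBrownianWrt 𝓕 P B) {a b : ℝ≥0}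
    (hab : a ≤ b) (t : ℝ≥0) {η : Ω → ℝ} (hη : StronglyMeasurable[𝓕 a] η) {C : ℝ}
    (hC : ∀ ω, |η ω| ≤ C) :
    ∃ x ∈ itoGenerators 𝓕 P B,
      x.fst =ᵐ[(volume : Measure ℝ≥0).prod P] (Set.Ioc 0 t ×ˢ Set.univ).indicator (elemVal a b η) ∧
      x.snd =ᵐ[P] elemInt B (min a t) (min b t) η := by
  rcases le_total a t with hat | hta
  · have e1 : (Set.Ioc 0 t ×ˢ Set.univ).indicator (elemVal a b η) = elemVal a (min b t) η := by
      ext p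
      simp only [elemVal, Set.indicator_apply, Set.mem_prod, Set.mem_Ioc, Set.mem_univ, and_true,
        le_min_iff]
      have : a < p.1 → 0 < p.1 := fun h => (zero_le).trans_lt h
      split_ifs <;> first | rfl | (exfalso; tauto)
    have hm := (hη.mono (𝓕.le a)).measurable
    rw [e1, min_eq_left hat]
    have m1 := memLp_elemVal (P := P) a (min b t) hm hC
    have m2 := memLp_elemInt hB a (min b t) hm hC
    exact ⟨WithLp.toLp 2 (m1.toLp _, m2.toLp _), ⟨a, min b t, η, le_min hab hat, hη, ⟨C, hC⟩,
      m1.coeFn_toLp, m2.coeFn_toLp⟩, m1.coeFn_toLp, m2.coeFn_toLp⟩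
  · have e1 : (Set.Ioc 0 t ×ˢ Set.univ).indicator (elemVal a b η) = 0 := by
      ext p
      simp only [elemVal, Set.indicator_apply, Set.mem_prod, Set.mem_Ioc, Set.mem_univ, and_true,
        Pi.zero_apply]
      have : a < p.1 → ¬ p.1 ≤ t := fun h => not_le.2 (hta.trans_lt h)
      split_ifs <;> first | rfl | (exfalso; tauto)
    have e2 : elemInt B (min a t) (min b t) η = 0 := by
      ext ω; simp [elemInt, min_eq_right hta, min_eq_right (hta.trans hab)]
    rw [e1, e2]
    -- The zero pair is the generator with zero coefficient on the empty interval (a, a].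
    refine ⟨0, ⟨a, a, 0, le_rfl, stronglyMeasurable_zero, ⟨0, by simp⟩, ?_, ?_⟩, ?_, ?_⟩
    · refine (Lp.coeFn_zero ℝ 2 _).trans (ae_of_all _ fun p => ?_)
      simp [elemVal]
    · refine (Lp.coeFn_zero ℝ 2 _).trans (ae_of_all _ fun p => ?_)
      simp [elemInt]
    · exact Lp.coeFn_zero ℝ 2 _
    · exact Lp.coeFn_zero ℝ 2 _

/-- The Itô integral is a martingale: the conditional expectation given `𝓕 t` is the integral over
`[0, t]`. -/
theorem IsItoPair.condExp [IsProbabilityMeasure P] (hB : IsBrownianWrt 𝓕 P B) (t : ℝ≥0)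
    (h : IsItoPair 𝓕 P B H N) :
    IsItoPair 𝓕 P B ((Set.Ioc 0 t ×ˢ Set.univ).indicator H) (P[N | 𝓕 t]) := by
  have hs : MeasurableSet (Set.Ioc 0 t ×ˢ (Set.univ : Set Ω)) := measurableSet_Ioc.prod .univ
  -- `Φ` truncates the integrand at t and conditions the integral on 𝓕 t. It is continuous and sends
  -- generators to generators, hence preserves the closed subspace.
  let Φ : ItoSpace P →L[ℝ] ItoSpace P := (WithLp.prodContinuousLinearEquiv 2 ℝ _ _).symm.toContinuousLinearMap.comp
    (((L2.indicatorL ((volume : Measure ℝ≥0).prod P) hs).comp (WithLp.fstL 2 ℝ _ _)).prod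
      ((L2.condExpL P (𝓕.le t)).comp (WithLp.sndL 2 ℝ _ _)))
  have hΦ1 : ∀ x, (Φ x).fst = L2.indicatorL _ hs x.fst := fun x => rfl
  have hΦ2 : ∀ x, (Φ x).snd = L2.condExpL P (𝓕.le t) x.snd := fun x => rfl
  have key : Submodule.span ℝ (itoGenerators 𝓕 P B) ≤
      (itoSubmodule 𝓕 P B).comap Φ.toLinearMap := by
    rw [Submodule.span_le]
    rintro x ⟨a, b, η, hab, hη, ⟨C, hC⟩, h1, h2⟩
    obtain ⟨y, hy, h3, h4⟩ := exists_itoGenerator hB hab t hη hC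
    have : Φ x = y := by
      refine (WithLp.ofLp_injective 2) (Prod.ext ?_ ?_)
      · change (Φ x).fst = y.fst
        rw [hΦ1]
        ext1
        filter_upwards [L2.coeFn_indicatorL hs x.fst, h1, h3] with p e1 e2 e3
        rw [e1, e3]
        by_cases hp : p ∈ Set.Ioc 0 t ×ˢ (Set.univ : Set Ω) <;> simp [Set.indicator_apply, e2]
      · change (Φ x).snd = y.snd
        rw [hΦ2]
        ext1
        exact (L2.coeFn_condExpL _ _).trans ((condExp_congr_ae h2).trans
          ((condExp_elemInt hB t hab hη hC).trans h4.symm))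
    change Φ x ∈ itoSubmodule 𝓕 P B
    rw [this]
    exact Submodule.le_topologicalClosure _ (Submodule.subset_span hy)
  obtain ⟨x, hx, h1, h2⟩ := h
  have hcl : IsClosed (((itoSubmodule 𝓕 P B).comap Φ.toLinearMap : Submodule ℝ (ItoSpace P)) :
      Set (ItoSpace P)) :=
    (Submodule.isClosed_topologicalClosure _).preimage Φ.continuous
  have h3 : Φ x ∈ itoSubmodule 𝓕 P B := Submodule.topologicalClosure_minimal _ key hcl hx
  refine ⟨Φ x, h3, ?_, ?_⟩
  · rw [hΦ1]
    filter_upwards [L2.coeFn_indicatorL hs x.fst, h1] with p e1 e2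
    rw [e1]
    simp [Set.indicator_apply, e2]
  · rw [hΦ2]
    exact (L2.coeFn_condExpL _ _).trans (condExp_congr_ae h2)

theorem exists_mem_itoSubmodule_simpleProcess [IsProbabilityMeasure P] (hB : IsBrownianWrt 𝓕 P B)
    (S : SimpleProcess 𝓕) (t : ℝ≥0) :
    IsItoPair 𝓕 P B ((Set.Ioc 0 t ×ˢ Set.univ).indicator fun p => S.val p.1 p.2)
      (S.integral B t) := by
  have h : ∀ i, ∃ x ∈ itoGenerators 𝓕 P B, x.fst =ᵐ[(volume : Measure ℝ≥0).prod P]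
      (Set.Ioc 0 t ×ˢ Set.univ).indicator (elemVal (S.time i) (S.time (i + 1)) (S.η i)) ∧
      x.snd =ᵐ[P] elemInt B (min (S.time i) t) (min (S.time (i + 1)) t) (S.η i) := fun i => by
    obtain ⟨c, hc⟩ := S.bounded i
    exact exists_itoGenerator hB (S.mono (Nat.le_succ i)) t (S.measurable i) hc
  choose x hx h1 h2 using h
  refine ⟨∑ i ∈ Finset.range S.n, x i, Submodule.sum_mem _ fun i _ =>
    Submodule.le_topologicalClosure _ (Submodule.subset_span (hx i)), ?_, ?_⟩
  · have e : (∑ i ∈ Finset.range S.n, x i).fst = ∑ i ∈ Finset.range S.n, (x i).fst :=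
      map_sum (WithLp.fstL 2 ℝ (Lp ℝ 2 ((volume : Measure ℝ≥0).prod P)) (Lp ℝ 2 P)) x _
    rw [e]
    filter_upwards [Lp.coeFn_finsetSum (Finset.range S.n) (fun i => (x i).fst), ae_all_iff.2 h1] with p h3 h4
    rw [h3, Finset.sum_apply]
    simp_rw [h4]
    by_cases hp : p ∈ Set.Ioc 0 t ×ˢ (Set.univ : Set Ω)
    · simp only [Set.indicator_of_mem hp]
      rfl
    · simp only [Set.indicator_of_notMem hp, Finset.sum_const_zero]
  · have e : (∑ i ∈ Finset.range S.n, x i).snd = ∑ i ∈ Finset.range S.n, (x i).snd :=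
      map_sum (WithLp.sndL 2 ℝ (Lp ℝ 2 ((volume : Measure ℝ≥0).prod P)) (Lp ℝ 2 P)) x _
    rw [e]
    filter_upwards [Lp.coeFn_finsetSum (Finset.range S.n) (fun i => (x i).snd), ae_all_iff.2 h2] with p h3 h4
    rw [h3, Finset.sum_apply]
    simp_rw [h4]
    rfl

/-- The approximating simple processes, cut to (0, t], lie in the closed subspace together with
their integrals, and so does their limit. -/
theorem IsItoIntegral.isItoPair [IsProbabilityMeasure P] (hB : IsBrownianWrt 𝓕 P B)
    {H : ℝ≥0 → Ω → ℝ} {t : ℝ≥0} (h : IsItoIntegral 𝓕 P B H t N) :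
    IsItoPair 𝓕 P B ((Set.Ioc 0 t ×ˢ Set.univ).indicator fun p => H p.1 p.2) N := by
  obtain ⟨hH, hN, S, hS1, hS2⟩ := h
  have hs : MeasurableSet (Set.Ioc 0 t ×ˢ (Set.univ : Set Ω)) := measurableSet_Ioc.prod .univ
  have hμ : ((volume : Measure ℝ≥0).restrict (Set.Ioc 0 t)).prod P =
      ((volume : Measure ℝ≥0).prod P).restrict (Set.Ioc 0 t ×ˢ Set.univ) := by
    rw [← Measure.prod_restrict, Measure.restrict_univ]
  rw [hμ] at hH
  simp_rw [hμ] at hS1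
  choose x hx h1 h2 using fun k => exists_mem_itoSubmodule_simpleProcess hB (S k) t
  have m1 : AEStronglyMeasurable ((Set.Ioc 0 t ×ˢ Set.univ).indicator fun p : ℝ≥0 × Ω => H p.1 p.2)
    ((volume : Measure ℝ≥0).prod P) := (aestronglyMeasurable_indicator_iff hs).2 hH
  have t1 : Tendsto (fun k => eLpNorm (⇑(x k).fst -
      (Set.Ioc 0 t ×ˢ Set.univ).indicator fun p : ℝ≥0 × Ω => H p.1 p.2) 2
      ((volume : Measure ℝ≥0).prod P)) atTop (𝓝 0) := by
    refine hS1.congr fun k => ?_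
    rw [← eLpNorm_indicator_eq_eLpNorm_restrict hs]
    refine eLpNorm_congr_ae ?_
    filter_upwards [h1 k] with p hp
    rw [Pi.sub_apply, hp]
    by_cases hp : p ∈ Set.Ioc 0 t ×ˢ (Set.univ : Set Ω)
    · simp only [Set.indicator_of_mem hp]
    · simp only [Set.indicator_of_notMem hp, sub_zero]
  have t2 : Tendsto (fun k => eLpNorm (⇑(x k).snd - N) 2 P) atTop (𝓝 0) := by
    refine hS2.congr fun k => eLpNorm_congr_ae ?_
    filter_upwards [h2 k] with ω hω
    rw [Pi.sub_apply, hω]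
  -- A limit in L² seminorm is itself square-integrable, being at finite distance from some
  -- approximant.
  have key : ∀ {α : Type _} {mα : MeasurableSpace α} {μ : Measure α} {f : ℕ → Lp ℝ 2 μ} {g : α → ℝ},
      AEStronglyMeasurable g μ → Tendsto (fun k => eLpNorm (⇑(f k) - g) 2 μ) atTop (𝓝 0) →
      MemLp g 2 μ := by
    intro α mα μ f g hg hfg
    obtain ⟨k, hk⟩ := (hfg.eventually (gt_mem_nhds one_pos)).exists
    have : MemLp (⇑(f k) - g) 2 μ :=
      ⟨(Lp.aestronglyMeasurable _).sub hg, hk.trans ENNReal.one_lt_top⟩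
    simpa using (Lp.memLp (f k)).sub this
  have mH := key m1 t1
  have mN := key hN t2
  refine ⟨WithLp.toLp 2 (mH.toLp _, mN.toLp _), ?_, mH.coeFn_toLp, mN.coeFn_toLp⟩
  refine (Submodule.isClosed_topologicalClosure _).mem_of_tendsto (b := atTop) (f := x) ?_
    (Eventually.of_forall hx)
  have e : x = fun k => (WithLp.prodContinuousLinearEquiv 2 ℝ _ _).symm ((x k).fst, (x k).snd) := by
    ext k; rfl
  rw [e]
  refine ((WithLp.prodContinuousLinearEquiv 2 ℝ _ _).symm.continuous.tendsto
    (mH.toLp _, mN.toLp _)).comp (Tendsto.prodMk_nhds ?_ ?_)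
  · exact (Lp.tendsto_Lp_iff_tendsto_eLpNorm _ _ mH).2 t1
  · exact (Lp.tendsto_Lp_iff_tendsto_eLpNorm _ _ mN).2 t2

end Truncation

/-! ### Convergence in measure of real functions -/

section ConvergenceInMeasure

variable {α ι : Type*} {mα : MeasurableSpace α} {μ : Measure α} {l : Filter ι} {f f' : ι → α → ℝ}
  {g g' : α → ℝ}

theorem MeasureTheory.TendstoInMeasure.add_real (h : TendstoInMeasure μ f l g)
    (h' : TendstoInMeasure μ f' l g') :
    TendstoInMeasure μ (fun i x => f i x + f' i x) l (fun x => g x + g' x) := by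
  rw [tendstoInMeasure_iff_norm] at h h' ⊢
  intro ε hε
  have h1 := (h (ε / 2) (half_pos hε)).add (h' (ε / 2) (half_pos hε))
  rw [add_zero] at h1
  refine tendsto_of_tendsto_of_tendsto_of_le_of_le tendsto_const_nhds h1 (fun _ => zero_le)
    fun i => (measure_mono ?_).trans (measure_union_le _ _)
  intro x hx
  simp only [Set.mem_ofPred_eq, Set.mem_union, Real.norm_eq_abs] at hx ⊢
  by_contra! hcon
  have h2 := abs_add_le (f i x - g x) (f' i x - g' x)
  rw [show f i x - g x + (f' i x - g' x) = f i x + f' i x - (g x + g' x) by ring] at h2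
  linarith [hcon.1, hcon.2]

theorem MeasureTheory.TendstoInMeasure.bdd_mul_real (h : TendstoInMeasure μ f l g) {η : α → ℝ}
    {C : ℝ} (hη : ∀ x, |η x| ≤ C) :
    TendstoInMeasure μ (fun i x => η x * f i x) l (fun x => η x * g x) := by
  rw [tendstoInMeasure_iff_norm] at h ⊢
  intro ε hε
  have hC : 0 < |C| + 1 := by positivity
  refine tendsto_of_tendsto_of_tendsto_of_le_of_le tendsto_const_nhds (h (ε / (|C| + 1))
    (by positivity)) (fun _ => zero_le) fun i => measure_mono ?_
  intro x hx
  simp only [Set.mem_ofPred_eq, Real.norm_eq_abs] at hx ⊢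
  rw [div_le_iff₀ hC]
  rw [← mul_sub, abs_mul] at hx
  calc ε ≤ |η x| * |f i x - g x| := hx
    _ ≤ (|C| + 1) * |f i x - g x| := by
      gcongr
      linarith [hη x, le_abs_self C]
    _ = _ := mul_comm _ _

theorem MeasureTheory.TendstoInMeasure.const_mul_real (h : TendstoInMeasure μ f l g) (c : ℝ) :
    TendstoInMeasure μ (fun i x => c * f i x) l (fun x => c * g x) :=
  h.bdd_mul_real (η := fun _ => c) (C := |c|) (fun _ => le_rfl)

theorem MeasureTheory.TendstoInMeasure.sub_real (h : TendstoInMeasure μ f l g)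
    (h' : TendstoInMeasure μ f' l g') :
    TendstoInMeasure μ (fun i x => f i x - f' i x) l (fun x => g x - g' x) := by
  have := h.add_real (h'.const_mul_real (-1))
  simpa only [neg_one_mul, ← sub_eq_add_neg] using this

/-- An ε/3 argument: approximations that are close in L¹ uniformly along the family transfer their
convergence in measure. -/
theorem tendstoInMeasure_of_forall_pos_approx (hf : ∀ i, AEStronglyMeasurable (f i) μ)
    (hg : AEStronglyMeasurable g μ)
    (h : ∀ η > (0 : ℝ), ∃ (f' : ι → α → ℝ) (g' : α → ℝ), TendstoInMeasure μ f' l g' ∧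
      (∀ i, AEStronglyMeasurable (f' i) μ) ∧ AEStronglyMeasurable g' μ ∧
      (∀ i, ∫⁻ x, ‖f i x - f' i x‖ₑ ∂μ ≤ ENNReal.ofReal η) ∧
      ∫⁻ x, ‖g x - g' x‖ₑ ∂μ ≤ ENNReal.ofReal η) :
    TendstoInMeasure μ f l g := by
  rw [tendstoInMeasure_iff_norm]
  intro ε hε
  rw [ENNReal.tendsto_nhds_zero]
  intro δ hδ
  wlog hδt : δ ≠ ⊤ generalizing δ
  · filter_upwards [this 1 one_pos ENNReal.one_ne_top] with i hi
    rw [not_not.1 hδt]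
    exact le_top
  have hδ' : 0 < δ.toReal := ENNReal.toReal_pos hδ.ne' hδt
  -- With this L¹ distance, Markov's inequality at level ε/3 leaves measure at most δ/3 for each of
  -- the two approximation errors.
  obtain ⟨f', g', h1, h2, h3, h4, h5⟩ := h (ε / 3 * (δ.toReal / 3)) (by positivity)
  rw [tendstoInMeasure_iff_norm] at h1
  have h6 := (ENNReal.tendsto_nhds_zero.1 (h1 (ε / 3) (by positivity))) (ENNReal.ofReal (δ.toReal / 3))
    (by simpa using hδ')
  have markov : ∀ u : α → ℝ, AEStronglyMeasurable u μ →
      ∫⁻ x, ‖u x‖ₑ ∂μ ≤ ENNReal.ofReal (ε / 3 * (δ.toReal / 3)) →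
      μ {x | ε / 3 ≤ |u x|} ≤ ENNReal.ofReal (δ.toReal / 3) := by
    intro u hu hle
    have e1 : {x | ε / 3 ≤ |u x|} = {x | ENNReal.ofReal (ε / 3) ≤ ‖u x‖ₑ} := by
      ext x
      rw [Set.mem_ofPred_eq, Set.mem_ofPred_eq, Real.enorm_eq_ofReal_abs,
        ENNReal.ofReal_le_ofReal_iff (abs_nonneg _)]
    have e2 := mul_meas_ge_le_lintegral₀ hu.enorm (ENNReal.ofReal (ε / 3))
    rw [e1]
    have e3 := e2.trans hle
    rw [ENNReal.ofReal_mul (by positivity)] at e3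
    rwa [ENNReal.mul_le_mul_iff_right (by simpa using hε) ENNReal.ofReal_ne_top] at e3
  filter_upwards [h6] with i hi
  have hsub : {x | ε ≤ ‖f i x - g x‖} ⊆ ({x | ε / 3 ≤ |f i x - f' i x|} ∪
      {x | ε / 3 ≤ ‖f' i x - g' x‖}) ∪ {x | ε / 3 ≤ |g x - g' x|} := by
    intro x hx
    simp only [Set.mem_ofPred_eq, Set.mem_union, Real.norm_eq_abs] at hx ⊢
    by_contra! hcon
    have e1 := abs_add_three (f i x - f' i x) (f' i x - g' x) (g' x - g x)
    rw [show f i x - f' i x + (f' i x - g' x) + (g' x - g x) = f i x - g x by ring,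
      abs_sub_comm (g' x)] at e1
    linarith [hcon.1.1, hcon.1.2, hcon.2]
  refine (measure_mono hsub).trans ((measure_union_le _ _).trans ((add_le_add
    ((measure_union_le _ _).trans (add_le_add (markov _ ((hf i).sub (h2 i)) (h4 i)) hi))
    (markov _ (hg.sub h3) h5)).trans ?_))
  rw [← ENNReal.ofReal_add (by positivity) (by positivity),
    ← ENNReal.ofReal_add (by positivity) (by positivity)]
  refine ENNReal.ofReal_le_of_le_toReal (le_of_eq (by ring))

theorem tendstoInMeasure_zero_of_lintegral_le {u : ι → ℝ} (hf : ∀ i, AEStronglyMeasurable (f i) μ)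
    (h : ∀ i, ∫⁻ x, ‖f i x‖ₑ ∂μ ≤ ENNReal.ofReal (u i)) (hu : Tendsto u l (𝓝 0)) :
    TendstoInMeasure μ f l (fun _ => 0) := by
  refine tendstoInMeasure_of_tendsto_eLpNorm (p := 1) one_ne_zero hf aestronglyMeasurable_const ?_
  have h1 : Tendsto (fun i => ENNReal.ofReal (u i)) l (𝓝 0) := by
    simpa using ENNReal.tendsto_ofReal hu
  refine tendsto_of_tendsto_of_tendsto_of_le_of_le tendsto_const_nhds h1 (fun _ => zero_le)
    fun i => ?_
  rw [eLpNorm_one_eq_lintegral_enorm]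
  simpa using h i

end ConvergenceInMeasure

/-! ### Partitions -/

namespace TimePartition

variable {t : ℝ≥0} (p : TimePartition t)

theorem pts_le {i : ℕ} (hi : i ≤ p.n) : p.pts i ≤ t := by
  have := p.mono hi
  rwa [p.last] at this

theorem sub_le_mesh {i : ℕ} (hi : i ∈ Finset.range p.n) :
    (p.pts (i + 1) : ℝ) - p.pts i ≤ p.mesh := by
  have h : p.pts (i + 1) - p.pts i ≤ p.mesh :=
    Finset.le_sup (f := fun i => p.pts (i + 1) - p.pts i) hi
  rw [← NNReal.coe_sub (p.mono (Nat.le_succ i))]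
  exact_mod_cast h

theorem pts_le_succ (i : ℕ) : p.pts i ≤ p.pts (i + 1) := p.mono (Nat.le_succ i)

theorem sum_sub_pts : ∑ i ∈ Finset.range p.n, ((p.pts (i + 1) : ℝ) - p.pts i) = t := by
  rw [Finset.sum_range_sub (fun i => (p.pts i : ℝ)), p.last, p.zero]; simp

/-- The points of a partition, cut off at `a`. -/
def cut (a : ℝ≥0) : TimePartition (min a t) where
  n := p.n
  pts i := min a (p.pts i)
  mono _ _ h := min_le_min le_rfl (p.mono h)
  zero := by rw [p.zero]; simp
  last := by rw [p.last]

theorem mesh_cut_le (a : ℝ≥0) : (p.cut a).mesh ≤ p.mesh := by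
  refine Finset.sup_le fun i hi => ?_
  refine le_trans ?_ (Finset.le_sup (f := fun i => p.pts (i + 1) - p.pts i) hi)
  change min a (p.pts (i + 1)) - min a (p.pts i) ≤ _
  rcases le_total a (p.pts i) with h | h
  · rw [min_eq_left h, min_eq_left (h.trans (p.pts_le_succ i))]; simp
  · rw [min_eq_right h]
    exact tsub_le_tsub_right (min_le_right _ _) _

variable {Ω : Type*}

theorem covSum_comm (A B : ℝ≥0 → Ω → ℝ) (ω : Ω) : p.covSum A B ω = p.covSum B A ω :=
  Finset.sum_congr rfl fun _ _ => mul_comm _ _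

theorem covSum_congr {A A' B B' : ℝ≥0 → Ω → ℝ} {ω : Ω} (hA : ∀ i ≤ p.n, A (p.pts i) ω = A' (p.pts i) ω)
    (hB : ∀ i ≤ p.n, B (p.pts i) ω = B' (p.pts i) ω) : p.covSum A B ω = p.covSum A' B' ω := by
  refine Finset.sum_congr rfl fun i hi => ?_
  have hi := Finset.mem_range.1 hi
  rw [hA _ hi.le, hA _ hi, hB _ hi.le, hB _ hi]

theorem covSum_ae_congr [MeasurableSpace Ω] {P : Measure Ω} {A A' B B' : ℝ≥0 → Ω → ℝ}
    (hA : ∀ s ≤ t, A s =ᵐ[P] A' s) (hB : ∀ s ≤ t, B s =ᵐ[P] B' s) :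
    p.covSum A B =ᵐ[P] p.covSum A' B' := by
  have h1 : ∀ᵐ ω ∂P, ∀ i : ℕ, i ≤ p.n → A (p.pts i) ω = A' (p.pts i) ω :=
    ae_all_iff.2 fun i => Filter.eventually_imp_distrib_left.2 fun hi => hA _ (p.pts_le hi)
  have h2 : ∀ᵐ ω ∂P, ∀ i : ℕ, i ≤ p.n → B (p.pts i) ω = B' (p.pts i) ω :=
    ae_all_iff.2 fun i => Filter.eventually_imp_distrib_left.2 fun hi => hB _ (p.pts_le hi)
  filter_upwards [h1, h2] with ω h3 h4 using p.covSum_congr h3 h4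

theorem covSum_add_left (A A' B : ℝ≥0 → Ω → ℝ) (ω : Ω) :
    p.covSum (fun s ω => A s ω + A' s ω) B ω = p.covSum A B ω + p.covSum A' B ω := by
  simp only [covSum, ← Finset.sum_add_distrib]
  exact Finset.sum_congr rfl fun _ _ => by ring

theorem covSum_add_right (A B B' : ℝ≥0 → Ω → ℝ) (ω : Ω) :
    p.covSum A (fun s ω => B s ω + B' s ω) ω = p.covSum A B ω + p.covSum A B' ω := by
  simp only [covSum, ← Finset.sum_add_distrib]
  exact Finset.sum_congr rfl fun _ _ => by ring

end TimePartition

/-! ### Covariation of stopped Brownian motions and of elementary integrals -/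

section BrownianCovariation

variable {Ω : Type*} [mΩ : MeasurableSpace Ω] {𝓕 : Filtration ℝ≥0 mΩ} {P : Measure Ω}
  {B B₁ B₂ : ℝ≥0 → Ω → ℝ}

theorem HasCovariation.symm {T : ℝ≥0} {A B C : ℝ≥0 → Ω → ℝ} (h : HasCovariation P T A B C) :
    HasCovariation P T B A C := fun t ht p hp =>
  (h t ht p hp).congr_left fun k => ae_of_all _ fun ω => (p k).covSum_comm A B ω

theorem TimePartition.measurable_covSum {t : ℝ≥0} (p : TimePartition t)
    (h₁ : ∀ s, Measurable (B₁ s)) (h₂ : ∀ s, Measurable (B₂ s)) : Measurable (p.covSum B₁ B₂) := by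
  have e : p.covSum B₁ B₂ = fun ω => ∑ i ∈ Finset.range p.n,
    (B₁ (p.pts (i + 1)) ω - B₁ (p.pts i) ω) * (B₂ (p.pts (i + 1)) ω - B₂ (p.pts i) ω) := rfl
  rw [e]
  exact Finset.measurable_sum _ fun i _ => ((h₁ _).sub (h₁ _)).mul ((h₂ _).sub (h₂ _))

theorem IsBrownianWrt.memLp_sub_sq (hB : IsBrownianWrt 𝓕 P B) (s t : ℝ≥0) :
    MemLp (fun ω => (B t ω - B s ω) ^ 2) 2 P := by
  have h4 := hB.memLp_sub s t (p := 4) (by simp)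
  refine (memLp_two_iff_integrable_sq (f := fun ω => (B t ω - B s ω) ^ 2) (h4.1.pow 2)).2 ?_
  refine (h4.integrable_norm_pow (p := 4) (by norm_num)).congr (ae_of_all _ fun ω => ?_)
  simp only [Real.norm_eq_abs]
  rw [← pow_mul, ← abs_pow, abs_of_nonneg (by positivity)]

/-- Squared increments over disjoint intervals are independent, so variances add. Each is at most
the fourth moment of the increment, which is proportional to the squared length, and one factor of
length is bounded by the mesh. -/
theorem IsBrownianWrt.variance_covSum_le [IsProbabilityMeasure P] (hB : IsBrownianWrt 𝓕 P B)
    {t : ℝ≥0} (p : TimePartition t) :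
    variance (p.covSum B B) P ≤ p.mesh * (t * ∫ x, x ^ 4 ∂(gaussianReal 0 1)) := by
  have hm4 : 0 ≤ ∫ x, x ^ 4 ∂(gaussianReal 0 1) := integral_nonneg fun x => by positivity
  have hind := hB.brownian.hasIndepIncrements p.n (fun i => p.pts i) (fun i j h => p.mono h)
  have e : p.covSum B B = ∑ i : Fin p.n,
      fun ω => (B (p.pts (i + 1)) ω - B (p.pts i) ω) ^ 2 := by
    ext ω
    rw [Finset.sum_apply]
    change ∑ i ∈ Finset.range p.n, _ = _
    rw [Finset.sum_range]
    exact Finset.sum_congr rfl fun i _ => (pow_two _).symm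
  rw [e, IndepFun.variance_sum (fun i _ => hB.memLp_sub_sq _ _)]
  · calc ∑ i : Fin p.n, variance (fun ω => (B (p.pts (i + 1)) ω - B (p.pts i) ω) ^ 2) P
        ≤ ∑ i : Fin p.n, ((p.pts (i + 1) : ℝ) - p.pts i) * (p.mesh * ∫ x, x ^ 4 ∂(gaussianReal 0 1)) := by
          refine Finset.sum_le_sum fun i _ => ?_
          refine (variance_le_expectation_sq (hB.memLp_sub_sq _ _).1).trans ?_
          have h1 := hB.integral_sub_pow_four (p.pts_le_succ i)
          simp only [Pi.pow_apply, ← pow_mul]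
          rw [h1, pow_two, mul_assoc]
          have h2 : 0 ≤ (p.pts (i + 1) : ℝ) - p.pts i := sub_nonneg.2 (p.pts_le_succ i)
          gcongr
          exact p.sub_le_mesh (Finset.mem_range.2 i.2)
      _ = p.mesh * (t * ∫ x, x ^ 4 ∂(gaussianReal 0 1)) := by
          rw [← Finset.sum_mul, ← Finset.sum_range (fun i => (p.pts (i + 1) : ℝ) - p.pts i), p.sum_sub_pts]
          ring
  · intro i _ j _ hij
    have := (hind.indepFun hij).comp (φ := fun x => x ^ 2) (ψ := fun x => x ^ 2) (by fun_prop)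
      (by fun_prop)
    exact this

theorem IsBrownianWrt.integral_covSum (hB : IsBrownianWrt 𝓕 P B)
    {t : ℝ≥0} (p : TimePartition t) : ∫ ω, p.covSum B B ω ∂P = t := by
  have e : ∀ ω, p.covSum B B ω = ∑ i ∈ Finset.range p.n,
      (B (p.pts (i + 1)) ω - B (p.pts i) ω) ^ 2 := fun ω =>
    Finset.sum_congr rfl fun i _ => (pow_two _).symm
  simp_rw [e]
  rw [integral_finsetSum _ fun i _ => (hB.memLp_sub _ _ (p := 2) (by simp)).integrable_sq,
    ← p.sum_sub_pts]
  exact Finset.sum_congr rfl fun i _ => hB.integral_sub_sq (p.pts_le_succ i)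

/-- The quadratic variation of Brownian motion. -/
theorem IsBrownianWrt.hasCovariation_self [IsProbabilityMeasure P] (hB : IsBrownianWrt 𝓕 P B)
    (T : ℝ≥0) : HasCovariation P T B B (fun t _ => t) := by
  intro t _ p hp
  rw [tendstoInMeasure_iff_norm]
  intro ε hε
  set m4 := ∫ x, x ^ 4 ∂(gaussianReal 0 1)
  have h1 : Tendsto (fun k => ENNReal.ofReal ((p k).mesh * (t * m4) / ε ^ 2)) atTop (𝓝 0) := by
    have : Tendsto (fun k => ((p k).mesh : ℝ) * (t * m4) / ε ^ 2) atTop (𝓝 (0 * (t * m4) / ε ^ 2)) :=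
      (((NNReal.tendsto_coe.2 hp)).mul_const _).div_const _
    simpa using ENNReal.tendsto_ofReal this
  refine tendsto_of_tendsto_of_tendsto_of_le_of_le tendsto_const_nhds h1 (fun _ => zero_le)
    fun k => ?_
  have hL2 : MemLp ((p k).covSum B B) 2 P := by
    have e : (p k).covSum B B = ∑ i ∈ Finset.range (p k).n,
        fun ω => (B ((p k).pts (i + 1)) ω - B ((p k).pts i) ω) ^ 2 := by
      ext ω
      rw [Finset.sum_apply]
      exact Finset.sum_congr rfl fun i _ => (pow_two _).symm
    rw [e]
    exact memLp_finsetSum' _ fun i _ => hB.memLp_sub_sq _ _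
  have h2 := meas_ge_le_variance_div_sq hL2 hε
  rw [hB.integral_covSum] at h2
  refine h2.trans (ENNReal.ofReal_le_ofReal ?_)
  gcongr
  exact hB.variance_covSum_le (p k)

/-- The process stopped at the deterministic time `a`. -/
def stopAt (B : ℝ≥0 → Ω → ℝ) (a : ℝ≥0) (s : ℝ≥0) (ω : Ω) : ℝ := B (min a s) ω

theorem lintegral_enorm_mul_le {α : Type*} {mα : MeasurableSpace α} {μ : Measure α} {f g : α → ℝ}
    (hf : MemLp f 2 μ) (hg : MemLp g 2 μ) {C : ℝ} (hfC : ∫ x, f x ^ 2 ∂μ ≤ C)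
    (hgC : ∫ x, g x ^ 2 ∂μ ≤ C) : ∫⁻ x, ‖f x * g x‖ₑ ∂μ ≤ ENNReal.ofReal C := by
  have hfg : Integrable (fun x => f x * g x) μ := hf.integrable_mul hg
  rw [← ofReal_integral_norm_eq_lintegral_enorm hfg]
  refine ENNReal.ofReal_le_ofReal ?_
  have h1 : ∫ x, ‖f x * g x‖ ∂μ ≤ ∫ x, (f x ^ 2 + g x ^ 2) / 2 ∂μ := by
    refine integral_mono hfg.norm
      ((hf.integrable_sq.add hg.integrable_sq).div_const 2) fun x => ?_
    simp only [Real.norm_eq_abs, abs_mul]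
    nlinarith [sq_nonneg (|f x| - |g x|), sq_abs (f x), sq_abs (g x)]
  rw [integral_div, integral_add hf.integrable_sq hg.integrable_sq] at h1
  linarith

/-- The first process moves only before a and the second only after a. Hence only a partition
interval with a in its interior contributes, and its L¹ norm is at most the mesh. -/
theorem tendstoInMeasure_covSum_stopAt_sub (hB₁ : IsBrownianWrt 𝓕 P B₁) (hB₂ : IsBrownianWrt 𝓕 P B₂)
    {a b : ℝ≥0} (hab : a ≤ b) {t : ℝ≥0} (p : ℕ → TimePartition t)
    (hp : Tendsto (fun k => (p k).mesh) atTop (𝓝 0)) :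
    TendstoInMeasure P (fun k => (p k).covSum (stopAt B₁ a)
      (fun s ω => stopAt B₂ b s ω - stopAt B₂ a s ω)) atTop (fun _ => 0) := by
  have hm₁ : ∀ c s, Measurable (stopAt B₁ c s) := fun c s => hB₁.measurable _
  have hm₂ : ∀ c s, Measurable (stopAt B₂ c s) := fun c s => hB₂.measurable _
  refine tendstoInMeasure_zero_of_lintegral_le (u := fun k => ((p k).mesh : ℝ))
    (fun k => ((p k).measurable_covSum (hm₁ a)
      fun s => (hm₂ b s).sub (hm₂ a s)).aestronglyMeasurable) (fun k => ?_)
    (NNReal.tendsto_coe.2 hp)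
  set q := p k
  set F : ℕ → Ω → ℝ := fun i ω => (stopAt B₁ a (q.pts (i + 1)) ω - stopAt B₁ a (q.pts i) ω) *
    ((stopAt B₂ b (q.pts (i + 1)) ω - stopAt B₂ a (q.pts (i + 1)) ω)
      - (stopAt B₂ b (q.pts i) ω - stopAt B₂ a (q.pts i) ω)) with hF
  have hFm : ∀ i, Measurable (F i) := fun i => ((hm₁ _ _).sub (hm₁ _ _)).mul
    (((hm₂ _ _).sub (hm₂ _ _)).sub ((hm₂ _ _).sub (hm₂ _ _)))
  have hz : ∀ i, ¬ (q.pts i < a ∧ a < q.pts (i + 1)) → F i = 0 := by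
    intro i hi
    ext ω
    simp only [hF, stopAt, Pi.zero_apply]
    rw [not_and_or, not_lt, not_lt] at hi
    rcases hi with hi | hi
    · rw [min_eq_left hi, min_eq_left (hi.trans (q.pts_le_succ i))]; ring
    · rw [min_eq_right hi, min_eq_right (hi.trans hab),
        min_eq_right ((q.pts_le_succ i).trans hi),
        min_eq_right ((q.pts_le_succ i).trans (hi.trans hab))]; ring
  have hb : ∀ i ∈ Finset.range q.n, q.pts i < a → a < q.pts (i + 1) →
      ∫⁻ ω, ‖F i ω‖ₑ ∂P ≤ ENNReal.ofReal q.mesh := by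
    intro i hi h1 h2
    have e : F i = fun ω => (B₁ a ω - B₁ (q.pts i) ω) * (B₂ (min b (q.pts (i + 1))) ω - B₂ a ω) := by
      ext ω
      simp only [hF, stopAt]
      rw [min_eq_left h2.le, min_eq_right h1.le, min_eq_right (h1.le.trans hab)]; ring
    have hmesh := q.sub_le_mesh hi
    have h1' : (q.pts i : ℝ) < a := h1
    have h2' : (a : ℝ) < q.pts (i + 1) := h2
    have h3 : a ≤ min b (q.pts (i + 1)) := le_min hab h2.le
    have h4 : ((min b (q.pts (i + 1)) : ℝ≥0) : ℝ) ≤ q.pts (i + 1) := NNReal.coe_le_coe.2 (min_le_right _ _)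
    rw [e]
    refine lintegral_enorm_mul_le (hB₁.memLp_sub _ _ (by simp)) (hB₂.memLp_sub _ _ (by simp)) ?_ ?_
    · rw [hB₁.integral_sub_sq h1.le]; linarith
    · rw [hB₂.integral_sub_sq h3]; linarith
  -- At most one partition interval has a in its interior.
  have hcard : ((Finset.range q.n).filter fun i => q.pts i < a ∧ a < q.pts (i + 1)).card ≤ 1 := by
    rw [Finset.card_le_one]
    intro i hi j hj
    simp only [Finset.mem_filter] at hi hj
    by_contra hne
    rcases lt_or_gt_of_ne hne with h | h
    · exact absurd (hi.2.2.trans_le (q.mono (Nat.succ_le_of_lt h))) (not_lt.2 hj.2.1.le)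
    · exact absurd (hj.2.2.trans_le (q.mono (Nat.succ_le_of_lt h))) (not_lt.2 hi.2.1.le)
  calc ∫⁻ ω, ‖∑ i ∈ Finset.range q.n, F i ω‖ₑ ∂P
      ≤ ∫⁻ ω, ∑ i ∈ Finset.range q.n, ‖F i ω‖ₑ ∂P := lintegral_mono fun ω => enorm_sum_le _ _
    _ = ∑ i ∈ Finset.range q.n, ∫⁻ ω, ‖F i ω‖ₑ ∂P :=
      lintegral_finsetSum _ fun i _ => (hFm i).enorm
    _ = ∑ i ∈ (Finset.range q.n).filter fun i => q.pts i < a ∧ a < q.pts (i + 1),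
          ∫⁻ ω, ‖F i ω‖ₑ ∂P := by
      rw [Finset.sum_filter_of_ne]
      intro i _ hne
      by_contra hcon
      exact hne (by rw [hz i hcon]; simp)
    _ ≤ ((Finset.range q.n).filter fun i => q.pts i < a ∧ a < q.pts (i + 1)).card •
          ENNReal.ofReal q.mesh := by
      refine Finset.sum_le_card_nsmul _ _ _ fun i hi => ?_
      rw [Finset.mem_filter] at hi
      exact hb i hi.1 hi.2.1 hi.2.2
    _ ≤ 1 • ENNReal.ofReal q.mesh := by gcongr
    _ = ENNReal.ofReal q.mesh := one_smul _ _

/-- For a ≤ b the process stopped at b is the process stopped at a plus a remainder that contributes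
nothing in the limit. -/
theorem tendstoInMeasure_covSum_stopAt (hB₁ : IsBrownianWrt 𝓕 P B₁) (hB₂ : IsBrownianWrt 𝓕 P B₂)
    {c : ℝ} (hc : ∀ T, HasCovariation P T B₁ B₂ (fun t _ => c * t)) (a b : ℝ≥0) {t : ℝ≥0}
    (p : ℕ → TimePartition t) (hp : Tendsto (fun k => (p k).mesh) atTop (𝓝 0)) :
    TendstoInMeasure P (fun k => (p k).covSum (stopAt B₁ a) (stopAt B₂ b)) atTop
      (fun _ => c * (min (min a b) t : ℝ≥0)) := by
  wlog hab : a ≤ b generalizing a b B₁ B₂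
  · have := this hB₂ hB₁ (fun T => (hc T).symm) b a (le_of_not_ge hab)
    rw [min_comm a b]
    exact this.congr_left fun k => ae_of_all _ fun ω => (p k).covSum_comm _ _ ω
  rw [min_eq_left hab]
  have hp' : Tendsto (fun k => ((p k).cut a).mesh) atTop (𝓝 0) :=
    tendsto_of_tendsto_of_tendsto_of_le_of_le tendsto_const_nhds hp (fun _ => zero_le)
      fun k => (p k).mesh_cut_le a
  -- Sums of both processes stopped at a along `p k` are, by definition, sums of the unstopped
  -- processes along the partition cut at a.
  have h1 := hc _ _ le_rfl (fun k => (p k).cut a) hp'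
  have h2 := h1.add_real (tendstoInMeasure_covSum_stopAt_sub hB₁ hB₂ hab p hp)
  refine (h2.congr_left fun k => ae_of_all _ fun ω => ?_).congr_right (ae_of_all _ fun ω => by simp)
  have e := (p k).covSum_add_right (stopAt B₁ a) (stopAt B₂ a)
    (fun s ω => stopAt B₂ b s ω - stopAt B₂ a s ω) ω
  simp only [add_sub_cancel] at e
  exact e.symm

/-- An elementary integral is a bounded, time-independent random factor times a difference of two
stopped processes. Bilinearity leaves four stopped covariations. -/
theorem tendstoInMeasure_covSum_elemInt (hB₁ : IsBrownianWrt 𝓕 P B₁) (hB₂ : IsBrownianWrt 𝓕 P B₂)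
    {c : ℝ} (hc : ∀ T, HasCovariation P T B₁ B₂ (fun t _ => c * t)) {a₁ b₁ a₂ b₂ : ℝ≥0}
    (h₁ : a₁ ≤ b₁) (h₂ : a₂ ≤ b₂) {η θ : Ω → ℝ} {C D : ℝ} (hC : ∀ ω, |η ω| ≤ C)
    (hD : ∀ ω, |θ ω| ≤ D) {t : ℝ≥0} (p : ℕ → TimePartition t)
    (hp : Tendsto (fun k => (p k).mesh) atTop (𝓝 0)) :
    TendstoInMeasure P
      (fun k => (p k).covSum (fun s => elemInt B₁ (min a₁ s) (min b₁ s) η)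
        (fun s => elemInt B₂ (min a₂ s) (min b₂ s) θ)) atTop
      (fun ω => c * ∫ s in Set.Ioc 0 t, elemVal a₁ b₁ η (s, ω) * elemVal a₂ b₂ θ (s, ω)) := by
  have key := tendstoInMeasure_covSum_stopAt hB₁ hB₂ hc
  have h := (((key b₁ b₂ p hp).sub_real (key a₁ b₂ p hp)).sub_real
    ((key b₁ a₂ p hp).sub_real (key a₁ a₂ p hp))).bdd_mul_real (η := fun ω => η ω * θ ω) (C := C * D)
      (fun ω => by
        rw [abs_mul]
        exact mul_le_mul (hC ω) (hD ω) (abs_nonneg _) ((abs_nonneg _).trans (hC ω)))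
  refine (h.congr_left fun k => ae_of_all _ fun ω => ?_).congr_right (ae_of_all _ fun ω => ?_)
  · simp only [TimePartition.covSum, ← Finset.sum_sub_distrib, Finset.mul_sum]
    refine Finset.sum_congr rfl fun i _ => ?_
    simp only [elemInt, stopAt]
    ring
  -- The four limits are recognised through 1_(a, b] = 1_{≤ b} - 1_{≤ a} and 1_{≤ a} 1_{≤ b} = 1_{≤
  -- min a b}.
  · have e1 : ∀ s : ℝ≥0, elemVal a₁ b₁ η (s, ω) * elemVal a₂ b₂ θ (s, ω) = (η ω * θ ω) *
        (((Set.Iic (min b₁ b₂)).indicator (fun _ => (1 : ℝ)) s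
            - (Set.Iic (min a₁ b₂)).indicator (fun _ => (1 : ℝ)) s)
          - ((Set.Iic (min b₁ a₂)).indicator (fun _ => (1 : ℝ)) s
            - (Set.Iic (min a₁ a₂)).indicator (fun _ => (1 : ℝ)) s)) := by
      intro s
      have g1 : ∀ {a b : ℝ≥0} (ζ : Ω → ℝ), a ≤ b → elemVal a b ζ (s, ω) = ζ ω *
          ((Set.Iic b).indicator (fun _ => (1 : ℝ)) s
            - (Set.Iic a).indicator (fun _ => (1 : ℝ)) s) := by
        intro a b ζ hab
        simp only [elemVal, Set.indicator_apply, Set.mem_Ioc, Set.mem_Iic]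
        rcases le_or_gt s a with h | h
        · simp [h, h.trans hab, not_lt.2 h]
        · simp [h, not_le.2 h]
      have g2 : ∀ a b : ℝ≥0, (Set.Iic (min a b)).indicator (fun _ => (1 : ℝ)) s
          = (Set.Iic a).indicator (fun _ => (1 : ℝ)) s
            * (Set.Iic b).indicator (fun _ => (1 : ℝ)) s := by
        intro a b
        simp only [Set.indicator_apply, Set.mem_Iic, le_min_iff, ite_and, mul_ite, mul_one, mul_zero]
        split_ifs <;> rfl
      rw [g1 η h₁, g1 θ h₂, g2, g2, g2, g2]
      ring
    have e2 : ∀ e : ℝ≥0, IntegrableOn ((Set.Iic e).indicator (fun _ => (1 : ℝ))) (Set.Ioc 0 t) :=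
      fun e => (integrable_const _).indicator measurableSet_Iic
    have e3 : ∀ e : ℝ≥0, ∫ s in Set.Ioc 0 t, (Set.Iic e).indicator (fun _ => (1 : ℝ)) s
        = (min e t : ℝ≥0) := by
      intro e
      rw [setIntegral_indicator measurableSet_Iic, Set.Ioc_inter_Iic, setIntegral_const,
        NNReal.measureReal_Ioc zero_le, min_comm]
      simp
    simp_rw [e1]
    rw [integral_const_mul, integral_sub, integral_sub (e2 _) (e2 _), integral_sub (e2 _) (e2 _),
      e3, e3, e3, e3]
    · ring
    · exact (e2 _).sub (e2 _)
    · exact (e2 _).sub (e2 _)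

end BrownianCovariation

/-! ### Extending convergence in measure to closed linear spans -/

section Closure

variable {Ω : Type*} [mΩ : MeasurableSpace Ω] {P : Measure Ω} {E : Type*} [NormedAddCommGroup E]
  [NormedSpace ℝ E]

/-- `φ` maps vectors to random variables, is linear up to null sets, and bounded by `K` as a map
into `L¹`. -/
structure IsAELinearBounded (P : Measure Ω) (K : ℝ) (φ : E → Ω → ℝ) : Prop where
  aesm : ∀ x, AEStronglyMeasurable (φ x) P
  add : ∀ x y, φ (x + y) =ᵐ[P] fun ω => φ x ω + φ y ω
  smul : ∀ (c : ℝ) x, φ (c • x) =ᵐ[P] fun ω => c * φ x ω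
  bound : ∀ x, ∫⁻ ω, ‖φ x ω‖ₑ ∂P ≤ ENNReal.ofReal (K * ‖x‖)

theorem IsAELinearBounded.sub {K : ℝ} {φ : E → Ω → ℝ} (h : IsAELinearBounded P K φ) (x y : E) :
    φ (x - y) =ᵐ[P] fun ω => φ x ω - φ y ω := by
  rw [show x - y = x + (-1 : ℝ) • y by simp [sub_eq_add_neg]]
  filter_upwards [h.add x ((-1 : ℝ) • y), h.smul (-1) y] with ω h1 h2
  rw [h1, h2]; ring

/-- Convergence in measure of a uniformly bounded sequence of linear maps extends from a set to the
closed linear span. -/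
theorem tendstoInMeasure_of_mem_topologicalClosure_span {φ : ℕ → E → Ω → ℝ} {ψ : E → Ω → ℝ} {K : ℝ}
    (hφ : ∀ k, IsAELinearBounded P K (φ k)) (hψ : IsAELinearBounded P K ψ) {s : Set E}
    (hs : ∀ x ∈ s, TendstoInMeasure P (fun k => φ k x) atTop (ψ x)) {x : E}
    (hx : x ∈ (Submodule.span ℝ s).topologicalClosure) :
    TendstoInMeasure P (fun k => φ k x) atTop (ψ x) := by
  have hzero : ∀ {φ : E → Ω → ℝ}, IsAELinearBounded P K φ → φ 0 =ᵐ[P] fun _ => 0 := by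
    intro φ h
    filter_upwards [h.smul 0 0] with ω h1
    rw [smul_zero] at h1
    rw [h1, zero_mul]
  have hspan : ∀ x ∈ Submodule.span ℝ s, TendstoInMeasure P (fun k => φ k x) atTop (ψ x) := by
    intro x hx
    induction hx using Submodule.span_induction with
    | mem x hx => exact hs x hx
    | zero =>
      refine TendstoInMeasure.congr (fun k => (hzero (hφ k)).symm) (hzero hψ).symm ?_
      exact tendstoInMeasure_of_tendsto_eLpNorm_top (by simp)
    | add x y _ _ h1 h2 =>
      exact (h1.add_real h2).congr (fun k => ((hφ k).add x y).symm) (hψ.add x y).symm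
    | smul c x _ h1 =>
      exact (h1.const_mul_real c).congr (fun k => ((hφ k).smul c x).symm) (hψ.smul c x).symm
  refine tendstoInMeasure_of_forall_pos_approx (fun k => (hφ k).aesm x) (hψ.aesm x) fun η hη => ?_
  have hx' : x ∈ closure (Submodule.span ℝ s : Set E) := hx
  -- At this distance the common bound K makes the L¹ error at most η for every `φ k` and for the
  -- limit `ψ` simultaneously.
  obtain ⟨y, hy, hxy⟩ := Metric.mem_closure_iff.1 hx' (η / (|K| + 1)) (by positivity)
  have hb : K * ‖x - y‖ ≤ η := by
    rw [dist_eq_norm, lt_div_iff₀ (by positivity)] at hxy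
    nlinarith [le_abs_self K, norm_nonneg (x - y)]
  have hle : ∀ {φ : E → Ω → ℝ}, IsAELinearBounded P K φ →
      ∫⁻ ω, ‖φ x ω - φ y ω‖ₑ ∂P ≤ ENNReal.ofReal η := by
    intro φ h
    refine le_trans (le_of_eq ?_) ((h.bound (x - y)).trans (ENNReal.ofReal_le_ofReal hb))
    refine lintegral_congr_ae ?_
    filter_upwards [h.sub x y] with ω h1
    rw [h1]
  exact ⟨fun k => φ k y, ψ y, hspan y hy, fun k => (hφ k).aesm y, hψ.aesm y,
    fun k => hle (hφ k), hle hψ⟩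

end Closure

/-! ### Square-integrable martingales and their covariation sums -/

section CondExp

theorem L2.condExpL_condExpL_of_le {Ω : Type*} {m₁ m₂ mΩ : MeasurableSpace Ω} {P : Measure Ω}
    [IsProbabilityMeasure P] (h₁₂ : m₁ ≤ m₂) (h₁ : m₁ ≤ mΩ)
    (h₂ : m₂ ≤ mΩ) (f : Lp ℝ 2 P) :
    L2.condExpL P h₁ (L2.condExpL P h₂ f) = L2.condExpL P h₁ f := by
  refine Lp.ext ((L2.coeFn_condExpL h₁ _).trans
    (((condExp_congr_ae (L2.coeFn_condExpL h₂ f)).trans (condExp_condExp_of_le h₁₂ h₂)).trans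
      (L2.coeFn_condExpL h₁ f).symm))

theorem L2.inner_condExpL_left_eq_right {Ω : Type*} {m mΩ : MeasurableSpace Ω} {P : Measure Ω}
    (hm : m ≤ mΩ) (f g : Lp ℝ 2 P) :
    inner ℝ (L2.condExpL P hm f) g = inner ℝ f (L2.condExpL P hm g) :=
  inner_condExpL2_left_eq_right hm

/-- Pythagoras for orthogonal projections onto nested subspaces. -/
theorem L2.norm_sq_condExpL_sub {Ω : Type*} {m₁ m₂ mΩ : MeasurableSpace Ω} {P : Measure Ω}
    [IsProbabilityMeasure P] (h₁₂ : m₁ ≤ m₂) (h₁ : m₁ ≤ mΩ)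
    (h₂ : m₂ ≤ mΩ) (f : Lp ℝ 2 P) :
    ‖L2.condExpL P h₂ f - L2.condExpL P h₁ f‖ ^ 2
      = ‖L2.condExpL P h₂ f‖ ^ 2 - ‖L2.condExpL P h₁ f‖ ^ 2 := by
  have h : inner ℝ (L2.condExpL P h₂ f) (L2.condExpL P h₁ f) = ‖L2.condExpL P h₁ f‖ ^ 2 := by
    rw [← real_inner_self_eq_norm_sq]
    conv_lhs => rw [← L2.condExpL_condExpL_of_le le_rfl h₁ h₁ f]
    rw [← L2.inner_condExpL_left_eq_right h₁, L2.condExpL_condExpL_of_le h₁₂ h₁ h₂]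
  rw [norm_sub_sq_real, h]
  ring

theorem L2.norm_condExpL_le {Ω : Type*} {m mΩ : MeasurableSpace Ω} {P : Measure Ω} (hm : m ≤ mΩ) (f : Lp ℝ 2 P) :
    ‖L2.condExpL P hm f‖ ≤ ‖f‖ :=
  norm_condExpL2_le hm f

variable {Ω : Type*} [mΩ : MeasurableSpace Ω] {𝓕 : Filtration ℝ≥0 mΩ} {P : Measure Ω}
  [IsProbabilityMeasure P]

/-- The martingale of conditional expectations of a square-integrable random variable. -/
noncomputable def martProc (𝓕 : Filtration ℝ≥0 mΩ) (f : Lp ℝ 2 P) (s : ℝ≥0) : Lp ℝ 2 P :=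
  L2.condExpL P (𝓕.le s) f

/-- The squared norms telescope. The bound does not depend on the partition, which is what the
closure argument needs. -/
theorem sum_norm_sq_martProc_le (𝓕 : Filtration ℝ≥0 mΩ) (f : Lp ℝ 2 P) {t : ℝ≥0}
    (p : TimePartition t) : ∑ i ∈ Finset.range p.n,
      ‖martProc 𝓕 f (p.pts (i + 1)) - martProc 𝓕 f (p.pts i)‖ ^ 2 ≤ ‖f‖ ^ 2 := by
  have h : ∀ i ∈ Finset.range p.n, ‖martProc 𝓕 f (p.pts (i + 1)) - martProc 𝓕 f (p.pts i)‖ ^ 2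
      = ‖martProc 𝓕 f (p.pts (i + 1))‖ ^ 2 - ‖martProc 𝓕 f (p.pts i)‖ ^ 2 :=
    fun i _ => L2.norm_sq_condExpL_sub (𝓕.mono (p.pts_le_succ i)) _ _ f
  rw [Finset.sum_congr rfl h, Finset.sum_range_sub (fun i => ‖martProc 𝓕 f (p.pts i)‖ ^ 2)]
  have h1 : ‖martProc 𝓕 f (p.pts p.n)‖ ^ 2 ≤ ‖f‖ ^ 2 := by
    gcongr
    exact L2.norm_condExpL_le _ f
  linarith [sq_nonneg ‖martProc 𝓕 f (p.pts 0)‖]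

theorem L2.lintegral_enorm_mul_le {α : Type*} {mα : MeasurableSpace α} {μ : Measure α}
    (f g : Lp ℝ 2 μ) : ∫⁻ x, ‖f x * g x‖ₑ ∂μ ≤ ENNReal.ofReal (‖f‖ * ‖g‖) := by
  have h1 : inner ℝ |f| |g| ≤ ‖f‖ * ‖g‖ := by
    have := real_inner_le_norm |f| |g|
    rwa [norm_abs_eq_norm, norm_abs_eq_norm] at this
  rw [L2.inner_eq_integral_mul] at h1
  have h2 : Integrable (fun x => f x * g x) μ := (Lp.memLp f).integrable_mul (Lp.memLp g)
  rw [← ofReal_integral_norm_eq_lintegral_enorm h2]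
  refine ENNReal.ofReal_le_ofReal (le_trans (le_of_eq (integral_congr_ae ?_)) h1)
  filter_upwards [Lp.coeFn_abs f, Lp.coeFn_abs g] with x h3 h4
  rw [h3, h4, norm_mul, Real.norm_eq_abs, Real.norm_eq_abs]

/-- Cauchy–Schwarz twice: over Ω on each partition interval, then over the intervals. -/
theorem lintegral_enorm_covSum_martProc_le (f g : Lp ℝ 2 P) {t : ℝ≥0} (p : TimePartition t) :
    ∫⁻ ω, ‖p.covSum (fun s => ⇑(martProc 𝓕 f s)) (fun s => ⇑(martProc 𝓕 g s)) ω‖ₑ ∂P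
      ≤ ENNReal.ofReal (‖f‖ * ‖g‖) := by
  set F : ℕ → Lp ℝ 2 P := fun i => martProc 𝓕 f (p.pts (i + 1)) - martProc 𝓕 f (p.pts i) with hF
  set G : ℕ → Lp ℝ 2 P := fun i => martProc 𝓕 g (p.pts (i + 1)) - martProc 𝓕 g (p.pts i) with hG
  have e : p.covSum (fun s => ⇑(martProc 𝓕 f s)) (fun s => ⇑(martProc 𝓕 g s)) =ᵐ[P]
      fun ω => ∑ i ∈ Finset.range p.n, F i ω * G i ω := by
    have h1 : ∀ᵐ ω ∂P, ∀ i : ℕ, F i ω = martProc 𝓕 f (p.pts (i + 1)) ω - martProc 𝓕 f (p.pts i) ω :=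
      ae_all_iff.2 fun i => Lp.coeFn_sub _ _
    have h2 : ∀ᵐ ω ∂P, ∀ i : ℕ, G i ω = martProc 𝓕 g (p.pts (i + 1)) ω - martProc 𝓕 g (p.pts i) ω :=
      ae_all_iff.2 fun i => Lp.coeFn_sub _ _
    filter_upwards [h1, h2] with ω h3 h4
    exact Finset.sum_congr rfl fun i _ => by rw [h3, h4]
  calc _ = ∫⁻ ω, ‖∑ i ∈ Finset.range p.n, F i ω * G i ω‖ₑ ∂P := by
        refine lintegral_congr_ae ?_
        filter_upwards [e] with ω h
        rw [h]
    _ ≤ ∫⁻ ω, ∑ i ∈ Finset.range p.n, ‖F i ω * G i ω‖ₑ ∂P := lintegral_mono fun ω => enorm_sum_le _ _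
    _ = ∑ i ∈ Finset.range p.n, ∫⁻ ω, ‖F i ω * G i ω‖ₑ ∂P :=
      lintegral_finsetSum' _ fun i _ =>
        ((Lp.aestronglyMeasurable (F i)).mul (Lp.aestronglyMeasurable (G i))).enorm
    _ ≤ ∑ i ∈ Finset.range p.n, ENNReal.ofReal (‖F i‖ * ‖G i‖) :=
      Finset.sum_le_sum fun i _ => L2.lintegral_enorm_mul_le _ _
    _ = ENNReal.ofReal (∑ i ∈ Finset.range p.n, ‖F i‖ * ‖G i‖) :=
      (ENNReal.ofReal_sum_of_nonneg fun i _ => by positivity).symm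
    _ ≤ ENNReal.ofReal (‖f‖ * ‖g‖) := by
      refine ENNReal.ofReal_le_ofReal ?_
      have h1 := Finset.sum_mul_sq_le_sq_mul_sq (Finset.range p.n) (fun i => ‖F i‖) (fun i => ‖G i‖)
      have h2 := sum_norm_sq_martProc_le 𝓕 f p
      have h3 := sum_norm_sq_martProc_le 𝓕 g p
      refine abs_le_of_sq_le_sq' ?_ (by positivity) |>.2
      refine h1.trans ?_
      rw [mul_pow]
      exact mul_le_mul h2 h3 (Finset.sum_nonneg fun i _ => by positivity) (by positivity)

/-- Any K above the norm of y is allowed, so that the sums and their limit functional can share one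
constant. -/
theorem isAELinearBounded_covSum_martProc (𝓕 : Filtration ℝ≥0 mΩ) (y : ItoSpace P) {t : ℝ≥0}
    (p : TimePartition t) {K : ℝ} (hK : ‖y‖ ≤ K) :
    IsAELinearBounded P K fun x : ItoSpace P =>
      p.covSum (fun s => ⇑(martProc 𝓕 x.snd s)) (fun s => ⇑(martProc 𝓕 y.snd s)) where
  aesm x := by
    refine AEStronglyMeasurable.congr (f := ∑ i ∈ Finset.range p.n,
      (⇑(martProc 𝓕 x.snd (p.pts (i + 1))) - ⇑(martProc 𝓕 x.snd (p.pts i))) *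
      (⇑(martProc 𝓕 y.snd (p.pts (i + 1))) - ⇑(martProc 𝓕 y.snd (p.pts i)))) ?_
      (ae_of_all _ fun ω => by simp [TimePartition.covSum])
    exact Finset.aestronglyMeasurable_sum _ fun i _ =>
      ((Lp.aestronglyMeasurable _).sub (Lp.aestronglyMeasurable _)).mul
        ((Lp.aestronglyMeasurable _).sub (Lp.aestronglyMeasurable _))
  add x x' := by
    refine (p.covSum_ae_congr (A' := fun s ω => martProc 𝓕 x.snd s ω + martProc 𝓕 x'.snd s ω)
      (fun s _ => ?_) (fun s _ => ae_eq_rfl)).trans (ae_of_all _ fun ω => p.covSum_add_left _ _ _ ω)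
    have e : martProc 𝓕 (x + x').snd s = martProc 𝓕 x.snd s + martProc 𝓕 x'.snd s := map_add _ _ _
    rw [e]
    exact Lp.coeFn_add _ _
  smul c x := by
    refine (p.covSum_ae_congr (A' := fun s ω => c * martProc 𝓕 x.snd s ω)
      (fun s _ => ?_) (fun s _ => ae_eq_rfl)).trans (ae_of_all _ fun ω => ?_)
    · have e : martProc 𝓕 (c • x).snd s = c • martProc 𝓕 x.snd s := map_smul _ _ _
      rw [e]
      exact Lp.coeFn_smul _ _
    · simp only [TimePartition.covSum, Finset.mul_sum]
      exact Finset.sum_congr rfl fun _ _ => by ring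
  bound x := by
    refine (lintegral_enorm_covSum_martProc_le x.snd y.snd p).trans (ENNReal.ofReal_le_ofReal ?_)
    rw [mul_comm]
    have h1 : ‖x.snd‖ ≤ ‖x‖ := WithLp.norm_snd_le _ _
    have h2 : ‖y.snd‖ ≤ ‖y‖ := WithLp.norm_snd_le _ _
    exact mul_le_mul (h2.trans hK) h1 (norm_nonneg _) ((norm_nonneg _).trans hK)

theorem isAELinearBounded_integral_mul (y : ItoSpace P) (t : ℝ≥0) (c : ℝ) {K : ℝ}
    (hK : |c| * ‖y‖ ≤ K) :
    IsAELinearBounded P K fun x : ItoSpace P => fun ω =>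
      c * ∫ s in Set.Ioc 0 t, x.fst (s, ω) * y.fst (s, ω) := by
  have hint : ∀ x : ItoSpace P, Integrable (fun q : ℝ≥0 × Ω => x.fst q * y.fst q)
      (((volume : Measure ℝ≥0).restrict (Set.Ioc 0 t)).prod P) := by
    intro x
    have h1 : Integrable (fun q : ℝ≥0 × Ω => x.fst q * y.fst q) ((volume : Measure ℝ≥0).prod P) :=
      (Lp.memLp x.fst).integrable_mul (Lp.memLp y.fst)
    have h2 := h1.integrableOn (s := Set.Ioc 0 t ×ˢ Set.univ)
    rwa [IntegrableOn, ← Measure.prod_restrict, Measure.restrict_univ] at h2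
  have hae : ∀ {f g : ℝ≥0 × Ω → ℝ}, f =ᵐ[(volume : Measure ℝ≥0).prod P] g →
      ∀ᵐ ω ∂P, ∀ᵐ s ∂((volume : Measure ℝ≥0).restrict (Set.Ioc 0 t)), f (s, ω) = g (s, ω) := by
    intro f g h
    have h1 := Measure.ae_ae_of_ae_prod ((Measure.measurePreserving_swap
      (μ := P) (ν := (volume : Measure ℝ≥0))).quasiMeasurePreserving.ae h)
    filter_upwards [h1] with ω hω using ae_restrict_of_ae hω
  refine ⟨fun x => ?_, fun x x' => ?_, fun a x => ?_, fun x => ?_⟩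
  · have h1 := (hint x).swap.aestronglyMeasurable.integral_prod_right'
    exact h1.const_mul c
  · filter_upwards [hae (Lp.coeFn_add x.fst x'.fst), (hint x).prod_left_ae, (hint x').prod_left_ae]
      with ω h1 h2 h3
    rw [← mul_add, ← integral_add h2 h3]
    congr 1
    refine integral_congr_ae ?_
    filter_upwards [h1] with s hs
    rw [WithLp.add_fst, hs, Pi.add_apply, add_mul]
  · filter_upwards [hae (Lp.coeFn_smul a x.fst)] with ω h1
    rw [mul_left_comm]
    congr 1
    rw [← integral_const_mul]
    refine integral_congr_ae ?_
    filter_upwards [h1] with s hs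
    rw [WithLp.smul_fst, hs, Pi.smul_apply, smul_eq_mul, mul_assoc]
  · calc ∫⁻ ω, ‖c * ∫ s in Set.Ioc 0 t, x.fst (s, ω) * y.fst (s, ω)‖ₑ ∂P
        ≤ ∫⁻ ω, ‖c‖ₑ * (∫⁻ s : ℝ≥0, ‖x.fst (s, ω) * y.fst (s, ω)‖ₑ) ∂P := by
          refine lintegral_mono fun ω => ?_
          rw [enorm_mul]
          gcongr
          exact (enorm_integral_le_lintegral_enorm _).trans
            (lintegral_mono' Measure.restrict_le_self le_rfl)
      _ = ‖c‖ₑ * ∫⁻ q, ‖x.fst q * y.fst q‖ₑ ∂((volume : Measure ℝ≥0).prod P) := by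
          rw [lintegral_const_mul' _ _ enorm_ne_top, lintegral_prod_symm]
          exact ((Lp.aestronglyMeasurable x.fst).mul (Lp.aestronglyMeasurable y.fst)).enorm
      _ ≤ ENNReal.ofReal |c| * ENNReal.ofReal (‖x.fst‖ * ‖y.fst‖) := by
          rw [Real.enorm_eq_ofReal_abs]
          gcongr
          exact L2.lintegral_enorm_mul_le _ _
      _ ≤ ENNReal.ofReal (K * ‖x‖) := by
          rw [← ENNReal.ofReal_mul (abs_nonneg _)]
          refine ENNReal.ofReal_le_ofReal ?_
          have h1 : ‖x.fst‖ ≤ ‖x‖ := WithLp.norm_fst_le _ _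
          have h2 : ‖y.fst‖ ≤ ‖y‖ := WithLp.norm_fst_le _ _
          calc |c| * (‖x.fst‖ * ‖y.fst‖) ≤ |c| * (‖x‖ * ‖y‖) := by gcongr
            _ = (|c| * ‖y‖) * ‖x‖ := by ring
            _ ≤ K * ‖x‖ := by gcongr

variable {B₁ B₂ : ℝ≥0 → Ω → ℝ}

/-- Both sides are bilinear, so the passage from elementary integrands to the closed span is made
first in x and then, with the roles exchanged by symmetry of the sums, in y. -/
theorem tendstoInMeasure_covSum_martProc (hB₁ : IsBrownianWrt 𝓕 P B₁) (hB₂ : IsBrownianWrt 𝓕 P B₂)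
    {c : ℝ} (hc : ∀ T, HasCovariation P T B₁ B₂ (fun t _ => c * t)) {x y : ItoSpace P}
    (hx : x ∈ itoSubmodule 𝓕 P B₁) (hy : y ∈ itoSubmodule 𝓕 P B₂) {t : ℝ≥0}
    (p : ℕ → TimePartition t) (hp : Tendsto (fun k => (p k).mesh) atTop (𝓝 0)) :
    TendstoInMeasure P (fun k => (p k).covSum (fun s => ⇑(martProc 𝓕 x.snd s))
      (fun s => ⇑(martProc 𝓕 y.snd s))) atTop
      (fun ω => c * ∫ s in Set.Ioc 0 t, x.fst (s, ω) * y.fst (s, ω)) := by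
  have hgen : ∀ x ∈ itoGenerators 𝓕 P B₁, ∀ y ∈ itoGenerators 𝓕 P B₂,
      TendstoInMeasure P (fun k => (p k).covSum (fun s => ⇑(martProc 𝓕 x.snd s))
      (fun s => ⇑(martProc 𝓕 y.snd s))) atTop
      (fun ω => c * ∫ s in Set.Ioc 0 t, x.fst (s, ω) * y.fst (s, ω)) := by
    rintro x ⟨a₁, b₁, η, h₁, hη, ⟨C, hC⟩, hx1, hx2⟩ y ⟨a₂, b₂, θ, h₂, hθ, ⟨D, hD⟩, hy1, hy2⟩
    refine (tendstoInMeasure_covSum_elemInt hB₁ hB₂ hc h₁ h₂ hC hD p hp).congr (fun k => ?_) ?_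
    · refine (p k).covSum_ae_congr (fun s _ => ?_) (fun s _ => ?_)
      · exact ((L2.coeFn_condExpL _ _).trans ((condExp_congr_ae hx2).trans
          (condExp_elemInt hB₁ s h₁ hη hC))).symm
      · exact ((L2.coeFn_condExpL _ _).trans ((condExp_congr_ae hy2).trans
          (condExp_elemInt hB₂ s h₂ hθ hD))).symm
    · have h1 := Measure.ae_ae_of_ae_prod ((Measure.measurePreserving_swap
        (μ := P) (ν := (volume : Measure ℝ≥0))).quasiMeasurePreserving.ae (hx1.mul hy1))
      filter_upwards [h1] with ω hω
      congr 1
      refine integral_congr_ae (ae_restrict_of_ae ?_)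
      filter_upwards [hω] with s hs using hs.symm
  have hleft : ∀ y ∈ itoGenerators 𝓕 P B₂,
      TendstoInMeasure P (fun k => (p k).covSum (fun s => ⇑(martProc 𝓕 x.snd s))
      (fun s => ⇑(martProc 𝓕 y.snd s))) atTop
      (fun ω => c * ∫ s in Set.Ioc 0 t, x.fst (s, ω) * y.fst (s, ω)) := fun y hy =>
    tendstoInMeasure_of_mem_topologicalClosure_span (K := max ‖y‖ (|c| * ‖y‖))
      (fun k => isAELinearBounded_covSum_martProc 𝓕 y (p k) (le_max_left _ _))
      (isAELinearBounded_integral_mul y t c (le_max_right _ _)) (fun x hx => hgen x hx y hy) hx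
  have h := tendstoInMeasure_of_mem_topologicalClosure_span (K := max ‖x‖ (|c| * ‖x‖))
      (fun k => isAELinearBounded_covSum_martProc 𝓕 x (p k) (le_max_left _ _))
      (isAELinearBounded_integral_mul x t c (le_max_right _ _))
      (fun y hy => ((hleft y hy).congr_left fun k => ae_of_all _ fun ω =>
        (p k).covSum_comm _ _ ω).congr_right (ae_of_all _ fun ω => by
        simp_rw [mul_comm (x.fst _)])) hy
  exact (h.congr_left fun k => ae_of_all _ fun ω =>
        (p k).covSum_comm _ _ ω).congr_right (ae_of_all _ fun ω => by simp_rw [mul_comm (y.fst _)])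

end CondExp

/-! ### Drift terms and the covariation of Itô processes -/

section Drift

/-- A factor bounded in L¹ is bounded in probability, so its product with one tending to zero in
measure tends to zero. The use is Cauchy–Schwarz, with v the squared increments of a martingale and
w those of a drift. -/
theorem tendstoInMeasure_zero_of_sq_le_mul {α : Type*} {mα : MeasurableSpace α} {μ : Measure α}
    {u v w : ℕ → α → ℝ} (h : ∀ k x, u k x ^ 2 ≤ v k x * w k x)
    (hv : ∀ k x, 0 ≤ v k x) (hw : ∀ k x, 0 ≤ w k x) (hvm : ∀ k, AEStronglyMeasurable (v k) μ) {K : ℝ}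
    (hK : ∀ k, ∫⁻ x, ‖v k x‖ₑ ∂μ ≤ ENNReal.ofReal K)
    (hw0 : TendstoInMeasure μ w atTop (fun _ => 0)) :
    TendstoInMeasure μ u atTop (fun _ => 0) := by
  rw [tendstoInMeasure_iff_norm] at hw0 ⊢
  intro ε hε
  rw [ENNReal.tendsto_nhds_zero]
  intro δ hδ
  wlog hδt : δ ≠ ⊤ generalizing δ
  · filter_upwards [this 1 one_pos ENNReal.one_ne_top] with i hi
    rw [not_not.1 hδt]
    exact le_top
  have hδ' : 0 < δ.toReal := ENNReal.toReal_pos hδ.ne' hδt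
  -- Markov's inequality gives measure at most δ/2 to v ≥ M; where v < M, |u| ≥ ε forces w ≥ ε² / M.
  set M := (|K| + 1) / (δ.toReal / 2) with hM
  have hM0 : 0 < M := by positivity
  have h1 := (ENNReal.tendsto_nhds_zero.1 (hw0 (ε ^ 2 / M) (by positivity)))
    (ENNReal.ofReal (δ.toReal / 2)) (by simpa using hδ')
  have markov : ∀ k, μ {x | M ≤ v k x} ≤ ENNReal.ofReal (δ.toReal / 2) := by
    intro k
    have e1 : {x | M ≤ v k x} = {x | ENNReal.ofReal M ≤ ‖v k x‖ₑ} := by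
      ext x
      rw [Set.mem_ofPred_eq, Set.mem_ofPred_eq, Real.enorm_eq_ofReal_abs,
        ENNReal.ofReal_le_ofReal_iff (abs_nonneg _), abs_of_nonneg (hv k x)]
    have e2 := (mul_meas_ge_le_lintegral₀ (hvm k).enorm (ENNReal.ofReal M)).trans (hK k)
    rw [e1]
    have e3 : ENNReal.ofReal K ≤ ENNReal.ofReal M * ENNReal.ofReal (δ.toReal / 2) := by
      rw [← ENNReal.ofReal_mul hM0.le]
      refine ENNReal.ofReal_le_ofReal ?_
      rw [hM, div_mul_cancel₀ _ (by positivity)]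
      linarith [le_abs_self K]
    have e4 := e2.trans e3
    rwa [ENNReal.mul_le_mul_iff_right (by simpa using hM0) ENNReal.ofReal_ne_top] at e4
  filter_upwards [h1] with k hk
  have hsub : {x | ε ≤ ‖u k x - 0‖} ⊆ {x | M ≤ v k x} ∪ {x | ε ^ 2 / M ≤ ‖w k x - 0‖} := by
    intro x hx
    simp only [Set.mem_ofPred_eq, Set.mem_union, Real.norm_eq_abs, sub_zero] at hx ⊢
    by_contra! hcon
    rw [abs_of_nonneg (hw k x), lt_div_iff₀ hM0] at hcon
    have e1 : ε ^ 2 ≤ u k x ^ 2 := by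
      rw [← sq_abs (u k x)]
      gcongr
    have e2 := h k x
    have e3 : v k x * w k x ≤ M * w k x := mul_le_mul_of_nonneg_right hcon.1.le (hw k x)
    linarith [hcon.2]
  refine (measure_mono hsub).trans ((measure_union_le _ _).trans
    ((add_le_add (markov k) hk).trans ?_))
  rw [← ENNReal.ofReal_add (by positivity) (by positivity)]
  exact ENNReal.ofReal_le_of_le_toReal (le_of_eq (by ring))

theorem TimePartition.sum_setIntegral {t : ℝ≥0} (p : TimePartition t) {f : ℝ≥0 → ℝ}
    (hf : IntegrableOn f (Set.Ioc 0 t)) :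
    ∑ i ∈ Finset.range p.n, ∫ s in Set.Ioc (p.pts i) (p.pts (i + 1)), f s
      = ∫ s in Set.Ioc 0 t, f s := by
  have h : ∀ n ≤ p.n, ∑ i ∈ Finset.range n, ∫ s in Set.Ioc (p.pts i) (p.pts (i + 1)), f s
      = ∫ s in Set.Ioc 0 (p.pts n), f s := by
    intro n hn
    induction n with
    | zero => simp [p.zero]
    | succ n ih =>
      rw [Finset.sum_range_succ, ih (Nat.le_of_succ_le hn),
        ← setIntegral_union (Set.Ioc_disjoint_Ioc_of_le le_rfl) measurableSet_Ioc
        (hf.mono_set (Set.Ioc_subset_Ioc_right (p.pts_le (Nat.le_of_succ_le hn))))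
        (hf.mono_set (Set.Ioc_subset_Ioc zero_le (p.pts_le hn))),
        Set.Ioc_union_Ioc_eq_Ioc zero_le (p.pts_le_succ n)]
  rw [h p.n le_rfl, p.last]

theorem setIntegral_Ioc_sub {f : ℝ≥0 → ℝ} {a b : ℝ≥0} (hab : a ≤ b)
    (hf : IntegrableOn f (Set.Ioc 0 b)) :
    (∫ s in Set.Ioc 0 b, f s) - ∫ s in Set.Ioc 0 a, f s = ∫ s in Set.Ioc a b, f s := by
  rw [← Set.Ioc_union_Ioc_eq_Ioc zero_le hab,
    setIntegral_union (Set.Ioc_disjoint_Ioc_of_le le_rfl) measurableSet_Ioc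
    (hf.mono_set (Set.Ioc_subset_Ioc_right hab))
    (hf.mono_set (Set.Ioc_subset_Ioc_left zero_le)), add_sub_cancel_left]

/-- An absolutely continuous function has vanishing quadratic variation. -/
theorem tendsto_covSum_setIntegral {Ω : Type*} {f : ℝ≥0 × Ω → ℝ} {t : ℝ≥0} {ω : Ω}
    (hf : IntegrableOn (fun s => f (s, ω)) (Set.Ioc 0 t)) (p : ℕ → TimePartition t)
    (hp : Tendsto (fun k => (p k).mesh) atTop (𝓝 0)) :
    Tendsto (fun k => (p k).covSum (fun r ω => ∫ s in Set.Ioc 0 r, f (s, ω))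
      (fun r ω => ∫ s in Set.Ioc 0 r, f (s, ω)) ω) atTop (𝓝 0) := by
  set I := ∫ s in Set.Ioc 0 t, |f (s, ω)| with hI
  have hI0 : 0 ≤ I := integral_nonneg fun _ => abs_nonneg _
  rw [Metric.tendsto_atTop]
  intro ε hε
  have hε' : 0 < ε / (I + 1) := by positivity
  -- Absolute continuity of the integral makes every increment at most ε / (I + 1) once the mesh is
  -- small. The sum of squares is at most this maximum times the total variation I.
  obtain ⟨δ, hδ, hδ'⟩ := exists_pos_setLIntegral_lt_of_measure_lt (f := fun s => ‖f (s, ω)‖ₑ)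
    (μ := volume.restrict (Set.Ioc 0 t)) hf.2.ne (ε := ENNReal.ofReal (ε / (I + 1)))
    (by simpa using hε')
  have hp' : Tendsto (fun k => ENNReal.ofReal (p k).mesh) atTop (𝓝 0) := by
    simpa using ENNReal.tendsto_ofReal (NNReal.tendsto_coe.2 hp)
  obtain ⟨k₀, hk₀⟩ := eventually_atTop.1 (hp'.eventually (gt_mem_nhds hδ))
  refine ⟨k₀, fun k hk => ?_⟩
  have hmesh := hk₀ k hk
  have habs : IntegrableOn (fun s => |f (s, ω)|) (Set.Ioc 0 t) := hf.abs
  set q := p k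
  have hincr : ∀ i ∈ Finset.range q.n,
      |(∫ s in Set.Ioc 0 (q.pts (i + 1)), f (s, ω)) - ∫ s in Set.Ioc 0 (q.pts i), f (s, ω)|
        ≤ ∫ s in Set.Ioc (q.pts i) (q.pts (i + 1)), |f (s, ω)| := by
    intro i hi
    rw [setIntegral_Ioc_sub (f := fun s => f (s, ω)) (q.pts_le_succ i) (hf.mono_set
      (Set.Ioc_subset_Ioc_right (q.pts_le (Finset.mem_range.1 hi))))]
    exact abs_integral_le_integral_abs
  have hsmall : ∀ i ∈ Finset.range q.n,
      ∫ s in Set.Ioc (q.pts i) (q.pts (i + 1)), |f (s, ω)| ≤ ε / (I + 1) := by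
    intro i hi
    have hsub : Set.Ioc (q.pts i) (q.pts (i + 1)) ⊆ Set.Ioc 0 t :=
      Set.Ioc_subset_Ioc zero_le (q.pts_le (Finset.mem_range.1 hi))
    have h1 := hδ' (Set.Ioc (q.pts i) (q.pts (i + 1))) (by
      refine (Measure.restrict_apply_le _ _).trans_lt ?_
      rw [NNReal.volume_Ioc]
      exact (ENNReal.ofReal_le_ofReal (q.sub_le_mesh hi)).trans_lt hmesh)
    rw [Measure.restrict_restrict measurableSet_Ioc, Set.inter_eq_left.2 hsub] at h1
    have h2 : ENNReal.ofReal (∫ s in Set.Ioc (q.pts i) (q.pts (i + 1)), |f (s, ω)|)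
        = ∫⁻ s in Set.Ioc (q.pts i) (q.pts (i + 1)), ‖f (s, ω)‖ₑ :=
      ofReal_integral_norm_eq_lintegral_enorm (hf.mono_set hsub)
    rw [← h2, ENNReal.ofReal_lt_ofReal_iff hε'] at h1
    exact h1.le
  have hnonneg : 0 ≤ q.covSum (fun r ω => ∫ s in Set.Ioc 0 r, f (s, ω))
      (fun r ω => ∫ s in Set.Ioc 0 r, f (s, ω)) ω :=
    Finset.sum_nonneg fun i _ => mul_self_nonneg _
  rw [Real.dist_eq, sub_zero, abs_of_nonneg hnonneg]
  calc q.covSum (fun r ω => ∫ s in Set.Ioc 0 r, f (s, ω)) (fun r ω => ∫ s in Set.Ioc 0 r, f (s, ω)) ω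
      ≤ ∑ i ∈ Finset.range q.n,
          ε / (I + 1) * ∫ s in Set.Ioc (q.pts i) (q.pts (i + 1)), |f (s, ω)| := by
        refine Finset.sum_le_sum fun i hi => ?_
        rw [← abs_mul_abs_self]
        exact mul_le_mul ((hincr i hi).trans (hsmall i hi)) (hincr i hi) (abs_nonneg _) hε'.le
    _ = ε / (I + 1) * I := by rw [← Finset.mul_sum, q.sum_setIntegral habs]
    _ < ε := by
        rw [div_mul_eq_mul_div, div_lt_iff₀ (by positivity)]
        nlinarith

variable {Ω : Type*} [mΩ : MeasurableSpace Ω] {𝓕 : Filtration ℝ≥0 mΩ} {P : Measure Ω}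

theorem ae_ae_of_ae_prod_swap [SFinite P] {μ : Measure ℝ≥0} [SFinite μ] {q : ℝ≥0 × Ω → Prop}
    (h : ∀ᵐ z ∂(μ.prod P), q z) : ∀ᵐ ω ∂P, ∀ᵐ s ∂μ, q (s, ω) :=
  Measure.ae_ae_of_ae_prod ((Measure.measurePreserving_swap
    (μ := P) (ν := μ)).quasiMeasurePreserving.ae h)

theorem aestronglyMeasurable_setIntegral [SFinite P] {f : ℝ≥0 × Ω → ℝ} {T t : ℝ≥0} (ht : t ≤ T)
    (hf : Integrable f ((volume.restrict (Set.Ioc 0 T)).prod P)) :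
    AEStronglyMeasurable (fun ω => ∫ s in Set.Ioc 0 t, f (s, ω)) P := by
  have h1 : Integrable f ((volume.restrict (Set.Ioc 0 t)).prod P) :=
    hf.mono_measure (Measure.prod_mono (Measure.restrict_mono (Set.Ioc_subset_Ioc_right ht) le_rfl) le_rfl)
  exact h1.swap.aestronglyMeasurable.integral_prod_right'

variable [IsProbabilityMeasure P]

theorem tendstoInMeasure_covSum_drift {f : ℝ≥0 × Ω → ℝ} {T t : ℝ≥0} (ht : t ≤ T)
    (hf : Integrable f ((volume.restrict (Set.Ioc 0 T)).prod P)) (p : ℕ → TimePartition t)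
    (hp : Tendsto (fun k => (p k).mesh) atTop (𝓝 0)) :
    TendstoInMeasure P (fun k => (p k).covSum (fun r ω => ∫ s in Set.Ioc 0 r, f (s, ω))
      (fun r ω => ∫ s in Set.Ioc 0 r, f (s, ω))) atTop (fun _ => 0) := by
  refine tendstoInMeasure_of_tendsto_ae (fun k => ?_) ?_
  · have e : (p k).covSum (fun r ω => ∫ s in Set.Ioc 0 r, f (s, ω))
        (fun r ω => ∫ s in Set.Ioc 0 r, f (s, ω)) = fun ω => ∑ i ∈ Finset.range (p k).n,
        ((∫ s in Set.Ioc 0 ((p k).pts (i + 1)), f (s, ω)) - ∫ s in Set.Ioc 0 ((p k).pts i), f (s, ω)) *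
        ((∫ s in Set.Ioc 0 ((p k).pts (i + 1)), f (s, ω)) - ∫ s in Set.Ioc 0 ((p k).pts i), f (s, ω)) :=
      rfl
    rw [e]
    refine Finset.aestronglyMeasurable_fun_sum _ fun i hi => ?_
    have hi := Finset.mem_range.1 hi
    have h1 := aestronglyMeasurable_setIntegral (((p k).pts_le hi.le).trans ht) hf
    have h2 := aestronglyMeasurable_setIntegral (((p k).pts_le hi).trans ht) hf
    exact (h2.sub h1).mul (h2.sub h1)
  · filter_upwards [hf.prod_left_ae] with ω hω
    exact tendsto_covSum_setIntegral (IntegrableOn.mono_set hω (Set.Ioc_subset_Ioc_right ht)) p hp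

/-- On `[0, T]` the process `A` is the sum of its initial value, the Itô integral of `H` with
respect to `B`, and an absolutely continuous process. -/
def IsItoProcess (𝓕 : Filtration ℝ≥0 mΩ) (P : Measure Ω) (B : ℝ≥0 → Ω → ℝ) (T : ℝ≥0)
    (H : ℝ≥0 × Ω → ℝ) (A : ℝ≥0 → Ω → ℝ) : Prop :=
  ∃ (A₀ : Ω → ℝ) (N : ℝ≥0 → Ω → ℝ) (f : ℝ≥0 × Ω → ℝ),
    Integrable f ((volume.restrict (Set.Ioc 0 T)).prod P) ∧
    (∀ t ≤ T, IsItoPair 𝓕 P B ((Set.Ioc 0 t ×ˢ Set.univ).indicator H) (N t)) ∧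
    ∀ t ≤ T, A t =ᵐ[P] fun ω => A₀ ω + (N t ω + ∫ s in Set.Ioc 0 t, f (s, ω))

/-- By the martingale property the terminal integral determines all earlier ones, so a single vector
of the Itô space describes the whole process on [0, T]. -/
theorem exists_martProc_eq {B : ℝ≥0 → Ω → ℝ} (hB : IsBrownianWrt 𝓕 P B) {T : ℝ≥0}
    {H : ℝ≥0 × Ω → ℝ} {N : ℝ≥0 → Ω → ℝ}
    (h : ∀ t ≤ T, IsItoPair 𝓕 P B ((Set.Ioc 0 t ×ˢ Set.univ).indicator H) (N t)) :
    ∃ x ∈ itoSubmodule 𝓕 P B,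
      x.fst =ᵐ[(volume : Measure ℝ≥0).prod P] (Set.Ioc 0 T ×ˢ Set.univ).indicator H ∧
      ∀ t ≤ T, ⇑(martProc 𝓕 x.snd t) =ᵐ[P] N t := by
  obtain ⟨x, hx, h1, h2⟩ := h T le_rfl
  refine ⟨x, hx, h1, fun t ht => ?_⟩
  have h3 := (h T le_rfl).condExp hB t
  rw [Set.indicator_indicator, Set.inter_eq_left.2
    (Set.prod_mono (Set.Ioc_subset_Ioc_right ht) subset_rfl)] at h3
  exact (L2.coeFn_condExpL _ _).trans ((condExp_congr_ae h2).trans (h3.snd_ae_unique hB (h t ht)))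

theorem tendstoInMeasure_covSum_martProc_drift (x : Lp ℝ 2 P) {f : ℝ≥0 × Ω → ℝ} {T t : ℝ≥0}
    (ht : t ≤ T) (hf : Integrable f ((volume.restrict (Set.Ioc 0 T)).prod P))
    (p : ℕ → TimePartition t) (hp : Tendsto (fun k => (p k).mesh) atTop (𝓝 0)) :
    TendstoInMeasure P (fun k => (p k).covSum (fun s => ⇑(martProc 𝓕 x s))
      (fun r ω => ∫ s in Set.Ioc 0 r, f (s, ω))) atTop (fun _ => 0) := by
  refine tendstoInMeasure_zero_of_sq_le_mul
    (v := fun k => (p k).covSum (fun s => ⇑(martProc 𝓕 x s)) (fun s => ⇑(martProc 𝓕 x s)))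
    (K := ‖x‖ * ‖x‖) (fun k ω => ?_) (fun k ω => Finset.sum_nonneg fun i _ => mul_self_nonneg _)
    (fun k ω => Finset.sum_nonneg fun i _ => mul_self_nonneg _) (fun k => ?_)
    (fun k => lintegral_enorm_covSum_martProc_le x x (p k)) (tendstoInMeasure_covSum_drift ht hf p hp)
  · simp only [TimePartition.covSum, ← pow_two]
    exact Finset.sum_mul_sq_le_sq_mul_sq _ _ _
  -- The sums involve only the second component, so x is paired with an arbitrary integrand, here
  -- zero.
  · have := (isAELinearBounded_covSum_martProc 𝓕 (WithLp.toLp 2 (0, x) : ItoSpace P) (p k) le_rfl).aesm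
      (WithLp.toLp 2 (0, x))
    exact this

/-- Initial values cancel in increments; of the four products of martingale and drift parts only
martingale times martingale survives. -/
theorem IsItoProcess.hasCovariation {B₁ B₂ : ℝ≥0 → Ω → ℝ} (hB₁ : IsBrownianWrt 𝓕 P B₁)
    (hB₂ : IsBrownianWrt 𝓕 P B₂) {c : ℝ} (hc : ∀ T, HasCovariation P T B₁ B₂ (fun t _ => c * t))
    {T : ℝ≥0} {H G : ℝ≥0 × Ω → ℝ} {A A' : ℝ≥0 → Ω → ℝ} (hA : IsItoProcess 𝓕 P B₁ T H A)
    (hA' : IsItoProcess 𝓕 P B₂ T G A') :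
    HasCovariation P T A A' (fun t ω => c * ∫ s in Set.Ioc 0 t, H (s, ω) * G (s, ω)) := by
  obtain ⟨A₀, N, f, hf, hN, hA⟩ := hA
  obtain ⟨A₀', N', f', hf', hN', hA'⟩ := hA'
  obtain ⟨x, hx, hx1, hx2⟩ := exists_martProc_eq hB₁ hN
  obtain ⟨y, hy, hy1, hy2⟩ := exists_martProc_eq hB₂ hN'
  intro t ht p hp
  have l1 := tendstoInMeasure_covSum_martProc hB₁ hB₂ hc hx hy p hp
  have l2 := tendstoInMeasure_covSum_martProc_drift (𝓕 := 𝓕) x.snd ht hf' p hp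
  have l3 := tendstoInMeasure_covSum_martProc_drift (𝓕 := 𝓕) y.snd ht hf p hp
  -- Two drifts: |ab| ≤ a² + b² reduces their mixed sums to the two sums of squares.
  have l4 : TendstoInMeasure P (fun k => (p k).covSum (fun r ω => ∫ s in Set.Ioc 0 r, f (s, ω))
      (fun r ω => ∫ s in Set.Ioc 0 r, f' (s, ω))) atTop (fun _ => 0) := by
    have e1 := tendstoInMeasure_covSum_drift ht hf p hp
    have e2 := tendstoInMeasure_covSum_drift ht hf' p hp
    have e3 := e1.add_real e2
    rw [tendstoInMeasure_iff_norm] at e3 ⊢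
    intro ε hε
    refine tendsto_of_tendsto_of_tendsto_of_le_of_le tendsto_const_nhds (e3 ε hε)
      (fun _ => zero_le) fun k => measure_mono fun ω hω => ?_
    simp only [Set.mem_ofPred_eq, sub_zero, add_zero, Real.norm_eq_abs] at hω ⊢
    refine hω.trans (le_trans ?_ (le_abs_self _))
    simp only [TimePartition.covSum, ← Finset.sum_add_distrib]
    refine (Finset.abs_sum_le_sum_abs _ _).trans (Finset.sum_le_sum fun i _ => ?_)
    rw [abs_mul]
    set a := (∫ s in Set.Ioc 0 ((p k).pts (i + 1)), f (s, ω)) - ∫ s in Set.Ioc 0 ((p k).pts i), f (s, ω)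
    set b := (∫ s in Set.Ioc 0 ((p k).pts (i + 1)), f' (s, ω)) - ∫ s in Set.Ioc 0 ((p k).pts i), f' (s, ω)
    nlinarith [sq_nonneg (|a| - |b|), sq_abs a, sq_abs b, sq_nonneg (|a| + |b|)]
  refine (((l1.add_real l2).add_real (l3.add_real l4)).congr (fun k => ?_) ?_)
  · have h1 : ∀ s ≤ t, A s =ᵐ[P] fun ω => A₀ ω + (martProc 𝓕 x.snd s ω + ∫ s in Set.Ioc 0 s, f (s, ω)) := by
      intro s hs
      filter_upwards [hA s (hs.trans ht), hx2 s (hs.trans ht)] with ω e1 e2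
      rw [e1, e2]
    have h2 : ∀ s ≤ t, A' s =ᵐ[P] fun ω => A₀' ω + (martProc 𝓕 y.snd s ω + ∫ s in Set.Ioc 0 s, f' (s, ω)) := by
      intro s hs
      filter_upwards [hA' s (hs.trans ht), hy2 s (hs.trans ht)] with ω e1 e2
      rw [e1, e2]
    refine (((p k).covSum_ae_congr h1 h2).trans (ae_of_all _ fun ω => ?_)).symm
    simp only [TimePartition.covSum, ← Finset.sum_add_distrib]
    exact Finset.sum_congr rfl fun i _ => by ring
  · filter_upwards [ae_ae_of_ae_prod_swap hx1, ae_ae_of_ae_prod_swap hy1] with ω e1 e2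
    simp only [add_zero]
    congr 1
    refine setIntegral_congr_ae measurableSet_Ioc ?_
    filter_upwards [e1, e2] with s e3 e4 hs
    have hs' : ((s, ω) : ℝ≥0 × Ω) ∈ Set.Ioc 0 T ×ˢ (Set.univ : Set Ω) :=
      ⟨⟨hs.1, hs.2.trans ht⟩, Set.mem_univ _⟩
    rw [e3, e4, Set.indicator_of_mem hs', Set.indicator_of_mem hs']

end Drift

/-! ### The stochastic Fubini theorem -/

section StochasticFubini

theorem eLpNorm_two_sq_eq_lintegral {α : Type*} {mα : MeasurableSpace α} (f : α → ℝ)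
    (μ : Measure α) : eLpNorm f 2 μ ^ 2 = ∫⁻ x, ‖f x‖ₑ ^ 2 ∂μ := by
  have h := eLpNorm_nnreal_pow_eq_lintegral (μ := μ) (f := f) (p := 2) two_ne_zero
  simpa using h

theorem memLp_two_iff_lintegral {α : Type*} {mα : MeasurableSpace α} {f : α → ℝ} {μ : Measure α}
    (hf : AEStronglyMeasurable f μ) : MemLp f 2 μ ↔ ∫⁻ x, ‖f x‖ₑ ^ 2 ∂μ < ⊤ := by
  rw [← eLpNorm_two_sq_eq_lintegral, MemLp, ENNReal.pow_lt_top_iff]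
  simp [hf]

/-- Cauchy–Schwarz against the finite measure μ: the square of ∫ f dμ is at most μ(U) ∫ f² dμ. -/
theorem MeasureTheory.MemLp.integral_left {U α : Type*} {mU : MeasurableSpace U}
    {mα : MeasurableSpace α} {μ : Measure U} [IsFiniteMeasure μ] {ν : Measure α} [SFinite ν]
    {f : U × α → ℝ} (hf : MemLp f 2 (μ.prod ν)) : MemLp (fun z => ∫ u, f (u, z) ∂μ) 2 ν := by
  have hs : AEStronglyMeasurable (fun q : α × U => f (q.2, q.1)) (ν.prod μ) :=
    hf.1.comp_measurePreserving Measure.measurePreserving_swap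
  rw [memLp_two_iff_lintegral hs.integral_prod_right']
  have h1 : ∀ᵐ z ∂ν, AEStronglyMeasurable (fun u => f (u, z)) μ := hs.prodMk_left
  have h2 := (memLp_two_iff_lintegral hf.1).1 hf
  rw [lintegral_prod_symm _ (hf.1.enorm.pow_const 2)] at h2
  calc ∫⁻ z, ‖∫ u, f (u, z) ∂μ‖ₑ ^ 2 ∂ν
      ≤ ∫⁻ z, (∫⁻ u, ‖f (u, z)‖ₑ ^ 2 ∂μ) * μ Set.univ ∂ν := by
        refine lintegral_mono_ae ?_
        filter_upwards [h1] with z hz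
        have e1 := eLpNorm_le_eLpNorm_mul_rpow_measure_univ (p := 1) (q := 2) (by norm_num) hz
        rw [eLpNorm_one_eq_lintegral_enorm] at e1
        calc ‖∫ u, f (u, z) ∂μ‖ₑ ^ 2
            ≤ (eLpNorm (fun u => f (u, z)) 2 μ * μ Set.univ ^ ((1 : ℝ) / 2)) ^ 2 := by
              gcongr
              refine (enorm_integral_le_lintegral_enorm _).trans (e1.trans (le_of_eq ?_))
              norm_num
          _ = _ := by
              rw [mul_pow, eLpNorm_two_sq_eq_lintegral, ← ENNReal.rpow_natCast (_ ^ _), ← ENNReal.rpow_mul]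
              norm_num
    _ = (∫⁻ z, ∫⁻ u, ‖f (u, z)‖ₑ ^ 2 ∂μ ∂ν) * μ Set.univ := by
        rw [lintegral_mul_const' _ _ (measure_ne_top _ _)]
    _ < ⊤ := ENNReal.mul_lt_top h2 (measure_lt_top _ _)

variable {Ω : Type*} [mΩ : MeasurableSpace Ω] {𝓕 : Filtration ℝ≥0 mΩ} {P : Measure Ω}
  {B : ℝ≥0 → Ω → ℝ}

theorem IsItoPair.const_mul {H : ℝ≥0 × Ω → ℝ} {N : Ω → ℝ} (h : IsItoPair 𝓕 P B H N) (c : ℝ) :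
    IsItoPair 𝓕 P B (fun z => c * H z) (fun ω => c * N ω) := by
  obtain ⟨x, hx, h1, h2⟩ := h
  refine ⟨c • x, Submodule.smul_mem _ c hx, ?_, ?_⟩
  · rw [WithLp.smul_fst]
    filter_upwards [Lp.coeFn_smul c x.fst, h1] with z e1 e2
    rw [e1, Pi.smul_apply, e2, smul_eq_mul]
  · rw [WithLp.smul_snd]
    filter_upwards [Lp.coeFn_smul c x.snd, h2] with z e1 e2
    rw [e1, Pi.smul_apply, e2, smul_eq_mul]

variable [IsProbabilityMeasure P]

theorem IsItoPair.lintegral_enorm_sq {H : ℝ≥0 × Ω → ℝ} {N : Ω → ℝ} (hB : IsBrownianWrt 𝓕 P B)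
    (h : IsItoPair 𝓕 P B H N) :
    ∫⁻ ω, ‖N ω‖ₑ ^ 2 ∂P = ∫⁻ z, ‖H z‖ₑ ^ 2 ∂((volume : Measure ℝ≥0).prod P) := by
  have h1 := h.integral_sq hB
  have e : ∀ {α : Type _} {mα : MeasurableSpace α} {μ : Measure α} {f : α → ℝ}, MemLp f 2 μ →
      ∫⁻ x, ‖f x‖ₑ ^ 2 ∂μ = ENNReal.ofReal (∫ x, f x ^ 2 ∂μ) := by
    intro α mα μ f hf
    rw [ofReal_integral_eq_lintegral_ofReal hf.integrable_sq (ae_of_all _ fun _ => sq_nonneg _)]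
    refine lintegral_congr fun x => ?_
    rw [Real.enorm_eq_ofReal_abs, ← ENNReal.ofReal_pow (abs_nonneg _), sq_abs]
  rw [e h.memLp_snd, e h.memLp_fst, h1]

/-- **Stochastic Fubini theorem** for Itô integrals depending on a parameter. -/
theorem IsItoPair.integral {U : Type*} {mU : MeasurableSpace U} {μ : Measure U} [IsFiniteMeasure μ]
    (hB : IsBrownianWrt 𝓕 P B) {H : U × (ℝ≥0 × Ω) → ℝ} {N : U × Ω → ℝ}
    (hH : MemLp H 2 (μ.prod ((volume : Measure ℝ≥0).prod P)))
    (hN : AEStronglyMeasurable N (μ.prod P))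
    (h : ∀ᵐ u ∂μ, IsItoPair 𝓕 P B (fun z => H (u, z)) (fun ω => N (u, ω))) :
    IsItoPair 𝓕 P B (fun z => ∫ u, H (u, z) ∂μ) (fun ω => ∫ u, N (u, ω) ∂μ) := by
  -- Square-integrability of N is inherited from H by the isometry at almost every u.
  have hN2 : MemLp N 2 (μ.prod P) := by
    have h1 := (memLp_two_iff_lintegral hH.1).1 hH
    rw [memLp_two_iff_lintegral hN, lintegral_prod _ (hN.enorm.pow_const 2)]
    rw [lintegral_prod _ (hH.1.enorm.pow_const 2)] at h1
    refine lt_of_eq_of_lt (lintegral_congr_ae ?_) h1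
    filter_upwards [h] with u hu using hu.lintegral_enorm_sq hB
  have mH := hH.integral_left
  have mN := hN2.integral_left
  refine ⟨WithLp.toLp 2 (mH.toLp _, mN.toLp _), ?_, mH.coeFn_toLp, mN.coeFn_toLp⟩
  have hcl : IsClosed (itoSubmodule 𝓕 P B : Set (ItoSpace P)) :=
    Submodule.isClosed_topologicalClosure _
  have : CompleteSpace (itoSubmodule 𝓕 P B) := hcl.completeSpace_coe
  -- Membership in a closed subspace is tested against its orthogonal complement. Inner products
  -- with a fixed z commute with ∫ dμ(u) by ordinary Fubini, and they vanish for almost every u.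
  rw [← Submodule.orthogonal_orthogonal (itoSubmodule 𝓕 P B), Submodule.mem_orthogonal]
  intro z hz
  rw [Submodule.mem_orthogonal] at hz
  have hF := (Lp.memLp z.fst).comp_snd μ
  have hG := (Lp.memLp z.snd).comp_snd μ
  have i1 : Integrable (fun q : U × (ℝ≥0 × Ω) => z.fst q.2 * H q) (μ.prod (volume.prod P)) :=
    hF.integrable_mul hH
  have i2 : Integrable (fun q : U × Ω => z.snd q.2 * N q) (μ.prod P) := hG.integrable_mul hN2
  have hzero : ∀ᵐ u ∂μ, (∫ q, z.fst q * H (u, q) ∂((volume : Measure ℝ≥0).prod P))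
      + ∫ ω, z.snd ω * N (u, ω) ∂P = 0 := by
    filter_upwards [h] with u hu
    obtain ⟨x, hx, h1, h2⟩ := hu
    have h3 := hz x hx
    rw [WithLp.prod_inner_apply] at h3
    change inner ℝ x.fst z.fst + inner ℝ x.snd z.snd = 0 at h3
    rw [L2.inner_eq_integral_mul, L2.inner_eq_integral_mul] at h3
    rw [← h3]
    congr 1
    · refine integral_congr_ae ?_
      filter_upwards [h1] with q hq
      rw [hq, mul_comm]
    · refine integral_congr_ae ?_
      filter_upwards [h2] with q hq
      rw [hq, mul_comm]
  rw [WithLp.prod_inner_apply]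
  change inner ℝ z.fst (mH.toLp _) + inner ℝ z.snd (mN.toLp _) = 0
  rw [L2.inner_eq_integral_mul, L2.inner_eq_integral_mul]
  have e1 : ∫ q, z.fst q * (mH.toLp _) q ∂((volume : Measure ℝ≥0).prod P)
      = ∫ u, ∫ q, z.fst q * H (u, q) ∂((volume : Measure ℝ≥0).prod P) ∂μ := by
    rw [integral_integral_swap i1]
    refine integral_congr_ae ?_
    filter_upwards [mH.coeFn_toLp] with q hq
    rw [hq, integral_const_mul]
  have e2 : ∫ ω, z.snd ω * (mN.toLp _) ω ∂P = ∫ u, ∫ ω, z.snd ω * N (u, ω) ∂P ∂μ := by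
    rw [integral_integral_swap i2]
    refine integral_congr_ae ?_
    filter_upwards [mN.coeFn_toLp] with q hq
    rw [hq, integral_const_mul]
  rw [e1, e2, ← integral_add i1.integral_prod_left i2.integral_prod_left, integral_congr_ae hzero]
  simp

end StochasticFubini

/-! ### The operator `Dxi` on bounded weights -/

section Kernel

/-- Translation of the integration variable on the half-line. -/
theorem NNReal.lintegral_Ioc_sub_le (f : ℝ → ℝ≥0∞) (s T : ℝ≥0) :
    ∫⁻ u in Set.Ioc s T, f ((u : ℝ) - s) ≤ ∫⁻ x in Set.Ioc 0 (T : ℝ), f x := by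
  have h1 : ∫⁻ u in Set.Ioc s T, f ((u : ℝ) - s)
      = ∫⁻ x in Set.Ioc (s : ℝ) T, f (x - s) ∂(volume.restrict (Set.Ici 0)) := by
    rw [← NNReal.map_coe_volume, NNReal.measurableEmbedding_coe.restrict_map,
      NNReal.measurableEmbedding_coe.lintegral_map]
    congr 2
  rw [h1]
  calc ∫⁻ x in Set.Ioc (s : ℝ) T, f (x - s) ∂(volume.restrict (Set.Ici 0))
      ≤ ∫⁻ x in Set.Ioc (s : ℝ) T, f (x - s) :=
        lintegral_mono' (Measure.restrict_mono le_rfl Measure.restrict_le_self) le_rfl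
    _ ≤ ∫⁻ x, (Set.Ioc (0 : ℝ) T).indicator f (x - s) := by
        rw [← lintegral_indicator measurableSet_Ioc]
        refine lintegral_mono fun x => ?_
        by_cases hx : x ∈ Set.Ioc (s : ℝ) T
        · have : x - s ∈ Set.Ioc (0 : ℝ) T := ⟨sub_pos.2 hx.1, by linarith [hx.2, s.coe_nonneg]⟩
          rw [Set.indicator_of_mem hx, Set.indicator_of_mem this]
        · rw [Set.indicator_of_notMem hx]; exact zero_le
    _ = ∫⁻ x in Set.Ioc 0 (T : ℝ), f x := by
        rw [lintegral_sub_right_eq_self (fun x => (Set.Ioc (0 : ℝ) T).indicator f x) (s : ℝ),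
          lintegral_indicator measurableSet_Ioc]

/-- Measurable functions bounded by a constant. -/
def IsBddMeasurable (g : ℝ≥0 → ℝ) : Prop := Measurable g ∧ ∃ C : ℝ, ∀ s, |g s| ≤ C

theorem IsBddMeasurable.const_mul {g : ℝ≥0 → ℝ} (hg : IsBddMeasurable g) (c : ℝ) :
    IsBddMeasurable fun s => c * g s := by
  obtain ⟨h1, C, hC⟩ := hg
  refine ⟨h1.const_mul c, |c| * C, fun s => ?_⟩
  rw [abs_mul]
  exact mul_le_mul_of_nonneg_left (hC s) (abs_nonneg c)

theorem IsBddMeasurable.mul {g h : ℝ≥0 → ℝ} (hg : IsBddMeasurable g) (hh : IsBddMeasurable h) :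
    IsBddMeasurable fun s => g s * h s := by
  obtain ⟨h1, C, hC⟩ := hg
  obtain ⟨h2, D, hD⟩ := hh
  refine ⟨h1.mul h2, C * D, fun s => ?_⟩
  rw [abs_mul]
  exact mul_le_mul (hC s) (hD s) (abs_nonneg _) ((abs_nonneg _).trans (hC s))

variable {κ : ℝ → ℝ}

theorem integrableOn_of_integrableOn_sq (hκ : Measurable κ) {T : ℝ}
    (h : IntegrableOn (fun x => κ x ^ 2) (Set.Ioc 0 T)) : IntegrableOn κ (Set.Ioc 0 T) :=
  ((memLp_two_iff_integrable_sq hκ.aestronglyMeasurable).2 h).integrable (by norm_num)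

theorem integrableOn_kernel (hκ : Measurable κ) {s T : ℝ≥0} (h : IntegrableOn κ (Set.Ioc 0 (T : ℝ))) :
    IntegrableOn (fun u : ℝ≥0 => κ ((u : ℝ) - s)) (Set.Ioc s T) :=
  ⟨(hκ.comp (by fun_prop)).aestronglyMeasurable,
    (NNReal.lintegral_Ioc_sub_le (fun x => ‖κ x‖ₑ) s T).trans_lt h.2⟩

/-- The bound is sup|g| times the integral of |κ| over (0, T]. Stability of this class of weights is
what lets the tree induction continue. -/
theorem isBddMeasurable_Dxi (hκ : Measurable κ) {T : ℝ≥0} (h : IntegrableOn κ (Set.Ioc 0 (T : ℝ)))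
    {g : ℝ≥0 → ℝ} (hg : IsBddMeasurable g) : IsBddMeasurable fun s => Dxi κ T s g := by
  obtain ⟨h1, C, hC⟩ := hg
  constructor
  -- The s-dependence of the domain is moved into an indicator, so that joint measurability applies.
  · have e : (fun s => Dxi κ T s g) = fun s => ∫ u : ℝ≥0, (Set.Ioc 0 T).indicator (fun u =>
        (Set.Ioi s).indicator (fun u : ℝ≥0 => κ ((u : ℝ) - s) * g u) u) u := by
      ext s
      rw [Dxi, integral_indicator measurableSet_Ioc, setIntegral_indicator measurableSet_Ioi]
      congr 2
      ext u
      simp only [Set.mem_Ioc, Set.mem_inter_iff, Set.mem_Ioi]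
      exact ⟨fun h => ⟨⟨(zero_le).trans_lt h.1, h.2⟩, h.1⟩, fun h => ⟨h.2, h.1.2⟩⟩
    rw [e]
    refine (StronglyMeasurable.integral_prod_right (f := fun (s u : ℝ≥0) => (Set.Ioc 0 T).indicator (fun u =>
        (Set.Ioi s).indicator (fun u : ℝ≥0 => κ ((u : ℝ) - s) * g u) u) u)
      (Measurable.stronglyMeasurable ?_)).measurable
    have e2 : Function.uncurry (fun (s u : ℝ≥0) => (Set.Ioc 0 T).indicator (fun u =>
        (Set.Ioi s).indicator (fun u : ℝ≥0 => κ ((u : ℝ) - s) * g u) u) u)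
        = (Prod.snd ⁻¹' Set.Ioc 0 T).indicator ({p : ℝ≥0 × ℝ≥0 | p.1 < p.2}.indicator
            fun p => κ ((p.2 : ℝ) - p.1) * g p.2) := by
      rfl
    rw [e2]
    refine Measurable.indicator (Measurable.indicator ?_ (measurableSet_lt measurable_fst
      measurable_snd)) (measurable_snd measurableSet_Ioc)
    exact (hκ.comp (by fun_prop)).mul (h1.comp measurable_snd)
  · refine ⟨C * ∫ x in Set.Ioc 0 (T : ℝ), |κ x|, fun s => ?_⟩
    have hC0 : 0 ≤ C := (abs_nonneg _).trans (hC 0)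
    have h2 := integrableOn_kernel hκ (s := s) h
    calc |Dxi κ T s g| ≤ ∫ u in Set.Ioc s T, |κ ((u : ℝ) - s) * g u| := abs_integral_le_integral_abs
      _ ≤ ∫ u in Set.Ioc s T, C * |κ ((u : ℝ) - s)| := by
          refine integral_mono_of_nonneg (ae_of_all _ fun _ => abs_nonneg _) (h2.abs.const_mul C)
            (ae_of_all _ fun u => ?_)
          simp only [abs_mul]
          rw [mul_comm]
          exact mul_le_mul_of_nonneg_right (hC u) (abs_nonneg _)
      _ = C * ∫ u in Set.Ioc s T, |κ ((u : ℝ) - s)| := integral_const_mul _ _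
      _ ≤ C * ∫ x in Set.Ioc 0 (T : ℝ), |κ x| := by
          refine mul_le_mul_of_nonneg_left ?_ hC0
          have e1 := ofReal_integral_norm_eq_lintegral_enorm h2
          have e2 := ofReal_integral_norm_eq_lintegral_enorm h
          have e3 := NNReal.lintegral_Ioc_sub_le (fun x => ‖κ x‖ₑ) s T
          rw [← e1, ← e2] at e3
          exact (ENNReal.ofReal_le_ofReal_iff (integral_nonneg fun _ => norm_nonneg _)).1 e3

end Kernel

/-! ### Forward variances as martingales; joint integrability -/

namespace AFVModel

variable {Ω : Type*} [mΩ : MeasurableSpace Ω] {P : Measure Ω} {κ : ℝ → ℝ} {ρ : ℝ} (M : AFVModel P κ ρ)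

theorem integrableOn_kernel_zero (M : AFVModel P κ ρ) (T : ℝ≥0) : IntegrableOn κ (Set.Ioc 0 (T : ℝ)) :=
  integrableOn_of_integrableOn_sq M.kernel_measurable (M.kernel_sq_integrable T)

theorem isBddMeasurable_Dxi (M : AFVModel P κ ρ) (T : ℝ≥0) {g : ℝ≥0 → ℝ} (hg : IsBddMeasurable g) :
    IsBddMeasurable fun s => Dxi κ T s g :=
  _root_.isBddMeasurable_Dxi M.kernel_measurable (M.integrableOn_kernel_zero T) hg

/-- The spot variance up to time `T` is jointly measurable. -/
theorem stronglyMeasurable_variance (T : ℝ≥0) :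
    StronglyMeasurable[(inferInstance : MeasurableSpace ℝ≥0).prod (M.𝓕 T)]
      (fun p : ℝ≥0 × Ω => M.ξ (min p.1 T) (min p.1 T) p.2) := by
  have h := M.variance_progressive T
  -- Progressive measurability concerns times in [0, T]; capping the time at T maps the whole
  -- half-line into that domain.
  have hm : @Measurable (ℝ≥0 × Ω) (Set.Iic T × Ω) ((inferInstance : MeasurableSpace ℝ≥0).prod (M.𝓕 T))
      (Subtype.instMeasurableSpace.prod (M.𝓕 T))
      (fun p => ((⟨min p.1 T, Set.mem_Iic.2 (min_le_right _ _)⟩ : Set.Iic T), p.2)) := by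
    refine @Measurable.prodMk _ ((inferInstance : MeasurableSpace ℝ≥0).prod (M.𝓕 T)) _ _ _
      (M.𝓕 T) _ _ ?_ ?_
    · refine Measurable.subtype_mk ?_
      have h1 : @Measurable (ℝ≥0 × Ω) ℝ≥0 ((inferInstance : MeasurableSpace ℝ≥0).prod (M.𝓕 T)) _ Prod.fst :=
        @measurable_fst _ _ _ (M.𝓕 T)
      exact h1.min measurable_const
    · exact @measurable_snd _ _ _ (M.𝓕 T)
  exact h.comp_measurable hm

theorem measurable_variance (T : ℝ≥0) :
    Measurable (fun p : ℝ≥0 × Ω => M.ξ (min p.1 T) (min p.1 T) p.2) :=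
  ((M.stronglyMeasurable_variance T).mono
    (sup_le_sup_left (MeasurableSpace.comap_mono (M.𝓕.le T)) _)).measurable

theorem measurable_curve (t : ℝ≥0) : Measurable (fun p : ℝ≥0 × Ω => M.ξ t p.1 p.2) :=
  (M.ξ_measurable t).mono (sup_le_sup_left (MeasurableSpace.comap_mono (M.𝓕.le t)) _) le_rfl

theorem measurable_ξ (t u : ℝ≥0) : Measurable (M.ξ t u) :=
  (M.measurable_curve t).comp measurable_prodMk_left

variable [IsProbabilityMeasure P]

/-- The forward variances are Itô integrals with respect to `W`. -/
theorem isItoPair_ξ {t u : ℝ≥0} (htu : t ≤ u) :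
    IsItoPair M.𝓕 P M.W
      ((Set.Ioc 0 t ×ˢ Set.univ).indicator fun p => κ ((u : ℝ) - p.1) * √(M.ξ p.1 p.1 p.2))
      (fun ω => M.ξ t u ω - M.ξ 0 u ω) :=
  (M.ξ_dynamics t u htu).isItoPair M.W_brownian

theorem condExp_ξ_sub {t u : ℝ≥0} (htu : t ≤ u) :
    P[fun ω => M.ξ u u ω - M.ξ 0 u ω | M.𝓕 t] =ᵐ[P] fun ω => M.ξ t u ω - M.ξ 0 u ω := by
  have h := (M.isItoPair_ξ le_rfl (u := u)).condExp M.W_brownian t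
  rw [Set.indicator_indicator, Set.inter_eq_left.2
    (Set.prod_mono (Set.Ioc_subset_Ioc_right htu) subset_rfl)] at h
  exact h.snd_ae_unique M.W_brownian (M.isItoPair_ξ htu)

theorem integrable_ξ_sub {t u : ℝ≥0} (htu : t ≤ u) :
    Integrable (fun ω => M.ξ t u ω - M.ξ 0 u ω) P :=
  (M.isItoPair_ξ htu).memLp_snd.integrable (by norm_num)

theorem integrable_ξ {t u : ℝ≥0} (htu : t ≤ u) (h0 : Integrable (M.ξ 0 u) P) :
    Integrable (M.ξ t u) P := by
  have := (M.integrable_ξ_sub htu).add h0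
  exact this.congr (ae_of_all _ fun ω => by simp)

/-- The increment of the forward variance is always in L², whereas `M.ξ 0 u` is known to be
integrable only for almost every u; hence the extra hypothesis. -/
theorem condExp_ξ {t u : ℝ≥0} (htu : t ≤ u) (h0 : Integrable (M.ξ 0 u) P) :
    P[M.ξ u u | M.𝓕 t] =ᵐ[P] M.ξ t u := by
  have hm : StronglyMeasurable[M.𝓕 t] (M.ξ 0 u) := by
    have h1 : Measurable[M.𝓕 0] (M.ξ 0 u) := (M.ξ_measurable 0).comp (@measurable_prodMk_left _ _ _ (M.𝓕 0) _)
    exact (h1.stronglyMeasurable).mono (M.𝓕.mono zero_le)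
  have e : M.ξ u u = (fun ω => M.ξ u u ω - M.ξ 0 u ω) + M.ξ 0 u := by ext ω; simp
  have h1 := condExp_add (M.integrable_ξ_sub (le_refl u)) h0 (M.𝓕 t)
  rw [← e, condExp_of_stronglyMeasurable (M.𝓕.le t) hm h0] at h1
  filter_upwards [h1, M.condExp_ξ_sub htu] with ω h2 h3
  rw [h2, Pi.add_apply, h3]; ring

theorem setIntegral_ξ {t u : ℝ≥0} (htu : t ≤ u) (h0 : Integrable (M.ξ 0 u) P) {A : Set Ω}
    (hA : MeasurableSet[M.𝓕 t] A) : ∫ ω in A, M.ξ u u ω ∂P = ∫ ω in A, M.ξ t u ω ∂P := by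
  rw [← setIntegral_condExp (M.𝓕.le t) (M.integrable_ξ le_rfl h0) hA]
  exact setIntegral_congr_ae (M.𝓕.le t A hA) ((M.condExp_ξ htu h0).mono fun _ h _ => h)

theorem integral_ξ_eq {t u : ℝ≥0} (htu : t ≤ u) (h0 : Integrable (M.ξ 0 u) P) :
    ∫ ω, M.ξ t u ω ∂P = ∫ ω, M.ξ 0 u ω ∂P := by
  have h1 := M.setIntegral_ξ htu h0 MeasurableSet.univ
  have h2 := M.setIntegral_ξ (zero_le (a := u)) h0 MeasurableSet.univ
  simp only [setIntegral_univ] at h1 h2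
  rw [← h1, h2]

theorem initial_integrable_Ioc (T : ℝ≥0) :
    Integrable (fun p : ℝ≥0 × Ω => M.ξ 0 p.1 p.2) ((volume.restrict (Set.Ioc 0 T)).prod P) :=
  (M.initial_integrable T).mono_measure
    (Measure.prod_mono (Measure.restrict_mono Set.Ioc_subset_Icc_self le_rfl) le_rfl)

theorem ae_integrable_initial (T : ℝ≥0) :
    ∀ᵐ u ∂((volume : Measure ℝ≥0).restrict (Set.Ioc 0 T)), Integrable (M.ξ 0 u) P :=
  (M.initial_integrable_Ioc T).prod_right_ae

/-- Covers both the spot variance (τ u = u) and a fixed curve (τ u = t): these are nonnegative with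
the same mean as ξ_0(u), so the initial curve controls them. -/
theorem integrable_of_ae_eq_ξ {t T : ℝ≥0} {Y : ℝ≥0 × Ω → ℝ} {τ : ℝ≥0 → ℝ≥0}
    (hYm : AEStronglyMeasurable Y ((volume.restrict (Set.Ioc t T)).prod P))
    (hτ : ∀ u ∈ Set.Ioc t T, τ u ≤ u) (hY : ∀ u ∈ Set.Ioc t T, ∀ ω, Y (u, ω) = M.ξ (τ u) u ω) :
    Integrable Y ((volume.restrict (Set.Ioc t T)).prod P) := by
  have hsub : (volume : Measure ℝ≥0).restrict (Set.Ioc t T) ≤ volume.restrict (Set.Ioc 0 T) :=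
    Measure.restrict_mono (Set.Ioc_subset_Ioc_left zero_le) le_rfl
  have h0 := ae_mono hsub (M.ae_integrable_initial T)
  have hmem : ∀ᵐ u ∂((volume : Measure ℝ≥0).restrict (Set.Ioc t T)), u ∈ Set.Ioc t T :=
    ae_restrict_mem measurableSet_Ioc
  rw [integrable_prod_iff hYm]
  constructor
  · filter_upwards [h0, hmem] with u h1 h2
    simp_rw [hY u h2]
    exact M.integrable_ξ (hτ u h2) h1
  · have h3 := ((M.initial_integrable_Ioc T).integral_prod_left).mono_measure hsub
    refine h3.congr ?_
    filter_upwards [h0, hmem] with u h1 h2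
    simp_rw [hY u h2]
    rw [← M.integral_ξ_eq (hτ u h2) h1]
    refine integral_congr_ae ?_
    filter_upwards [M.ξ_nonneg _ _ (hτ u h2)] with ω hω
    rw [Real.norm_of_nonneg hω]

theorem integrable_variance (T : ℝ≥0) :
    Integrable (fun p : ℝ≥0 × Ω => M.ξ p.1 p.1 p.2) ((volume.restrict (Set.Ioc 0 T)).prod P) := by
  refine M.integrable_of_ae_eq_ξ (τ := fun u => u) ?_ (fun _ _ => le_rfl) (fun _ _ _ => rfl)
  refine (M.measurable_variance T).aestronglyMeasurable.congr ?_
  have hmem : ∀ᵐ u ∂((volume : Measure ℝ≥0).restrict (Set.Ioc 0 T)), u ∈ Set.Ioc 0 T :=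
    ae_restrict_mem measurableSet_Ioc
  filter_upwards [Measure.quasiMeasurePreserving_fst.ae hmem] with p hp
  rw [min_eq_left hp.2]

theorem integrable_curve (t T : ℝ≥0) :
    Integrable (fun p : ℝ≥0 × Ω => M.ξ t p.1 p.2) ((volume.restrict (Set.Ioc t T)).prod P) :=
  M.integrable_of_ae_eq_ξ (τ := fun _ => t) (M.measurable_curve t).aestronglyMeasurable
    (fun _ hu => hu.1.le) (fun _ _ _ => rfl)

end AFVModel

theorem IsBddMeasurable.integrable_mul {α : Type*} {mα : MeasurableSpace α} {μ : Measure α}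
    {g : ℝ≥0 → ℝ} (hg : IsBddMeasurable g) {Y : α → ℝ} (hY : Integrable Y μ) {τ : α → ℝ≥0}
    (hτ : Measurable τ) : Integrable (fun p => Y p * g (τ p)) μ := by
  obtain ⟨h1, C, hC⟩ := hg
  exact hY.mul_bdd (c := C) (h1.comp hτ).aestronglyMeasurable (ae_of_all _ fun p => hC _)

theorem restrict_Ioc_restrict_Ici {r T : ℝ≥0} (hr : 0 < r) :
    ((volume : Measure ℝ≥0).restrict (Set.Ioc 0 T)).restrict (Set.Ici r)
      = volume.restrict (Set.Ioc r T) := by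
  rw [Measure.restrict_restrict measurableSet_Ici]
  have : Set.Ici r ∩ Set.Ioc 0 T = Set.Icc r T := by
    ext u
    simp only [Set.mem_inter_iff, Set.mem_Ici, Set.mem_Ioc, Set.mem_Icc]
    exact ⟨fun h => ⟨h.1, h.2.2⟩, fun h => ⟨h.1, hr.trans_le h.1, h.2⟩⟩
  rw [this]
  exact Measure.restrict_congr_set Ioc_ae_eq_Icc.symm

/-! ### Tails of the forward variance curve: conditional expectation and martingale part -/

namespace AFVModel

variable {Ω : Type*} [mΩ : MeasurableSpace Ω] {P : Measure Ω} {κ : ℝ → ℝ} {ρ : ℝ}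
  (M : AFVModel P κ ρ)

/-- The functional `∫_t^T ξ_t(s) g(s) ds` of the forward variance curve. -/
noncomputable def tail (T : ℝ≥0) (g : ℝ≥0 → ℝ) (t : ℝ≥0) (ω : Ω) : ℝ :=
  ∫ s in Set.Ioc t T, M.ξ t s ω * g s

/-- The weighted accumulated variance `∫_0^t V_s g(s) ds`. -/
noncomputable def acc (g : ℝ≥0 → ℝ) (t : ℝ≥0) (ω : Ω) : ℝ :=
  ∫ s in Set.Ioc 0 t, M.ξ s s ω * g s

theorem stronglyMeasurable_tail (T : ℝ≥0) {g : ℝ≥0 → ℝ} (hg : IsBddMeasurable g) (t : ℝ≥0) :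
    StronglyMeasurable[M.𝓕 t] (M.tail T g t) := by
  have h1 : @Measurable (Ω × ℝ≥0) ℝ ((M.𝓕 t).prod inferInstance) _
      (fun p : Ω × ℝ≥0 => M.ξ t p.2 p.1 * g p.2) :=
    ((M.ξ_measurable t).comp (@measurable_swap _ _ (M.𝓕 t) _)).mul
      (hg.1.comp (@measurable_snd _ _ (M.𝓕 t) _))
  exact @StronglyMeasurable.integral_prod_right Ω ℝ≥0 ℝ (M.𝓕 t) _ _ _ _ _
    (fun ω s => M.ξ t s ω * g s) h1.stronglyMeasurable

theorem stronglyMeasurable_acc {g : ℝ≥0 → ℝ} (hg : IsBddMeasurable g) (t : ℝ≥0) :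
    StronglyMeasurable[M.𝓕 t] (M.acc g t) := by
  have h1 : @Measurable (Ω × ℝ≥0) ℝ ((M.𝓕 t).prod inferInstance) _
      (fun p : Ω × ℝ≥0 => M.ξ (min p.2 t) (min p.2 t) p.1 * g p.2) :=
    ((M.stronglyMeasurable_variance t).measurable.comp (@measurable_swap _ _ (M.𝓕 t) _)).mul
      (hg.1.comp (@measurable_snd _ _ (M.𝓕 t) _))
  have h2 := @StronglyMeasurable.integral_prod_right Ω ℝ≥0 ℝ (M.𝓕 t) _
    ((volume : Measure ℝ≥0).restrict (Set.Ioc 0 t)) _ _ _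
    (fun ω s => M.ξ (min s t) (min s t) ω * g s) h1.stronglyMeasurable
  have e : M.acc g t = fun ω => ∫ s in Set.Ioc 0 t, M.ξ (min s t) (min s t) ω * g s := by
    ext ω
    refine setIntegral_congr_fun measurableSet_Ioc fun s hs => ?_
    simp only [min_eq_left hs.2]
  rw [e]
  exact h2

/-- The integrand in the stochastic Fubini theorem. -/
noncomputable def fubiniIntegrand (g : ℝ≥0 → ℝ) (t : ℝ≥0) (q : ℝ≥0 × (ℝ≥0 × Ω)) : ℝ :=
  g q.1 * {q : ℝ≥0 × (ℝ≥0 × Ω) | q.2.1 ∈ Set.Ioc 0 (min t q.1)}.indicator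
    (fun q => κ ((q.1 : ℝ) - q.2.1) * √(M.ξ (min q.2.1 t) (min q.2.1 t) q.2.2)) q

theorem measurable_fubiniIntegrand {g : ℝ≥0 → ℝ} (hg : IsBddMeasurable g) (t : ℝ≥0) :
    Measurable (M.fubiniIntegrand g t) := by
  have h1 : Measurable fun q : ℝ≥0 × (ℝ≥0 × Ω) => √(M.ξ (min q.2.1 t) (min q.2.1 t) q.2.2) :=
    ((M.measurable_variance t).comp measurable_snd).sqrt
  have h2 : Measurable fun q : ℝ≥0 × (ℝ≥0 × Ω) => κ ((q.1 : ℝ) - q.2.1) :=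
    M.kernel_measurable.comp (by fun_prop)
  refine (hg.1.comp measurable_fst).mul ((h2.mul h1).indicator ?_)
  have e : {q : ℝ≥0 × (ℝ≥0 × Ω) | q.2.1 ∈ Set.Ioc 0 (min t q.1)} =
      {q | 0 < q.2.1} ∩ {q | q.2.1 ≤ min t q.1} := rfl
  rw [e]
  exact (measurableSet_lt measurable_const (by fun_prop)).inter
    (measurableSet_le (by fun_prop) (by fun_prop))

variable [IsProbabilityMeasure P]

theorem integrable_variance_mul (T : ℝ≥0) {g : ℝ≥0 → ℝ} (hg : IsBddMeasurable g) :
    Integrable (fun p : ℝ≥0 × Ω => M.ξ p.1 p.1 p.2 * g p.1) ((volume.restrict (Set.Ioc 0 T)).prod P) :=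
  hg.integrable_mul (M.integrable_variance T) measurable_fst

theorem integrable_curve_mul (t T : ℝ≥0) {g : ℝ≥0 → ℝ} (hg : IsBddMeasurable g) :
    Integrable (fun p : ℝ≥0 × Ω => M.ξ t p.1 p.2 * g p.1) ((volume.restrict (Set.Ioc t T)).prod P) :=
  hg.integrable_mul (M.integrable_curve t T) measurable_fst

theorem integrable_acc {g : ℝ≥0 → ℝ} (hg : IsBddMeasurable g) (t : ℝ≥0) :
    Integrable (M.acc g t) P :=
  (M.integrable_variance_mul t hg).integral_prod_right

theorem integrable_tail (T : ℝ≥0) {g : ℝ≥0 → ℝ} (hg : IsBddMeasurable g) (t : ℝ≥0) :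
    Integrable (M.tail T g t) P :=
  (M.integrable_curve_mul t T hg).integral_prod_right

theorem restrict_Ioc_prod_le (t T : ℝ≥0) : ((volume : Measure ℝ≥0).restrict (Set.Ioc t T)).prod P ≤
    (volume.restrict (Set.Ioc 0 T)).prod P :=
  Measure.prod_mono (Measure.restrict_mono (Set.Ioc_subset_Ioc_left zero_le) le_rfl) le_rfl

/-- Fubini on a set A of 𝓕 t reduces the claim to E[V_s; A] = E[ξ_t(s); A], which holds for almost
every s. -/
theorem condExp_future {t T : ℝ≥0} {g : ℝ≥0 → ℝ} (hg : IsBddMeasurable g) :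
    P[fun ω => ∫ s in Set.Ioc t T, M.ξ s s ω * g s | M.𝓕 t] =ᵐ[P] M.tail T g t := by
  have i1 := (M.integrable_variance_mul T hg).mono_measure (restrict_Ioc_prod_le (P := P) t T)
  have i2 := M.integrable_curve_mul t T hg
  refine (ae_eq_condExp_of_forall_setIntegral_eq (M.𝓕.le t) i1.integral_prod_right
    (fun s _ _ => (M.integrable_tail T hg t).integrableOn) (fun A hA _ => ?_)
    (M.stronglyMeasurable_tail T hg t).aestronglyMeasurable).symm
  have hle : ∀ {ν : Measure ℝ≥0} [SFinite ν], ν.prod (P.restrict A) ≤ ν.prod P :=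
    fun {ν} _ => Measure.prod_mono le_rfl Measure.restrict_le_self
  have j1 := i1.mono_measure hle
  have j2 := i2.mono_measure hle
  change ∫ ω in A, (∫ s in Set.Ioc t T, M.ξ t s ω * g s) ∂P = _
  rw [← integral_integral_swap (f := fun s ω => M.ξ t s ω * g s) j2,
    ← integral_integral_swap (f := fun s ω => M.ξ s s ω * g s) j1]
  have h0 := ae_mono (Measure.restrict_mono (Set.Ioc_subset_Ioc_left (zero_le (a := t))) le_rfl)
    (M.ae_integrable_initial T)
  refine integral_congr_ae ?_
  filter_upwards [h0, ae_restrict_mem measurableSet_Ioc] with u h1 h2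
  rw [integral_mul_const, integral_mul_const, M.setIntegral_ξ h2.1.le h1 hA]

theorem condExp_acc {t T : ℝ≥0} (ht : t ≤ T) {g : ℝ≥0 → ℝ} (hg : IsBddMeasurable g) :
    P[M.acc g T | M.𝓕 t] =ᵐ[P] fun ω => M.acc g t ω + M.tail T g t ω := by
  have i1 := (M.integrable_variance_mul T hg).mono_measure (restrict_Ioc_prod_le (P := P) t T)
  have h1 : M.acc g T =ᵐ[P] M.acc g t + fun ω => ∫ s in Set.Ioc t T, M.ξ s s ω * g s := by
    filter_upwards [(M.integrable_variance_mul T hg).prod_left_ae] with ω hω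
    have := setIntegral_Ioc_sub (f := fun s => M.ξ s s ω * g s) ht hω
    rw [Pi.add_apply, ← this, acc, acc, add_sub_cancel]
  have h2 := condExp_add (M.integrable_acc hg t) i1.integral_prod_right (M.𝓕 t)
  rw [condExp_of_stronglyMeasurable (M.𝓕.le t) (M.stronglyMeasurable_acc hg t)
    (M.integrable_acc hg t)] at h2
  filter_upwards [condExp_congr_ae (m := M.𝓕 t) h1, h2, M.condExp_future (t := t) (T := T) hg]
    with ω e1 e2 e3
  rw [e1, e2, Pi.add_apply, e3]

/-- Integrating over u first bounds the kernel by its squared L² norm on (0, T], uniformly in r;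
what remains is a multiple of E∫ V, which is finite. -/
theorem memLp_fubiniIntegrand {g : ℝ≥0 → ℝ} (hg : IsBddMeasurable g) (t T : ℝ≥0) :
    MemLp (M.fubiniIntegrand g t) 2
      ((volume.restrict (Set.Ioc 0 T)).prod ((volume : Measure ℝ≥0).prod P)) := by
  have hm := M.measurable_fubiniIntegrand hg t
  obtain ⟨-, C, hC⟩ := hg
  rw [memLp_two_iff_lintegral hm.aestronglyMeasurable, lintegral_prod_symm _ (by fun_prop)]
  set K := ∫⁻ x in Set.Ioc 0 (T : ℝ), ‖κ x‖ₑ ^ 2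
  have hK : K < ⊤ := (memLp_two_iff_lintegral M.kernel_measurable.aestronglyMeasurable).1
    ((memLp_two_iff_integrable_sq M.kernel_measurable.aestronglyMeasurable).2
      (M.kernel_sq_integrable T))
  have hV := (M.integrable_variance t).2
  have hμ : ((volume : Measure ℝ≥0).restrict (Set.Ioc 0 t)).prod P =
      ((volume : Measure ℝ≥0).prod P).restrict (Set.Ioc 0 t ×ˢ Set.univ) := by
    rw [← Measure.prod_restrict, Measure.restrict_univ]
  rw [HasFiniteIntegral, hμ, ← lintegral_indicator (measurableSet_Ioc.prod .univ)] at hV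
  have hbound : ∀ z : ℝ≥0 × Ω, ∫⁻ u in Set.Ioc 0 T, ‖M.fubiniIntegrand g t (u, z)‖ₑ ^ 2
      ≤ (ENNReal.ofReal C ^ 2 * K) * (Set.Ioc 0 t ×ˢ Set.univ).indicator
        (fun p : ℝ≥0 × Ω => ‖M.ξ p.1 p.1 p.2‖ₑ) z := by
    rintro ⟨r, ω⟩
    by_cases hr : r ∈ Set.Ioc 0 t
    · have hr' : ((r, ω) : ℝ≥0 × Ω) ∈ Set.Ioc 0 t ×ˢ (Set.univ : Set Ω) := ⟨hr, Set.mem_univ _⟩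
      rw [Set.indicator_of_mem hr']
      have h1 : ∀ u : ℝ≥0, ‖M.fubiniIntegrand g t (u, (r, ω))‖ₑ ^ 2 ≤ (ENNReal.ofReal C ^ 2 *
          ‖M.ξ r r ω‖ₑ) * (Set.Ici r).indicator (fun u : ℝ≥0 => ‖κ ((u : ℝ) - r)‖ₑ ^ 2) u := by
        intro u
        by_cases hu : r ≤ u
        · have hq : ((u, (r, ω)) : ℝ≥0 × (ℝ≥0 × Ω)) ∈
              {q : ℝ≥0 × (ℝ≥0 × Ω) | q.2.1 ∈ Set.Ioc 0 (min t q.1)} := ⟨hr.1, le_min hr.2 hu⟩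
          rw [fubiniIntegrand, Set.indicator_of_mem hq, Set.indicator_of_mem (show u ∈ Set.Ici r from hu)]
          simp only [min_eq_left hr.2]
          rw [enorm_mul, enorm_mul, mul_pow, mul_pow, mul_comm (‖κ _‖ₑ ^ 2), ← mul_assoc]
          gcongr
          · rw [Real.enorm_eq_ofReal_abs]
            exact ENNReal.ofReal_le_ofReal (hC u)
          -- The bound (√ξ)² ≤ |ξ| holds for either sign, since the square root of a negative number
          -- is zero.
          · rw [← enorm_pow]
            rcases le_or_gt 0 (M.ξ r r ω) with h | h
            · rw [Real.sq_sqrt h]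
            · rw [Real.sqrt_eq_zero_of_nonpos h.le]; simp
        · have hq : ((u, (r, ω)) : ℝ≥0 × (ℝ≥0 × Ω)) ∉
              {q : ℝ≥0 × (ℝ≥0 × Ω) | q.2.1 ∈ Set.Ioc 0 (min t q.1)} :=
            fun h => hu (h.2.trans (min_le_right _ _))
          rw [fubiniIntegrand, Set.indicator_of_notMem hq]
          simp
      refine (lintegral_mono h1).trans ?_
      rw [lintegral_const_mul' _ _ (ENNReal.mul_ne_top (by simp) enorm_ne_top),
        lintegral_indicator measurableSet_Ici, restrict_Ioc_restrict_Ici hr.1, mul_right_comm]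
      gcongr
      exact NNReal.lintegral_Ioc_sub_le (fun x => ‖κ x‖ₑ ^ 2) r T
    · have h1 : ∀ u : ℝ≥0, ‖M.fubiniIntegrand g t (u, (r, ω))‖ₑ ^ 2 = 0 := by
        intro u
        have hq : ((u, (r, ω)) : ℝ≥0 × (ℝ≥0 × Ω)) ∉
            {q : ℝ≥0 × (ℝ≥0 × Ω) | q.2.1 ∈ Set.Ioc 0 (min t q.1)} :=
          fun h => hr ⟨h.1, h.2.trans (min_le_left _ _)⟩
        rw [fubiniIntegrand, Set.indicator_of_notMem hq]
        simp
      simp_rw [h1]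
      simp
  refine (lintegral_mono hbound).trans_lt ?_
  rw [lintegral_const_mul' _ _ (ENNReal.mul_ne_top (by simp) hK.ne)]
  exact ENNReal.mul_lt_top (ENNReal.mul_lt_top (by simp) hK) hV

/-- The martingale part of `∫_t^T ξ_t(s) g(s) ds` is the stochastic integral of
`√V_s ∫_s^T κ(u - s) g(u) du`. -/
theorem isItoPair_tail {T : ℝ≥0} {g : ℝ≥0 → ℝ} (hg : IsBddMeasurable g) {t : ℝ≥0} (ht : t ≤ T) :
    IsItoPair M.𝓕 P M.W
      ((Set.Ioc 0 t ×ˢ Set.univ).indicator fun p => √(M.ξ p.1 p.1 p.2) * Dxi κ T p.1 g)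
      (fun ω => M.tail T g t ω + M.acc g t ω - M.tail T g 0 ω) := by
  classical
  -- N(u) is g(u) (ξ_{min t u}(u) - ξ_0(u)): before t the curve has turned into spot variance, after
  -- t it is still the forward curve. Integration over (0, T] therefore yields `acc` at t plus
  -- `tail` at t minus `tail` at 0. The inner minimum serves joint measurability.
  set N : ℝ≥0 × Ω → ℝ := fun q => g q.1 *
    ((if q.1 ≤ t then M.ξ (min q.1 t) (min q.1 t) q.2 else M.ξ t q.1 q.2) - M.ξ 0 q.1 q.2) with hN
  have hNm : Measurable N :=
    (hg.1.comp measurable_fst).mul ((Measurable.ite (measurableSet_le measurable_fst measurable_const)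
      (M.measurable_variance t) (M.measurable_curve t)).sub (M.measurable_curve 0))
  have hpair : ∀ u : ℝ≥0, IsItoPair M.𝓕 P M.W (fun z => M.fubiniIntegrand g t (u, z))
      (fun ω => N (u, ω)) := by
    intro u
    refine ((M.isItoPair_ξ (min_le_right t u)).const_mul (g u)).congr (ae_of_all _ fun z => ?_)
      (ae_of_all _ fun ω => ?_)
    · simp only [fubiniIntegrand, Set.indicator_apply, Set.mem_prod, Set.mem_univ, and_true,
        Set.mem_ofPred_eq]
      split_ifs with h
      · rw [min_eq_left (h.2.trans (min_le_left _ _))]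
      · rfl
    · simp only [hN]
      split_ifs with h
      · rw [min_eq_right h, min_eq_left h]
      · rw [min_eq_left (le_of_not_ge h)]
  have key := IsItoPair.integral M.W_brownian (M.memLp_fubiniIntegrand hg t T)
    hNm.aestronglyMeasurable (ae_of_all _ hpair)
  refine key.congr (ae_of_all _ fun z => ?_) ?_
  · obtain ⟨r, ω⟩ := z
    by_cases hr : r ∈ Set.Ioc 0 t
    · have hr' : ((r, ω) : ℝ≥0 × Ω) ∈ Set.Ioc 0 t ×ˢ (Set.univ : Set Ω) := ⟨hr, Set.mem_univ _⟩
      rw [Set.indicator_of_mem hr']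
      -- Only maturities u ≥ r carry noise at time r; √V_r factors out and the u-integral is `Dxi`.
      have e : ∀ u : ℝ≥0, M.fubiniIntegrand g t (u, (r, ω)) = (Set.Ici r).indicator
          (fun u : ℝ≥0 => √(M.ξ r r ω) * (κ ((u : ℝ) - r) * g u)) u := by
        intro u
        simp only [fubiniIntegrand, Set.indicator_apply, Set.mem_ofPred_eq, Set.mem_Ioc, le_min_iff, hr.1,
          hr.2, true_and, Set.mem_Ici, min_eq_left hr.2]
        split_ifs
        · ring
        · simp
      simp_rw [e]
      rw [integral_indicator measurableSet_Ici, restrict_Ioc_restrict_Ici hr.1, integral_const_mul, Dxi]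
    · have hr' : ((r, ω) : ℝ≥0 × Ω) ∉ Set.Ioc 0 t ×ˢ (Set.univ : Set Ω) := fun h => hr h.1
      rw [Set.indicator_of_notMem hr']
      have h1 : ∀ u : ℝ≥0, M.fubiniIntegrand g t (u, (r, ω)) = 0 := by
        intro u
        have hq : ((u, (r, ω)) : ℝ≥0 × (ℝ≥0 × Ω)) ∉
            {q : ℝ≥0 × (ℝ≥0 × Ω) | q.2.1 ∈ Set.Ioc 0 (min t q.1)} :=
          fun h => hr ⟨h.1, h.2.trans (min_le_left _ _)⟩
        rw [fubiniIntegrand, Set.indicator_of_notMem hq, mul_zero]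
      simp_rw [h1]
      simp
  · filter_upwards [(M.integrable_variance_mul t hg).prod_left_ae,
      (M.integrable_curve_mul t T hg).prod_left_ae, (M.integrable_curve_mul 0 T hg).prod_left_ae]
      with ω h1 h2 h3
    set F : ℝ≥0 → ℝ := fun u =>
      (if u ≤ t then M.ξ (min u t) (min u t) ω else M.ξ t u ω) * g u with hF
    have e1 : Set.EqOn (fun u => M.ξ u u ω * g u) F (Set.Ioc 0 t) := fun u hu => by
      simp only [hF, if_pos hu.2, min_eq_left hu.2]
    have e2 : Set.EqOn (fun u => M.ξ t u ω * g u) F (Set.Ioc t T) := fun u hu => by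
      simp only [hF, if_neg (not_le.2 hu.1)]
    have i1 : IntegrableOn F (Set.Ioc 0 t) := IntegrableOn.congr_fun h1 e1 measurableSet_Ioc
    have i2 : IntegrableOn F (Set.Ioc t T) := IntegrableOn.congr_fun h2 e2 measurableSet_Ioc
    have i3 : IntegrableOn F (Set.Ioc 0 T) := by
      rw [← Set.Ioc_union_Ioc_eq_Ioc zero_le ht]
      exact i1.union i2
    have e3 : ∀ u, N (u, ω) = F u - M.ξ 0 u ω * g u := fun u => by
      simp only [hN, hF]; ring
    simp_rw [e3]
    rw [integral_sub i3 h3, ← sub_add_cancel (∫ u in Set.Ioc 0 T, F u) (∫ u in Set.Ioc 0 t, F u),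
      setIntegral_Ioc_sub ht i3, ← setIntegral_congr_fun measurableSet_Ioc e1,
      ← setIntegral_congr_fun measurableSet_Ioc e2]
    rfl

end AFVModel

/-- The partition of `[0, t]` into `k + 1` intervals of equal length. -/
noncomputable def TimePartition.uniform (t : ℝ≥0) (k : ℕ) : TimePartition t where
  n := k + 1
  pts i := min (i * (t / (k + 1))) t
  mono i j hij := by
    refine min_le_min_right _ ?_
    gcongr
  zero := by simp
  last := by
    have : ((k + 1 : ℕ) : ℝ≥0) * (t / (k + 1)) = t := by
      push_cast
      exact mul_div_cancel₀ t (by positivity)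
    rw [this, min_self]

theorem TimePartition.tendsto_mesh_uniform (t : ℝ≥0) :
    Tendsto (fun k => (TimePartition.uniform t k).mesh) atTop (𝓝 0) := by
  have h1 : Tendsto (fun k : ℕ => t / ((k : ℝ≥0) + 1)) atTop (𝓝 0) := by
    rw [← NNReal.tendsto_coe]
    push_cast
    have := (tendsto_one_div_add_atTop_nhds_zero_nat (𝕜 := ℝ)).const_mul (t : ℝ)
    simpa [div_eq_mul_inv] using this
  refine tendsto_of_tendsto_of_tendsto_of_le_of_le tendsto_const_nhds h1 (fun _ => zero_le) fun k => ?_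
  refine Finset.sup_le fun i _ => ?_
  simp only [TimePartition.uniform]
  rw [tsub_le_iff_right]
  push_cast
  rw [← min_add_add_left]
  refine le_min ((min_le_left _ _).trans (le_of_eq (by ring))) ((min_le_right _ _).trans ?_)
  exact le_add_self

/-! ### Uniqueness of the covariation process -/

section Covariation

variable {Ω : Type*} [mΩ : MeasurableSpace Ω] {P : Measure Ω} {T : ℝ≥0} {A B C C' : ℝ≥0 → Ω → ℝ}

/-- One sequence of partitions with vanishing mesh, here the uniform one, already determines the
limit. -/
theorem HasCovariation.ae_unique (h : HasCovariation P T A B C) (h' : HasCovariation P T A B C')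
    {t : ℝ≥0} (ht : t ≤ T) : C t =ᵐ[P] C' t :=
  tendstoInMeasure_ae_unique (h t ht _ (TimePartition.tendsto_mesh_uniform t))
    (h' t ht _ (TimePartition.tendsto_mesh_uniform t))

theorem covariation_ae_eq (h : HasCovariation P T A B C) (hC : ∀ t ≤ T, Integrable (C t) P)
    {t : ℝ≥0} (ht : t ≤ T) : covariation P T A B t =ᵐ[P] C t := by
  have hI : HasIntegrableCovariation P T A B := ⟨C, h, hC⟩
  rw [covariation, dif_pos hI]
  exact hI.choose_spec.1.ae_unique h ht

theorem HasCovariation.congr (h : HasCovariation P T A B C) (hC : ∀ t ≤ T, C t =ᵐ[P] C' t) :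
    HasCovariation P T A B C' := fun t ht p hp =>
  (h t ht p hp).congr_right (hC t ht)

end Covariation

/-! ### Itô decompositions and diamond products of trees -/

namespace AFVModel

variable {Ω : Type*} [mΩ : MeasurableSpace Ω] {P : Measure Ω} {κ : ℝ → ℝ} {ρ : ℝ}
  (M : AFVModel P κ ρ) [IsProbabilityMeasure P]

/-- Nonnegativity is assumed almost surely at each fixed time. Fubini exchanges the quantifiers,
through the capped version, which is jointly measurable. -/
theorem ae_variance_nonneg (T : ℝ≥0) :
    ∀ᵐ p : ℝ≥0 × Ω ∂((volume : Measure ℝ≥0).restrict (Set.Ioc 0 T)).prod P, 0 ≤ M.ξ p.1 p.1 p.2 := by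
  have h1 : ∀ᵐ p : ℝ≥0 × Ω ∂((volume : Measure ℝ≥0).restrict (Set.Ioc 0 T)).prod P,
      0 ≤ M.ξ (min p.1 T) (min p.1 T) p.2 := by
    rw [Measure.ae_prod_iff_ae_ae (measurableSet_le measurable_const (M.measurable_variance T))]
    exact ae_of_all _ fun s => M.ξ_nonneg (min s T) (min s T) le_rfl
  have h2 : ∀ᵐ p : ℝ≥0 × Ω ∂((volume : Measure ℝ≥0).restrict (Set.Ioc 0 T)).prod P,
      p.1 ∈ Set.Ioc 0 T :=
    Measure.quasiMeasurePreserving_fst.ae (ae_restrict_mem measurableSet_Ioc)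
  filter_upwards [h1, h2] with p h3 h4
  rwa [min_eq_left h4.2] at h3

/-- The log-price is an Itô process driven by `Z`. -/
theorem isItoProcess_X (T : ℝ≥0) :
    IsItoProcess M.𝓕 P M.Z T (fun p => √(M.ξ p.1 p.1 p.2) * 1) M.X := by
  obtain ⟨R, hR, hS⟩ := M.S_dynamics
  refine ⟨fun ω => Real.log (M.S 0 ω), R, fun p => M.ξ p.1 p.1 p.2 * (-(1 / 2)),
    (M.integrable_variance T).mul_const _, fun t _ => ?_, fun t _ => ?_⟩
  · simp only [mul_one]
    exact (hR t).isItoPair M.Z_brownian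
  · filter_upwards [hS t, M.S_pos] with ω h1 h2
    rw [X, h1, Real.log_mul h2.ne' (Real.exp_pos _).ne', Real.log_exp, integral_mul_const]
    ring

/-- The functionals `∫_t^T ξ_t(s) g(s) ds` form an Itô process driven by `W`. -/
theorem isItoProcess_of_ae_eq_tail {T : ℝ≥0} {g : ℝ≥0 → ℝ} (hg : IsBddMeasurable g)
    {A : ℝ≥0 → Ω → ℝ} (hA : ∀ t ≤ T, A t =ᵐ[P] M.tail T g t) :
    IsItoProcess M.𝓕 P M.W T (fun p => √(M.ξ p.1 p.1 p.2) * Dxi κ T p.1 g) A := by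
  -- The tail at t is its initial value plus the martingale part, minus the variance already
  -- accumulated: as t grows, mass leaves the tail at rate V_t g(t).
  refine ⟨M.tail T g 0, fun t ω => M.tail T g t ω + M.acc g t ω - M.tail T g 0 ω,
    fun p => -(M.ξ p.1 p.1 p.2 * g p.1), (M.integrable_variance_mul T hg).neg,
    fun t ht => M.isItoPair_tail hg ht, fun t ht => ?_⟩
  filter_upwards [hA t ht] with ω hω
  rw [hω, integral_neg, acc]
  ring

/-- The diamond product of two Itô processes with integrands `√V h` and `√V h'`. -/
theorem hasIntegrableCovariation_and_diamond {B₁ B₂ : ℝ≥0 → Ω → ℝ} (hB₁ : IsBrownianWrt M.𝓕 P B₁)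
    (hB₂ : IsBrownianWrt M.𝓕 P B₂) {c : ℝ} (hc : ∀ T, HasCovariation P T B₁ B₂ (fun t _ => c * t))
    {T : ℝ≥0} {h h' : ℝ≥0 → ℝ} (hh : IsBddMeasurable h) (hh' : IsBddMeasurable h')
    {A A' : ℝ≥0 → Ω → ℝ}
    (hA : IsItoProcess M.𝓕 P B₁ T (fun p => √(M.ξ p.1 p.1 p.2) * h p.1) A)
    (hA' : IsItoProcess M.𝓕 P B₂ T (fun p => √(M.ξ p.1 p.1 p.2) * h' p.1) A') :
    HasIntegrableCovariation P T A A' ∧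
      ∀ t ≤ T, diamond M.𝓕 P T A A' t =ᵐ[P] M.tail T (fun s => c * (h s * h' s)) t := by
  have hg : IsBddMeasurable fun s => c * (h s * h' s) := (hh.mul hh').const_mul c
  -- The two square roots multiply to V wherever V is nonnegative, that is, almost everywhere.
  have hcov : HasCovariation P T A A' (M.acc fun s => c * (h s * h' s)) := by
    refine (hA.hasCovariation hB₁ hB₂ hc hA').congr fun t ht => ?_
    filter_upwards [ae_ae_of_ae_prod_swap (M.ae_variance_nonneg t)] with ω hω
    rw [acc, ← integral_const_mul]
    refine integral_congr_ae ?_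
    filter_upwards [hω] with s hs
    rw [mul_mul_mul_comm, Real.mul_self_sqrt hs]
    ring
  have hint : ∀ t ≤ T, Integrable (M.acc (fun s => c * (h s * h' s)) t) P :=
    fun t _ => M.integrable_acc hg t
  refine ⟨⟨_, hcov, hint⟩, fun t ht => ?_⟩
  filter_upwards [condExp_congr_ae (m := M.𝓕 t) (covariation_ae_eq hcov hint le_rfl),
    covariation_ae_eq hcov hint ht, M.condExp_acc ht hg] with ω h1 h2 h3
  rw [diamond, h1, h2, h3, add_sub_cancel_left]

theorem hasCovariation_one_mul {𝓕 : Filtration ℝ≥0 mΩ} {B : ℝ≥0 → Ω → ℝ} (hB : IsBrownianWrt 𝓕 P B)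
    (T : ℝ≥0) : HasCovariation P T B B (fun t _ => 1 * t) := by
  simpa only [one_mul] using hB.hasCovariation_self T

/-- Every node of a diamond tree is well defined and of the form `∫_t^T ξ_t(s) g(s) ds`. -/
theorem tree_eq_tail (T : ℝ≥0) (𝕋 : DiamondTree) (h𝕋 : 𝕋 ≠ .leaf) :
    M.TreeWellDefined T 𝕋 ∧ ∃ g, IsBddMeasurable g ∧ ∀ t ≤ T, M.tree T 𝕋 t =ᵐ[P] M.tail T g t := by
  have key : ∀ 𝕋 : DiamondTree, M.TreeWellDefined T 𝕋 ∧ (𝕋 ≠ .leaf →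
      ∃ g, IsBddMeasurable g ∧ ∀ t ≤ T, M.tree T 𝕋 t =ᵐ[P] M.tail T g t) := by
    intro 𝕋
    induction 𝕋 with
    | leaf => exact ⟨trivial, fun h => (h rfl).elim⟩
    | node a b iha ihb =>
      -- The two kinds of factor: a leaf has h = 1 and driver Z, any other tree has h = `Dxi` of its
      -- weight and driver W.
      have hform : ∀ a : DiamondTree, (a ≠ .leaf →
          ∃ g, IsBddMeasurable g ∧ ∀ t ≤ T, M.tree T a t =ᵐ[P] M.tail T g t) →
          ∃ h, IsBddMeasurable h ∧
          (IsItoProcess M.𝓕 P M.Z T (fun p => √(M.ξ p.1 p.1 p.2) * h p.1) (M.tree T a) ∨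
           IsItoProcess M.𝓕 P M.W T (fun p => √(M.ξ p.1 p.1 p.2) * h p.1) (M.tree T a)) := by
        intro a ha
        by_cases hl : a = .leaf
        · subst hl
          exact ⟨fun _ => 1, ⟨measurable_const, 1, fun _ => by simp⟩, Or.inl (M.isItoProcess_X T)⟩
        · obtain ⟨g, hg, hag⟩ := ha hl
          exact ⟨_, M.isBddMeasurable_Dxi T hg, Or.inr (M.isItoProcess_of_ae_eq_tail hg hag)⟩
      have hgen : ∃ g, IsBddMeasurable g ∧ (HasIntegrableCovariation P T (M.tree T a) (M.tree T b) ∧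
          ∀ t ≤ T, diamond M.𝓕 P T (M.tree T a) (M.tree T b) t =ᵐ[P] M.tail T g t) := by
        obtain ⟨h, hh, hA⟩ := hform a iha.2
        obtain ⟨h', hh', hA'⟩ := hform b ihb.2
        -- The new weight is c h h', with c = 1 for equal drivers and c = ρ for different ones.
        rcases hA with hA | hA <;> rcases hA' with hA' | hA'
        · exact ⟨_, (hh.mul hh').const_mul 1, M.hasIntegrableCovariation_and_diamond M.Z_brownian
            M.Z_brownian (hasCovariation_one_mul M.Z_brownian) hh hh' hA hA'⟩
        · exact ⟨_, (hh.mul hh').const_mul ρ, M.hasIntegrableCovariation_and_diamond M.Z_brownian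
            M.W_brownian M.correlation hh hh' hA hA'⟩
        · exact ⟨_, (hh.mul hh').const_mul ρ, M.hasIntegrableCovariation_and_diamond M.W_brownian
            M.Z_brownian (fun T => (M.correlation T).symm) hh hh' hA hA'⟩
        · exact ⟨_, (hh.mul hh').const_mul 1, M.hasIntegrableCovariation_and_diamond M.W_brownian
            M.W_brownian (hasCovariation_one_mul M.W_brownian) hh hh' hA hA'⟩
      obtain ⟨g, hg, hi, hd⟩ := hgen
      exact ⟨⟨iha.1, ihb.1, hi⟩, fun _ => ⟨g, hg, hd⟩⟩
  exact ⟨(key 𝕋).1, (key 𝕋).2 h𝕋⟩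

end AFVModel

/-! ### Functional derivatives and continuity of the kernel operator -/

/-- Integration against a bounded weight is its own functional derivative. -/
theorem hasFunctionalDerivAt_integral (s T : ℝ≥0) {g : ℝ≥0 → ℝ} (hg : IsBddMeasurable g)
    {x : ℝ≥0 → ℝ} (hx : IntegrableOn x (Set.Icc s T)) :
    HasFunctionalDerivAt s T (fun x => ∫ u in Set.Icc s T, x u * g u) g x := by
  obtain ⟨C, hC⟩ := hg.2
  refine ⟨hg.1.aestronglyMeasurable, ⟨C, ae_of_all _ hC⟩, fun ε hε => ⟨1, one_pos, fun y hy _ => ?_⟩⟩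
  have i1 : Integrable (fun u => x u * g u) (volume.restrict (Set.Icc s T)) :=
    hg.integrable_mul hx measurable_id
  have i2 : Integrable (fun u => g u * y u) (volume.restrict (Set.Icc s T)) :=
    (hg.integrable_mul hy measurable_id).congr (ae_of_all _ fun u => mul_comm _ _)
  have h1 : ∫ u in Set.Icc s T, (x + y) u * g u
      = (∫ u in Set.Icc s T, x u * g u) + ∫ u in Set.Icc s T, g u * y u := by
    rw [← integral_add i1 i2]
    refine integral_congr_ae (ae_of_all _ fun u => ?_)
    simp only [Pi.add_apply]
    ring
  beta_reduce
  rw [h1, add_sub_cancel_left, sub_self, abs_zero]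
  exact mul_nonneg hε.le (integral_nonneg fun _ => abs_nonneg _)

theorem AFVModel.isCurveFunctional_of_ae_eq_tail {Ω : Type*} [mΩ : MeasurableSpace Ω] {P : Measure Ω}
    {κ : ℝ → ℝ} {ρ : ℝ} (M : AFVModel P κ ρ) {T : ℝ≥0} {g : ℝ≥0 → ℝ} (hg : IsBddMeasurable g)
    {A : ℝ≥0 → Ω → ℝ} (hA : ∀ t ≤ T, A t =ᵐ[P] M.tail T g t) :
    M.IsCurveFunctional T A (fun s x => ∫ u in Set.Icc s T, x u * g u) (fun _ => g) where
  eq_functional s hs := by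
    filter_upwards [hA s hs] with ω hω
    rw [hω, tail, integral_Icc_eq_integral_Ioc]
  hasDeriv s _ _ hx := hasFunctionalDerivAt_integral s T hg hx

/-- The correlation of a bounded function with an integrable function is continuous. -/
theorem continuous_integral_mul_comp_sub {h k : ℝ → ℝ} (hh : Measurable h) {C : ℝ}
    (hC : ∀ x, |h x| ≤ C) (hk : Integrable k) : Continuous fun r => ∫ x, h x * k (x - r) := by
  have hC0 : 0 ≤ C := (abs_nonneg _).trans (hC 0)
  have hbd : ∀ {f : ℝ → ℝ}, Integrable f → Integrable fun x => h x * f x := fun hf =>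
    hf.bdd_mul hh.aestronglyMeasurable (ae_of_all _ hC)
  -- Replacing k by a continuous compactly supported ψ changes the correlation by at most C times
  -- the L¹ distance, uniformly in r. For ψ the correlation is a convolution with its reflection.
  refine continuous_of_uniform_approx_of_continuous fun u hu => ?_
  obtain ⟨ε, hε, hεu⟩ := Metric.mem_uniformity_dist.1 hu
  obtain ⟨ψ, hψs, hψ, hψc, hψi⟩ := hk.exists_hasCompactSupport_integral_sub_le
    (ε := ε / (2 * (C + 1))) (by positivity)
  refine ⟨fun r => ∫ x, h x * ψ (x - r), ?_, fun r => hεu ?_⟩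
  · have hloc : LocallyIntegrable h :=
      (memLp_top_of_bound hh.aestronglyMeasurable C (ae_of_all _ hC)).locallyIntegrable le_top
    have h1 := (hψs.comp_homeomorph (Homeomorph.neg ℝ)).continuous_convolution_right
      (ContinuousLinearMap.mul ℝ ℝ) hloc (hψc.comp (Homeomorph.neg ℝ).continuous)
    refine h1.congr fun r => ?_
    rw [convolution]
    refine integral_congr_ae (ae_of_all _ fun x => ?_)
    simp
  · have e : (∫ x, h x * k (x - r)) - ∫ x, h x * ψ (x - r)
        = ∫ x, h x * (k (x - r) - ψ (x - r)) := by
      rw [← integral_sub (hbd (hk.comp_sub_right r)) (hbd (hψi.comp_sub_right r))]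
      simp only [mul_sub]
    rw [Real.dist_eq, e]
    calc |∫ x, h x * (k (x - r) - ψ (x - r))|
        ≤ ∫ x, C * ‖k (x - r) - ψ (x - r)‖ := by
          refine norm_integral_le_of_norm_le (f := fun x => h x * (k (x - r) - ψ (x - r)))
            (((hk.comp_sub_right r).sub (hψi.comp_sub_right r)).norm.const_mul C)
            (ae_of_all _ fun x => ?_)
          rw [norm_mul]
          exact mul_le_mul_of_nonneg_right (hC x) (norm_nonneg _)
      _ = C * ∫ x, ‖k x - ψ x‖ := by
          rw [integral_const_mul, integral_sub_right_eq_self (fun x => ‖k x - ψ x‖) r]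
      _ ≤ C * (ε / (2 * (C + 1))) := by gcongr
      _ < ε := by
          rw [← mul_div_assoc, div_lt_iff₀ (by positivity)]
          nlinarith

/-- Points having a left neighbourhood on which `p` holds almost everywhere satisfy `p` up to a
null set. -/
theorem measure_eq_zero_of_ae_left {B : Set ℝ≥0} {p : ℝ≥0 → Prop} (hp : ∀ s ∈ B, ¬ p s)
    (h : ∀ s ∈ B, ∃ a < s, ∀ᵐ r ∂(volume : Measure ℝ≥0).restrict (Set.Ioo a s), p r) :
    volume B = 0 := by
  choose! a ha hae using h
  -- Lindelöf: countably many of the intervals cover the whole union, so p holds almost everywhere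
  -- on it.
  obtain ⟨D, hDB, hD, hU⟩ := TopologicalSpace.isOpen_biUnion_countable B
    (fun s => Set.Ioo (a s) s) (fun _ _ => isOpen_Ioo)
  set U := ⋃ s ∈ B, Set.Ioo (a s) s with hUdef
  have hUae : ∀ᵐ r ∂(volume : Measure ℝ≥0).restrict U, p r := by
    rw [← hU, ae_restrict_biUnion_iff _ hD]
    exact fun s hs => hae s (hDB hs)
  have hUm : MeasurableSet U := (isOpen_biUnion fun _ _ => isOpen_Ioo).measurableSet
  have h1 : volume (B ∩ U) = 0 := by
    rw [ae_restrict_iff' hUm] at hUae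
    refine measure_mono_null (fun s hs => ?_) hUae
    exact fun hcon => hp s hs.1 (hcon hs.2)
  -- A point of B outside the union is isolated from the left among such points, its own left
  -- interval belonging to the union. There are only countably many points of this kind.
  have h2 : (B \ U).Countable := by
    refine (countable_setOfPred_isolated_left_within (s := B \ U)).mono fun s hs => ?_
    refine Set.mem_sep hs ?_
    rw [← empty_mem_iff_bot, mem_nhdsWithin]
    refine ⟨Set.Ioi (a s), isOpen_Ioi, ha s hs.1, ?_⟩
    rintro r ⟨h3, h4, h5⟩
    exact h4.2 (Set.mem_biUnion hs.1 ⟨h3, h5⟩)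
  rw [← Set.inter_union_sdiff B U]
  exact measure_union_null h1 (h2.measure_zero _)

/-- A functional with a functional derivative independent of the curve is affine. -/
theorem sub_eq_integral_of_hasFunctionalDerivAt {s T : ℝ≥0} {Φ : (ℝ≥0 → ℝ) → ℝ} {δ : ℝ≥0 → ℝ}
    (h : ∀ x, IntegrableOn x (Set.Icc s T) → HasFunctionalDerivAt s T Φ δ x) {x : ℝ≥0 → ℝ}
    (hx : IntegrableOn x (Set.Icc s T)) : Φ x - Φ 0 = ∫ u in Set.Icc s T, δ u * x u := by
  set c := ∫ u in Set.Icc s T, δ u * x u with hc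
  set m := ∫ u in Set.Icc s T, |x u| with hm
  have hm0 : 0 ≤ m := integral_nonneg fun _ => abs_nonneg _
  -- Along the ray through x the derivative is the same number c at every l, so Φ(l x) - l c is
  -- constant; it is compared at l = 1 and l = 0.
  have key : ∀ l : ℝ, HasDerivAt (fun l : ℝ => Φ (l • x)) c l := by
    intro l
    rw [hasDerivAt_iff_isLittleO, Asymptotics.isLittleO_iff]
    intro ε hε
    obtain ⟨r, hr, hΦ⟩ := (h (l • x) (hx.smul l)).2.2 (ε / (m + 1)) (by positivity)
    filter_upwards [Metric.ball_mem_nhds l (show 0 < r / (m + 1) by positivity)] with l' hl'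
    rw [Metric.mem_ball, Real.dist_eq, lt_div_iff₀ (by positivity)] at hl'
    have e1 : ∫ u in Set.Icc s T, |((l' - l) • x) u| = |l' - l| * m := by
      simp only [Pi.smul_apply, smul_eq_mul, abs_mul]
      rw [integral_const_mul]
    have e2 : ∫ u in Set.Icc s T, δ u * ((l' - l) • x) u = (l' - l) * c := by
      rw [hc, ← integral_const_mul]
      refine integral_congr_ae (ae_of_all _ fun u => ?_)
      simp only [Pi.smul_apply, smul_eq_mul]
      ring
    have := hΦ ((l' - l) • x) (hx.smul _) (by rw [e1]; nlinarith [abs_nonneg (l' - l)])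
    rw [e1, e2, ← add_smul, add_sub_cancel] at this
    rw [Real.norm_eq_abs, Real.norm_eq_abs, smul_eq_mul]
    refine this.trans ?_
    rw [div_mul_eq_mul_div, div_le_iff₀ (by positivity)]
    nlinarith [mul_nonneg hε.le (abs_nonneg (l' - l))]
  have h2 : ∀ l : ℝ, HasDerivAt (fun l : ℝ => Φ (l • x) - l * c) 0 l := fun l =>
    ((key l).sub ((hasDerivAt_id l).mul_const c)).congr_deriv (by simp)
  have h3 := is_const_of_deriv_eq_zero (fun l => (h2 l).differentiableAt) (fun l => (h2 l).deriv) 1 0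
  simp only [one_smul, zero_smul, one_mul, zero_mul, sub_zero] at h3
  linarith

/-- A functional derivative has a bounded measurable version. -/
theorem exists_isBddMeasurable_ae_eq {S : Set ℝ≥0} {δ : ℝ≥0 → ℝ}
    (h1 : AEStronglyMeasurable δ (volume.restrict S))
    (h2 : ∃ c : ℝ, ∀ᵐ u ∂(volume.restrict S), |δ u| ≤ c) :
    ∃ g, IsBddMeasurable g ∧ δ =ᵐ[volume.restrict S] g := by
  obtain ⟨c, hc⟩ := h2
  refine ⟨fun u => max (-|c|) (min |c| (h1.mk δ u)), ⟨?_, |c|, fun u => ?_⟩, ?_⟩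
  · exact measurable_const.max (measurable_const.min h1.stronglyMeasurable_mk.measurable)
  · exact abs_le.2 ⟨le_max_left _ _, max_le (by linarith [abs_nonneg c]) (min_le_left _ _)⟩
  · filter_upwards [hc, h1.ae_eq_mk] with u h3 h4
    have h5 := abs_le.1 (h3.trans (le_abs_self c))
    rw [← h4, min_eq_right h5.2, max_eq_right h5.1]

theorem IsBddMeasurable.sub {g h : ℝ≥0 → ℝ} (hg : IsBddMeasurable g) (hh : IsBddMeasurable h) :
    IsBddMeasurable fun s => g s - h s := by
  obtain ⟨h1, C, hC⟩ := hg
  obtain ⟨h2, D, hD⟩ := hh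
  exact ⟨h1.sub h2, C + D, fun s => (abs_sub _ _).trans (add_le_add (hC s) (hD s))⟩

theorem IsBddMeasurable.indicator {g : ℝ≥0 → ℝ} (hg : IsBddMeasurable g) {S : Set ℝ≥0}
    (hS : MeasurableSet S) : IsBddMeasurable (S.indicator g) := by
  classical
  obtain ⟨h1, C, hC⟩ := hg
  refine ⟨h1.indicator hS, C, fun s => ?_⟩
  rw [Set.indicator_apply]
  split_ifs
  · exact hC s
  · simpa using (abs_nonneg _).trans (hC s)

/-- Truncating the density to `(s, T]`, the operator `Dxi` depends continuously on time up to `s`. -/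
theorem exists_continuous_eq_Dxi {κ : ℝ → ℝ} {s T : ℝ≥0} (hκ : IntegrableOn κ (Set.Ioc 0 (T : ℝ)))
    {g : ℝ≥0 → ℝ} (hg : IsBddMeasurable g) :
    ∃ J : ℝ≥0 → ℝ, Continuous J ∧ ∀ r ≤ s, J r = Dxi κ T r ((Set.Ioc s T).indicator g) := by
  obtain ⟨h1, C, hC⟩ := hg.indicator (measurableSet_Ioc (a := s) (b := T))
  set φ := (Set.Ioc s T).indicator g with hφ
  set k := (Set.Ioc 0 (T : ℝ)).indicator κ with hk
  have hki : Integrable k := (integrable_indicator_iff measurableSet_Ioc).2 hκ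
  -- As φ lives on (s, T], for r ≤ s the lower limit of integration plays no role and u - r stays in
  -- (0, T], so `Dxi` is a correlation on the real line. Negative x contribute nothing: `toNNReal`
  -- sends them to 0, outside (s, T].
  refine ⟨fun r => ∫ x, φ x.toNNReal * k (x - r), (continuous_integral_mul_comp_sub
    (h1.comp measurable_real_toNNReal) (fun x => hC _) hki).comp NNReal.continuous_coe,
    fun r hr => ?_⟩
  have e1 : ∀ x : ℝ, φ x.toNNReal * k (x - r) =
      (Set.Ici (0 : ℝ)).indicator (fun x => φ x.toNNReal * k (x - r)) x := by
    intro x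
    rw [Set.indicator_apply]
    split_ifs with hx
    · rfl
    · have : x.toNNReal ∉ Set.Ioc s T := by
        rw [Real.toNNReal_of_nonpos (not_le.1 hx).le]
        exact fun h => not_lt_zero h.1
      rw [hφ, Set.indicator_of_notMem this, zero_mul]
  change ∫ x, φ x.toNNReal * k (x - r) = _
  rw [integral_congr_ae (ae_of_all _ e1), integral_indicator measurableSet_Ici, ← NNReal.map_coe_volume,
    NNReal.measurableEmbedding_coe.integral_map, Dxi, ← integral_indicator measurableSet_Ioc]
  refine integral_congr_ae (ae_of_all _ fun u => ?_)
  simp only [Real.toNNReal_coe, Set.indicator_apply, hφ, hk]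
  by_cases hu : u ∈ Set.Ioc s T
  · have h2 : u ∈ Set.Ioc r T := ⟨hr.trans_lt hu.1, hu.2⟩
    have h3 : (u : ℝ) - r ∈ Set.Ioc 0 (T : ℝ) :=
      ⟨sub_pos.2 (NNReal.coe_lt_coe.2 h2.1),
        (sub_le_self _ r.coe_nonneg).trans (NNReal.coe_le_coe.2 hu.2)⟩
    rw [if_pos hu, if_pos h2, if_pos h3, mul_comm]
  · simp [hu]

theorem Dxi_congr_ae {κ : ℝ → ℝ} {s T : ℝ≥0} {δ g : ℝ≥0 → ℝ}
    (h : δ =ᵐ[volume.restrict (Set.Ioc s T)] g) : Dxi κ T s δ = Dxi κ T s g := by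
  refine integral_congr_ae ?_
  filter_upwards [h] with u hu
  rw [hu]

theorem Dxi_sub {κ : ℝ → ℝ} (hκ : Measurable κ) {s T : ℝ≥0} (hκT : IntegrableOn κ (Set.Ioc 0 (T : ℝ)))
    {g h : ℝ≥0 → ℝ} (hg : IsBddMeasurable g) (hh : IsBddMeasurable h) :
    Dxi κ T s (fun u => g u - h u) = Dxi κ T s g - Dxi κ T s h := by
  have i := integrableOn_kernel hκ hκT (s := s)
  have i1 : Integrable (fun u : ℝ≥0 => κ (u - s) * g u) (volume.restrict (Set.Ioc s T)) :=
    hg.integrable_mul i measurable_id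
  have i2 : Integrable (fun u : ℝ≥0 => κ (u - s) * h u) (volume.restrict (Set.Ioc s T)) :=
    hh.integrable_mul i measurable_id
  simp only [Dxi, mul_sub]
  exact integral_sub i1 i2

/-! ### Independence of the formula from the choice of functional derivative -/

namespace AFVModel

variable {Ω : Type*} [mΩ : MeasurableSpace Ω] {P : Measure Ω} {κ : ℝ → ℝ} {ρ : ℝ}
  (M : AFVModel P κ ρ) [IsProbabilityMeasure P]

/-- If `∫_s^T ξ_s(u) g(u) du` is deterministic, then the spot variance vanishes at almost every
earlier time at which the martingale integrand does not. -/
theorem variance_eq_zero_of_tail_eq_const {s T : ℝ≥0} (hs : s ≤ T) {g : ℝ≥0 → ℝ}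
    (hg : IsBddMeasurable g) {c : ℝ} (hc : M.tail T g s =ᵐ[P] fun _ => c) :
    ∀ᵐ r ∂(volume : Measure ℝ≥0).restrict (Set.Ioc 0 s),
      Dxi κ T r ((Set.Ioc s T).indicator g) ≠ 0 → M.ξ r r =ᵐ[P] 0 := by
  -- Cutting the weight to (s, T] leaves the tail at s unchanged and removes the accumulated
  -- variance up to s, so the Itô integral is the tail at s minus the tail at 0.
  set φ := (Set.Ioc s T).indicator g with hφdef
  have hφ : IsBddMeasurable φ := hg.indicator measurableSet_Ioc
  have h1 : ∀ ω, M.tail T φ s ω = M.tail T g s ω := fun ω =>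
    setIntegral_congr_fun measurableSet_Ioc fun u hu => by
      simp only [hφdef, Set.indicator_of_mem hu]
  have h2 : ∀ ω, M.acc φ s ω = 0 := fun ω => by
    rw [acc, setIntegral_congr_fun (g := fun _ => (0 : ℝ)) measurableSet_Ioc fun u hu => ?_]
    · simp
    · simp only [hφdef, Set.indicator_of_notMem (fun h : u ∈ Set.Ioc s T => h.1.not_ge hu.2),
        mul_zero]
  have hpair := M.isItoPair_tail hφ hs
  have hN : (fun ω => M.tail T φ s ω + M.acc φ s ω - M.tail T φ 0 ω)
      =ᵐ[P] fun ω => c - M.tail T φ 0 ω := by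
    filter_upwards [hc] with ω hω
    rw [h1, h2, hω, add_zero]
  have hpair' := hpair.congr (ae_eq_refl _) hN
  -- Conditioning on 𝓕 0 truncates the integrand to the empty interval (0, 0], while c minus the
  -- tail at 0 is already 𝓕 0-measurable; hence it vanishes.
  have hzero : (fun ω => c - M.tail T φ 0 ω) =ᵐ[P] 0 := by
    have h3 := (hpair'.condExp M.W_brownian 0).snd_ae_eq_zero M.W_brownian
      (by simp [Pi.zero_def])
    rwa [condExp_of_stronglyMeasurable (f := fun ω => c - M.tail T φ 0 ω) (M.𝓕.le 0)
      (stronglyMeasurable_const.sub (M.stronglyMeasurable_tail T hφ 0))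
      ((integrable_const c).sub (M.integrable_tail T hφ 0))] at h3
  have hH := hpair'.fst_ae_eq_zero M.W_brownian hzero
  rw [ae_restrict_iff' measurableSet_Ioc]
  filter_upwards [Measure.ae_ae_of_ae_prod hH] with r hr hrs hD
  filter_upwards [hr, M.ξ_nonneg r r le_rfl] with ω h3 h4
  have hmem : ((r, ω) : ℝ≥0 × Ω) ∈ Set.Ioc 0 s ×ˢ (Set.univ : Set Ω) := ⟨hrs, Set.mem_univ _⟩
  rw [Set.indicator_of_mem hmem] at h3
  simpa using (Real.sqrt_eq_zero h4).1 ((mul_eq_zero.1 h3).resolve_right hD)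

/-- The densities of a family of curve functionals representing `∫_s^T ξ_s(u) g(u) du` yield the
same operator `Dxi` as `g` at almost every time with nonvanishing variance. -/
theorem ae_variance_eq_zero_or_Dxi_eq {T : ℝ≥0} {g : ℝ≥0 → ℝ} (hg : IsBddMeasurable g)
    {A : ℝ≥0 → Ω → ℝ} (hA : ∀ t ≤ T, A t =ᵐ[P] M.tail T g t) {Φ : ℝ≥0 → (ℝ≥0 → ℝ) → ℝ}
    {δ : ℝ≥0 → ℝ≥0 → ℝ} (hΦ : M.IsCurveFunctional T A Φ δ) :
    ∀ᵐ s ∂(volume : Measure ℝ≥0).restrict (Set.Ioc 0 T),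
      M.ξ s s =ᵐ[P] 0 ∨ Dxi κ T s (δ s) = Dxi κ T s g := by
  set B := {s | s ∈ Set.Ioc 0 T ∧ ¬ (M.ξ s s =ᵐ[P] 0) ∧ Dxi κ T s (δ s) ≠ Dxi κ T s g}
  suffices hB : volume B = 0 by
    rw [ae_restrict_iff' measurableSet_Ioc]
    refine measure_mono_null (fun s hs => ?_) hB
    by_contra hcon
    refine hs fun hsT => ?_
    by_contra h
    push Not at h
    exact hcon ⟨hsT, h⟩
  refine measure_eq_zero_of_ae_left (p := fun s => M.ξ s s =ᵐ[P] 0) (fun s hs => hs.2.1) ?_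
  rintro s ⟨⟨hs0, hsT⟩, -, hD⟩
  have hd := hΦ.hasDeriv s hsT
  obtain ⟨δ', hδ', hδae⟩ := exists_isBddMeasurable_ae_eq (hd 0 integrableOn_zero).1
    (hd 0 integrableOn_zero).2.1
  have hφ := hδ'.sub hg
  -- Both weights represent A_s, the first up to the additive constant of the affine functional Φ_s.
  have hconst : M.tail T (fun u => δ' u - g u) s =ᵐ[P] fun _ => -Φ s 0 := by
    filter_upwards [hΦ.eq_functional s hsT, hA s hsT, (M.integrable_curve s T).prod_left_ae]
      with ω h1 h2 h3
    have h3' : IntegrableOn (fun u => M.ξ s u ω) (Set.Icc s T) :=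
      (integrableOn_Icc_iff_integrableOn_Ioc).2 h3
    have h4 := sub_eq_integral_of_hasFunctionalDerivAt hd h3'
    have h5 : ∫ u in Set.Icc s T, δ s u * M.ξ s u ω = M.tail T δ' s ω := by
      rw [tail, ← integral_Icc_eq_integral_Ioc]
      refine integral_congr_ae ?_
      filter_upwards [hδae] with u hu
      rw [hu, mul_comm]
    have h6 : M.tail T (fun u => δ' u - g u) s ω = M.tail T δ' s ω - M.tail T g s ω := by
      simp only [tail, mul_sub]
      exact integral_sub (hδ'.integrable_mul h3 measurable_id) (hg.integrable_mul h3 measurable_id)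
    rw [h6, ← h5, ← h4, ← h1, h2]
    ring
  have hae := M.variance_eq_zero_of_tail_eq_const hsT hφ hconst
  obtain ⟨J, hJc, hJ⟩ := exists_continuous_eq_Dxi (s := s) (M.integrableOn_kernel_zero T) hφ
  have hJs : J s ≠ 0 := by
    have e : Dxi κ T s ((Set.Ioc s T).indicator fun u => δ' u - g u)
        = Dxi κ T s fun u => δ' u - g u :=
      setIntegral_congr_fun measurableSet_Ioc fun u hu => by
        simp only [Set.indicator_of_mem hu]
    rw [hJ s le_rfl, e, Dxi_sub M.kernel_measurable (M.integrableOn_kernel_zero T) hδ' hg, sub_ne_zero,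
      ← Dxi_congr_ae (ae_mono (Measure.restrict_mono Set.Ioc_subset_Icc_self le_rfl) hδae)]
    exact hD
  -- J does not vanish at s, hence not on a left neighbourhood of s, which exists because s > 0.
  -- There the martingale integrand can vanish only if the variance does.
  obtain ⟨a, has, ha⟩ := exists_Ioc_subset_of_mem_nhds (hJc.continuousAt.eventually_ne hJs) ⟨0, hs0⟩
  refine ⟨a, has, ?_⟩
  have hsub : Set.Ioo a s ⊆ Set.Ioc 0 s := fun r hr => ⟨zero_le.trans_lt hr.1, hr.2.le⟩
  filter_upwards [ae_mono (Measure.restrict_mono hsub le_rfl) hae,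
    ae_restrict_mem measurableSet_Ioo] with r h1 h2
  refine h1 ?_
  rw [← hJ r h2.2.le]
  exact ha ⟨h2.1, h2.2.le⟩

/-- The forward variance is the conditional expectation of the spot variance. -/
theorem ξ_eq_zero_of_variance_eq_zero {t u : ℝ≥0} (htu : t ≤ u) (h0 : Integrable (M.ξ 0 u) P)
    (h : M.ξ u u =ᵐ[P] 0) : M.ξ t u =ᵐ[P] 0 := by
  have h1 := (M.condExp_ξ htu h0).symm.trans (condExp_congr_ae h)
  rwa [condExp_zero] at h1

/-- Functional derivatives agree after multiplication by the forward variance. -/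
theorem ae_ξ_mul_Dxi_eq {T : ℝ≥0} {g : ℝ≥0 → ℝ} (hg : IsBddMeasurable g)
    {A : ℝ≥0 → Ω → ℝ} (hA : ∀ t ≤ T, A t =ᵐ[P] M.tail T g t) {Φ : ℝ≥0 → (ℝ≥0 → ℝ) → ℝ}
    {δ : ℝ≥0 → ℝ≥0 → ℝ} (hΦ : M.IsCurveFunctional T A Φ δ) (t : ℝ≥0) :
    ∀ᵐ ω ∂P, ∀ᵐ s ∂(volume : Measure ℝ≥0).restrict (Set.Ioc t T),
      M.ξ t s ω * Dxi κ T s (δ s) = M.ξ t s ω * Dxi κ T s g := by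
  have hsub : (volume : Measure ℝ≥0).restrict (Set.Ioc t T) ≤ volume.restrict (Set.Ioc 0 T) :=
    Measure.restrict_mono (Set.Ioc_subset_Ioc_left zero_le) le_rfl
  have hm := M.measurable_curve t
  -- The statement that ξ_t(s) vanishes a.s. is encoded as E|ξ_t(s)| = 0, a measurable condition on
  -- s. Fubini then gives one null set of ω valid for almost every s.
  have hEm : Measurable fun p : ℝ≥0 × Ω => ∫⁻ ω, ‖M.ξ t p.1 ω‖ₑ ∂P :=
    (Measurable.lintegral_prod_right' hm.enorm).comp measurable_fst
  have hzero : ∀ s, (∫⁻ ω, ‖M.ξ t s ω‖ₑ ∂P = 0 ↔ M.ξ t s =ᵐ[P] 0) := fun s => by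
    rw [lintegral_eq_zero_iff (M.measurable_ξ t s).enorm]
    exact ⟨fun h => h.mono fun ω hω => by simpa using hω, fun h => h.mono fun ω hω => by simpa using hω⟩
  have h1 : ∀ᵐ p : ℝ≥0 × Ω ∂((volume : Measure ℝ≥0).restrict (Set.Ioc t T)).prod P,
      ∫⁻ ω, ‖M.ξ t p.1 ω‖ₑ ∂P ≠ 0 ∨ M.ξ t p.1 p.2 = 0 := by
    rw [Measure.ae_prod_iff_ae_ae (p := fun p : ℝ≥0 × Ω => ∫⁻ ω, ‖M.ξ t p.1 ω‖ₑ ∂P ≠ 0 ∨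
      M.ξ t p.1 p.2 = 0) (((hEm (measurableSet_singleton 0)).compl).union
      (hm (measurableSet_singleton 0)))]
    refine ae_of_all _ fun s => ?_
    by_cases h : ∫⁻ ω, ‖M.ξ t s ω‖ₑ ∂P = 0
    · exact ((hzero s).1 h).mono fun ω hω => Or.inr hω
    · exact ae_of_all _ fun ω => Or.inl h
  filter_upwards [ae_ae_of_ae_prod_swap h1] with ω hω
  filter_upwards [hω, ae_mono hsub (M.ae_variance_eq_zero_or_Dxi_eq hg hA hΦ),
    ae_mono hsub (M.ae_integrable_initial T), ae_restrict_mem measurableSet_Ioc] with s h2 h3 h4 h5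
  rcases h3 with h3 | h3
  · have h6 := (hzero s).2 (M.ξ_eq_zero_of_variance_eq_zero h5.1.le h4 h3)
    rw [h2.resolve_left (not_not.2 h6), zero_mul, zero_mul]
  · rw [h3]

end AFVModel

theorem mainTheorem9 {Ω : Type*} [mΩ : MeasurableSpace Ω] (P : Measure Ω) [IsProbabilityMeasure P]
    (κ : ℝ → ℝ) (ρ : ℝ) (M : AFVModel P κ ρ) (T : ℝ≥0)
    (𝕋 : DiamondTree) (h𝕋 : 𝕋 ≠ DiamondTree.leaf) :
    M.TreeWellDefined T (DiamondTree.node 𝕋 DiamondTree.leaf) ∧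
    (∃ (Φ : ℝ≥0 → (ℝ≥0 → ℝ) → ℝ) (δ : ℝ≥0 → ℝ≥0 → ℝ), M.IsCurveFunctional T (M.tree T 𝕋) Φ δ) ∧
    ∀ (Φ : ℝ≥0 → (ℝ≥0 → ℝ) → ℝ) (δ : ℝ≥0 → ℝ≥0 → ℝ), M.IsCurveFunctional T (M.tree T 𝕋) Φ δ →
      ∀ t ≤ T, ∀ᵐ ω ∂P,
        IntegrableOn (fun s => M.ξ t s ω * Dxi κ T s (δ s)) (Set.Ioc t T) ∧
        diamond M.𝓕 P T (M.tree T 𝕋) M.X t ω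
          = ρ * ∫ s in Set.Ioc t T, M.ξ t s ω * Dxi κ T s (δ s) := by
  obtain ⟨hwd, g, hg, hA⟩ := M.tree_eq_tail T 𝕋 h𝕋
  have hD := M.isBddMeasurable_Dxi T hg
  -- The tree is driven by W with h = `Dxi` of its weight, the log-price by Z with h' = 1, so c = ρ.
  obtain ⟨hI, hd⟩ := M.hasIntegrableCovariation_and_diamond M.W_brownian M.Z_brownian
    (fun T => (M.correlation T).symm) hD (h' := fun _ => 1) ⟨measurable_const, 1, fun _ => by simp⟩
    (M.isItoProcess_of_ae_eq_tail hg hA) (M.isItoProcess_X T)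
  refine ⟨⟨hwd, trivial, hI⟩, ⟨_, _, M.isCurveFunctional_of_ae_eq_tail hg hA⟩,
    fun Φ δ hΦ t ht => ?_⟩
  filter_upwards [hd t ht, M.ae_ξ_mul_Dxi_eq hg hA hΦ t, (M.integrable_curve t T).prod_left_ae]
    with ω h1 h2 h3
  -- Integrability and value are known for the weight g and pass to δ, since the two integrands
  -- agree for almost every s.
  refine ⟨(hD.integrable_mul h3 measurable_id).congr (h2.mono fun s hs => hs.symm), ?_⟩
  rw [h1, integral_congr_ae h2, AFVModel.tail, ← integral_const_mul]
  refine integral_congr_ae (ae_of_all _ fun s => ?_)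
  ring
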